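/- For a nonnegative integer $p$ let $\|x\|_p=\bigl(\sum_i|x[i]|^p\bigr)^{1/p}$ if $p\ge 1$, and let $\|x\|_0$ be the number of nonzero entries of $x$. An instance of Parameterized Equal Clustering under $\ell_p$ is a triple $(X,k,B)$, where $X=\{x_1,\dots,x_n\}$ is a collection (repetitions allowed) of $n$ points of $\mathbb{Z}^d$, $k$ is a positive integer dividing $n$, and $B\ge 0$ is an integer, the parameter. A solution is an equal $k$-clustering, that is, a partition of $X$ into clusters $X_1,\dots,X_k$ with $|X_1|=\dots=|X_k|=n/k$. Its cost is $\sum_{i=1}^k\min_{c\in\mathbb{R}^d}\sum_{x\in X_i}\|c-x\|_p$, and its value $\mathrm{cost}_p^B(X_1,\dots,X_k)$ is this cost if the cost is at most $B$, and $B+1$ otherwise. Let $\mathrm{Opt}(X,k,B)$ be the minimum value of a solution. The ratio of a value to the optimum is taken to be $1$ when the optimum is $0$. Theorem. For every fixed integer $p\ge 0$, Parameterized Equal Clustering under $\ell_p$, parameterized by $B$, has a $2$-approximate polynomial kernel. That is, there are a polynomial $g$, a polynomial-time reduction algorithm that turns every instance $(X,k,B)$ into an instance $(X',k',B')$ whose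 encoding length plus $B'$ is at most $g(B)$, and a polynomial-time solution-lifting algorithm that, given $(X,k,B)$, the produced $(X',k',B')$ and an equal $k'$-clustering $X'_1,\dots,X'_{k'}$ of $X'$, computes an equal $k$-clustering $X_1,\dots,X_k$ of $X$ with $$\frac{\mathrm{cost}_p^{B}(X_1,\dots,X_k)}{\mathrm{Opt}(X,k,B)}\le 2\cdot\frac{\mathrm{cost}_p^{B'}(X'_1,\dots,X'_{k'})}{\mathrm{Opt}(X',k',B')}.$$ Moreover, there is a constant $C$ depending only on $p$ such that, with $b=\max(B,1)$, the collection $X'$ always consists of at most $Cb^2$ points of $\mathbb{Z}^{d'}$ with $d'\le Cb^{p+2}$, and every coordinate of every point has absolute value at most $Cb^3$. -/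

import Mathlib

/-! ## A machine model with a running time

Programs work on binary trees, the data of the `WHILE` language. The current value can be split,
paired, tested and iterated on in a `while` loop. A basic operation costs the full size of the tree
that it reads, so sharing is never free: the running time bounds the size of every tree that a run
builds, and the model is polynomially equivalent to Turing machines. -/

namespace PolyModel

/-- Binary trees, the values that programs work on. -/
inductive Data : Type
  | nil : Data
  | cons : Data → Data → Data

/-- The number of nodes (leaves included) of a tree. -/
def Data.size : Data → ℕ
  | .nil => 1
  | .cons a b => 1 + a.size + b.size

/-- Left subtree (`nil` for the leaf). -/
def Data.left : Data → Data
  | .nil => .nil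
  | .cons a _ => a

/-- Right subtree (`nil` for the leaf). -/
def Data.right : Data → Data
  | .nil => .nil
  | .cons _ b => b

/-- Programs. Each one transforms a current value. -/
inductive Prog : Type
  /-- return the leaf -/
  | nil : Prog
  /-- return the current value -/
  | id : Prog
  /-- return the left subtree -/
  | left : Prog
  /-- return the right subtree -/
  | right : Prog
  /-- run both programs on the current value and join their results -/
  | pair : Prog → Prog → Prog
  /-- run the first program, then the second one on its result -/
  | seq : Prog → Prog → Prog
  /-- run the test; if its result is not the leaf, run the second program, otherwise the third -/
  | ite : Prog → Prog → Prog → Prog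
  /-- as long as the test does not return the leaf, replace the current value by the result of the
  second program -/
  | loop : Prog → Prog → Prog

/-- `Runs P x y t`: the program `P`, started on `x`, halts with result `y` after time `t`. -/
inductive Runs : Prog → Data → Data → ℕ → Prop
  | nil (x : Data) : Runs .nil x .nil x.size
  | id (x : Data) : Runs .id x x x.size
  | left (x : Data) : Runs .left x x.left x.size
  | right (x : Data) : Runs .right x x.right x.size
  | pair {P Q : Prog} {x y z : Data} {t u : ℕ} (hP : Runs P x y t) (hQ : Runs Q x z u) :
      Runs (.pair P Q) x (.cons y z) (t + u + 1)
  | seq {P Q : Prog} {x y z : Data} {t u : ℕ} (hP : Runs P x y t) (hQ : Runs Q y z u) :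
      Runs (.seq P Q) x z (t + u + 1)
  | ite_true {T P Q : Prog} {x a b y : Data} {t u : ℕ} (hT : Runs T x (.cons a b) t)
      (hP : Runs P x y u) : Runs (.ite T P Q) x y (t + u + 1)
  | ite_false {T P Q : Prog} {x y : Data} {t u : ℕ} (hT : Runs T x .nil t)
      (hQ : Runs Q x y u) : Runs (.ite T P Q) x y (t + u + 1)
  | loop_done {T P : Prog} {x : Data} {t : ℕ} (hT : Runs T x .nil t) :
      Runs (.loop T P) x x (t + x.size + 1)
  | loop_step {T P : Prog} {x a b y z : Data} {t u v : ℕ} (hT : Runs T x (.cons a b) t)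
      (hP : Runs P x y u) (hL : Runs (.loop T P) y z v) :
      Runs (.loop T P) x z (t + u + v + 1)

/-- `f` is computed, with respect to the given encodings of inputs and outputs, by a program whose
running time is bounded by a polynomial in the size of the encoded input. -/
def PolyTime {α β : Type} (encα : α → Data) (encβ : β → Data) (f : α → β) : Prop :=
  ∃ (P : Prog) (q : Polynomial ℕ), ∀ a : α, ∃ t : ℕ,
    t ≤ q.eval (encα a).size ∧ Runs P (encα a) (encβ (f a)) t

/-! ### Encodings -/

/-- A bit. -/
def encBool : Bool → Data
  | false => .nil
  | true => .cons .nil .nil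

/-- A list of encoded objects. -/
def encList : List Data → Data
  | [] => .nil
  | a :: l => .cons a (encList l)

/-- A natural number, in binary (least significant bit first). -/
def encNat (m : ℕ) : Data := encList (m.bits.map encBool)

/-- An integer: its sign and its absolute value in binary. -/
def encInt (z : ℤ) : Data := .cons (encBool (decide (z < 0))) (encNat z.natAbs)

end PolyModel

/-! ## Parameterized minimization problems and lossy kernels -/

namespace LossyKernel

open PolyModel

/-- A parameterized minimization problem: instances, each with its parameter, the (feasible)
solutions of each instance, the value of each solution, and encodings of instances and solutions
as inputs of programs. -/
structure ParamMinProblem where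
  Inst : Type
  param : Inst → ℕ
  Sol : Inst → Type
  value : (I : Inst) → Sol I → ℝ
  encInst : Inst → Data
  encSol : (I : Inst) → Sol I → Data

namespace ParamMinProblem

variable (P : ParamMinProblem)

/-- The optimum value of an instance. -/
noncomputable def opt (I : P.Inst) : ℝ := ⨅ s : P.Sol I, P.value I s

/-- The ratio of the value of a solution to the optimum, which is `1` by convention when the
optimum is `0`. -/
noncomputable def ratio (I : P.Inst) (s : P.Sol I) : ℝ :=
  if P.opt I = 0 then 1 else P.value I s / P.opt I

/-- An `α`-approximate kernel of size `g`: a reduction algorithm `R` and a solution-lifting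
algorithm `L`, which is given the instance `I`, the reduced instance `R I` and a solution of the
reduced instance. Both run in polynomial time. -/
structure IsApproxKernel (α : ℝ) (g : ℕ → ℕ) (R : P.Inst → P.Inst)
    (L : (I : P.Inst) → P.Sol (R I) → P.Sol I) : Prop where
  reduce_polyTime : PolyTime P.encInst P.encInst R
  lift_polyTime :
    PolyTime
      (fun a : (I : P.Inst) × P.Sol (R I) =>
        .cons (P.encInst a.1) (.cons (P.encInst (R a.1)) (P.encSol (R a.1) a.2)))
      (fun b : (I : P.Inst) × P.Sol I => P.encSol b.1 b.2)
      (fun a => ⟨a.1, L a.1 a.2⟩)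
  size_le : ∀ I : P.Inst, (P.encInst (R I)).size + P.param (R I) ≤ g (P.param I)
  ratio_le : ∀ (I : P.Inst) (s' : P.Sol (R I)),
    P.ratio I (L I s') ≤ α * P.ratio (R I) s'

end ParamMinProblem

end LossyKernel

/-! ## Parameterized Equal Clustering -/

namespace EqualClustering

open PolyModel LossyKernel

/-- The `ℓ_p`-norm of a real vector; for `p = 0` the number of its nonzero entries. -/
noncomputable def lpNorm (p : ℕ) {d : ℕ} (x : Fin d → ℝ) : ℝ :=
  if p = 0 then ((Finset.univ.filter (fun h => x h ≠ 0)).card : ℝ)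
  else (∑ h, |x h| ^ p) ^ (1 / (p : ℝ))

/-- An instance: a collection of `n` (not necessarily distinct) points of `ℤ^d`, a positive
number `k` of clusters that divides `n`, and a budget `B`. -/
structure Instance where
  d : ℕ
  n : ℕ
  pts : Fin n → Fin d → ℤ
  k : ℕ
  k_pos : 0 < k
  k_dvd : k ∣ n
  B : ℕ

/-- An equal `k`-clustering: every point is assigned to one of `k` clusters, and every cluster
receives exactly `n / k` points. -/
structure Clustering (I : Instance) where
  assign : Fin I.n → Fin I.k
  card_eq : ∀ j : Fin I.k, (Finset.univ.filter (fun i => assign i = j)).card = I.n / I.k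

/-- The cost of the subcollection of points with indices in `X`: the least sum of distances to a
common real median. -/
noncomputable def clusterCost (p : ℕ) (I : Instance) (X : Finset (Fin I.n)) : ℝ :=
  ⨅ c : Fin I.d → ℝ, ∑ i ∈ X, lpNorm p (fun h => c h - (I.pts i h : ℝ))

/-- The cost of an equal clustering: the sum of the costs of its clusters. -/
noncomputable def cost (p : ℕ) (I : Instance) (K : Clustering I) : ℝ :=
  ∑ j : Fin I.k, clusterCost p I (Finset.univ.filter (fun i => K.assign i = j))

/-- The cost of an equal clustering, replaced by `B + 1` when it exceeds the budget `B`. -/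
noncomputable def budgetCost (p : ℕ) (I : Instance) (K : Clustering I) : ℝ :=
  if cost p I K ≤ (I.B : ℝ) then cost p I K else (I.B : ℝ) + 1

/-- The encoding of an instance: `d`, `k` and `B` in binary and the list of the points, each being
the list of its coordinates in binary. -/
def encInstance (I : Instance) : Data :=
  encList [encNat I.d, encNat I.k, encNat I.B,
    encList (List.ofFn fun i => encList (List.ofFn fun h => encInt (I.pts i h)))]

/-- The encoding of a clustering: the list of the numbers of the clusters of the points. -/
def encClustering (I : Instance) (K : Clustering I) : Data :=
  encList (List.ofFn fun i => encNat (K.assign i : ℕ))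

/-- Parameterized Equal Clustering under the `ℓ_p`-norm, parameterized by the budget. -/
noncomputable def problem (p : ℕ) : ParamMinProblem where
  Inst := Instance
  param := Instance.B
  Sol := Clustering
  value := budgetCost p
  encInst := encInstance
  encSol := encClustering

end EqualClustering

/-! Write s = n/k. Groups of s equal points are formed greedily until every point has fewer than s
open copies, and each group becomes a cluster of cost 0. Only this step loses a factor. Given a
clustering with medians, let m(t,j) be the number of points of group t in cluster j. Replacing the
median of cluster j by the point of group t, at distance δ from it, raises the cost by at most (s -
2m(t,j))δ. The matrix m/s is a fractional injection of groups into clusters, and Birkhoff's theorem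
rounds it (`exists_injective_sum_le`) to an injection whose total increase is at most (1 - 2/s)D,
where D = ∑ m(t,j)δ is at most the old cost; here m ≤ m² is used. Once the chosen clusters have
group points as medians, swaps bring every group into its cluster for free (`exists_exchange`). If s
exceeds twice the cost, majority points are optimal medians already and nothing is lost. The outcome
is `IsGrouping.exists_respectsGroups`. The factor 2 - 2/s, slightly better than 2, keeps the new
cost within B when 2·Opt < B + 1; when 2·Opt ≥ B + 1, every solution is 2-approximate, since values
are capped at B + 1.

The remaining steps lose nothing. Different lattice points have distance at least 1. A cluster that
is not a group contains two different points, so it costs at least 1, and t ≥ 2 different points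
cost at least t/2. Hence at most B such clusters and 2B different open points remain. If s > 2B + 1,
let e = s - (2B + 1). In a clustering of cost at most B, each non-group cluster has a majority point
with at least e + B + 1 copies, these points differ from cluster to cluster, and they are exactly
the points with that many open copies. So e copies of each can be deleted
(`IsPruning.exists_restrict`) and put back later (`IsKernelization.exists_placement`), and clusters
of 2B + 1 points remain.

Finally the coordinates are compressed. Points that share a cluster of cost at most B are within
distance B. Joining all points that might be that close gives components; points are recorded
relative to a base point of their component, coordinates in which everything then vanishes are
dropped, and repeated labels keep different components more than B apart. For p = 0 only equality of
coordinates matters, so coordinates are first replaced by ranks. Cheap clusters cost the same before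
and after (`IsNewPoints.cost_map_eq`, `IsNewPoints.cost_eq_map`).

Both algorithms are written as functions on lists, whose polynomial running time follows from
closure properties of `IsPoly`; the essential one is the fold with polynomially bounded accumulators
(`IsPoly.foldl`). The ratio is put together in `ratio_lift_le`. -/

namespace PolyModel

/-! ### Closure properties of polynomial time -/

open Polynomial

theorem eval_mono (q : ℕ[X]) {x y : ℕ} (h : x ≤ y) : q.eval x ≤ q.eval y := by
  induction q using Polynomial.induction_on' with
  | add p q hp hq => simpa using Nat.add_le_add hp hq
  | monomial n a => simpa using Nat.mul_le_mul_left a (Nat.pow_le_pow_left h n)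

theorem Data.size_pos (x : Data) : 0 < x.size := by
  cases x <;> simp only [Data.size] <;> omega

theorem Data.size_left_le (x : Data) : x.left.size ≤ x.size := by
  cases x <;> simp [Data.size, Data.left]; omega

theorem Data.size_right_le (x : Data) : x.right.size ≤ x.size := by
  cases x <;> simp [Data.size, Data.right]

/-- Every operation pays for the tree it reads, and pairing pays for both parts. This lets the time
of the second of two composed programs be bounded in terms of the original input. -/
theorem Runs.size_le {P : Prog} {x y : Data} {t : ℕ} (h : Runs P x y t) : y.size ≤ t := by
  induction h with
  | nil x => exact x.size_pos
  | id x => exact le_rfl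
  | left x => exact x.size_left_le
  | right x => exact x.size_right_le
  | pair _ _ h₁ h₂ => simp only [Data.size]; omega
  | seq _ _ _ h => omega
  | ite_true _ _ _ h => omega
  | ite_false _ _ _ h => omega
  | loop_done => omega
  | loop_step _ _ _ _ _ h => omega

section General

variable {α β γ : Type} {eα : α → Data} {eβ : β → Data} {eγ : γ → Data}

theorem PolyTime.size_le {f : α → β} (h : PolyTime eα eβ f) :
    ∃ q : ℕ[X], ∀ a, (eβ (f a)).size ≤ q.eval (eα a).size := by
  obtain ⟨P, q, h⟩ := h
  refine ⟨q, fun a => ?_⟩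
  obtain ⟨t, ht, hr⟩ := h a
  exact hr.size_le.trans ht

theorem PolyTime.of_eq {f : α → β} (h : ∀ a, eα a = eβ (f a)) : PolyTime eα eβ f :=
  ⟨.id, X, fun a => ⟨(eα a).size, by simp, (h a) ▸ (Runs.id (eα a) : Runs .id (eα a) (eα a) _)⟩⟩

theorem PolyTime.of_left {f : α → β} (h : ∀ a, (eα a).left = eβ (f a)) : PolyTime eα eβ f :=
  ⟨.left, X, fun a => ⟨_, by simp, h a ▸ Runs.left (eα a)⟩⟩

theorem PolyTime.of_right {f : α → β} (h : ∀ a, (eα a).right = eβ (f a)) : PolyTime eα eβ f :=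
  ⟨.right, X, fun a => ⟨_, by simp, h a ▸ Runs.right (eα a)⟩⟩

theorem PolyTime.comp {g : β → γ} {f : α → β} (hg : PolyTime eβ eγ g) (hf : PolyTime eα eβ f) :
    PolyTime eα eγ (fun a => g (f a)) := by
  obtain ⟨P, q, hP⟩ := hf
  obtain ⟨Q, r, hQ⟩ := hg
  refine ⟨.seq P Q, q + r.comp q + 1, fun a => ?_⟩
  obtain ⟨t, ht, hr⟩ := hP a
  obtain ⟨u, hu, hr'⟩ := hQ (f a)
  have := eval_mono r (hr.size_le.trans ht)
  exact ⟨_, by simp only [eval_add, eval_comp, eval_one]; omega, hr.seq hr'⟩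

theorem PolyTime.pair {g : α → γ} {f : α → β} (hf : PolyTime eα eβ f) (hg : PolyTime eα eγ g) :
    PolyTime eα (fun y : β × γ => .cons (eβ y.1) (eγ y.2)) (fun a => (f a, g a)) := by
  obtain ⟨P, q, hP⟩ := hf
  obtain ⟨Q, r, hQ⟩ := hg
  refine ⟨.pair P Q, q + r + 1, fun a => ?_⟩
  obtain ⟨t, ht, hr⟩ := hP a
  obtain ⟨u, hu, hr'⟩ := hQ a
  exact ⟨_, by simp only [eval_add, eval_one]; omega, hr.pair hr'⟩

/-- Each branch need only be correct on its own side of the test, hence the subtypes; taking the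
head of a nonempty list relies on this. -/
theorem PolyTime.branch {c : α → γ} {f g : α → β} (p : α → Prop) [DecidablePred p]
    (hc : PolyTime eα eγ c)
    (hp : ∀ a, p a → ∃ u v, eγ (c a) = .cons u v) (hn : ∀ a, ¬ p a → eγ (c a) = .nil)
    (hf : PolyTime (fun a : {a // p a} => eα a) eβ (fun a => f a))
    (hg : PolyTime (fun a : {a // ¬ p a} => eα a) eβ (fun a => g a)) :
    PolyTime eα eβ (fun a => if p a then f a else g a) := by
  obtain ⟨T, r, hT⟩ := hc
  obtain ⟨P, q, hP⟩ := hf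
  obtain ⟨Q, q', hQ⟩ := hg
  refine ⟨.ite T P Q, r + q + q' + 1, fun a => ?_⟩
  obtain ⟨t, ht, hr⟩ := hT a
  by_cases h : p a
  · obtain ⟨u, hu, hr'⟩ := hP ⟨a, h⟩
    obtain ⟨v, w, hvw⟩ := hp a h
    rw [hvw] at hr
    simp only [h, if_true]
    refine ⟨_, ?_, hr.ite_true hr'⟩
    simp only [eval_add, eval_one] at *; omega
  · obtain ⟨u, hu, hr'⟩ := hQ ⟨a, h⟩
    rw [hn a h] at hr
    simp only [h, if_false]
    refine ⟨_, ?_, hr.ite_false hr'⟩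
    simp only [eval_add, eval_one] at *; omega

theorem PolyTime.restrict {f : α → β} (h : PolyTime eα eβ f) (p : α → Prop) :
    PolyTime (fun a : {a // p a} => eα a) eβ (fun a => f a) := by
  obtain ⟨P, q, h⟩ := h
  exact ⟨P, q, fun a => h a⟩

theorem PolyTime.const (D : Data) : PolyTime eα (fun _ : Unit => D) (fun _ => ()) := by
  induction D with
  | nil => exact ⟨.nil, X, fun a => ⟨_, by simp, .nil _⟩⟩
  | cons a b ha hb =>
    have := ha.pair hb
    obtain ⟨P, q, h⟩ := this
    exact ⟨P, q, h⟩

end General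

/-- With τ bounding one test, one execution of the body and the size of the last state, each of the
m + 1 rounds costs at most 2τ + 1. -/
theorem Runs.loop_iterate {T P : Prog} (τ : ℕ) :
    ∀ (m : ℕ) (st : ℕ → Data),
      (∀ i < m, ∃ a b t, t ≤ τ ∧ Runs T (st i) (.cons a b) t) →
      (∃ t, t ≤ τ ∧ Runs T (st m) .nil t) →
      (∀ i < m, ∃ t, t ≤ τ ∧ Runs P (st i) (st (i + 1)) t) →
      (st m).size ≤ τ →
      ∃ t, t ≤ (m + 1) * (2 * τ + 1) ∧ Runs (.loop T P) (st 0) (st m) t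
  | 0, st, _, ⟨t, ht, hr⟩, _, hs => ⟨_, by omega, hr.loop_done⟩
  | m + 1, st, hT, hm, hP, hs => by
    obtain ⟨v, hv, hL⟩ := Runs.loop_iterate τ m (fun i => st (i + 1)) (fun i hi => hT _ (by omega)) hm
      (fun i hi => hP _ (by omega)) hs
    obtain ⟨a, b, t, ht, hr⟩ := hT 0 (by omega)
    obtain ⟨u, hu, hr'⟩ := hP 0 (by omega)
    refine ⟨_, ?_, hr.loop_step hr' hL⟩
    have : (m + 1 + 1) * (2 * τ + 1) = (m + 1) * (2 * τ + 1) + 2 * τ + 1 := by ring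
    omega

/-- Types whose elements are inputs and outputs of programs. -/
class Enc (α : Type) where
  enc : α → Data

open Enc (enc)

instance : Enc Bool := ⟨encBool⟩
instance : Enc ℕ := ⟨encNat⟩
instance : Enc ℤ := ⟨encInt⟩
instance {α β : Type} [Enc α] [Enc β] : Enc (α × β) := ⟨fun x => .cons (enc x.1) (enc x.2)⟩
instance {α : Type} [Enc α] : Enc (List α) := ⟨fun l => encList (l.map enc)⟩

end PolyModel

/-! ### Polynomial-time functions and folds over lists -/

namespace PolyModel

open Enc (enc)
open Polynomial

/-- `f` is computable in polynomial time, with respect to the standard encodings. -/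
@[fun_prop]
def IsPoly {α β : Type} [Enc α] [Enc β] (f : α → β) : Prop := PolyTime enc enc f

section Basic

variable {α β γ δ : Type} [Enc α] [Enc β] [Enc γ] [Enc δ]

@[fun_prop]
theorem IsPoly.id : IsPoly (fun a : α => a) := PolyTime.of_eq fun _ => rfl

@[fun_prop]
theorem IsPoly.const (b : β) : IsPoly (fun _ : α => b) := by
  obtain ⟨P, q, h⟩ := PolyTime.const (eα := (enc : α → Data)) (enc b)
  exact ⟨P, q, h⟩

@[fun_prop]
theorem IsPoly.comp {g : β → γ} {f : α → β} (hg : IsPoly g) (hf : IsPoly f) :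
    IsPoly (fun a => g (f a)) := PolyTime.comp hg hf

@[fun_prop]
theorem IsPoly.prodMk {f : α → β} {g : α → γ} (hf : IsPoly f) (hg : IsPoly g) :
    IsPoly (fun a => (f a, g a)) := PolyTime.pair hf hg

@[fun_prop]
theorem IsPoly.fst {f : α → β × γ} (hf : IsPoly f) : IsPoly (fun a => (f a).1) :=
  PolyTime.comp (PolyTime.of_left fun _ => rfl : IsPoly (Prod.fst : β × γ → β)) hf

@[fun_prop]
theorem IsPoly.snd {f : α → β × γ} (hf : IsPoly f) : IsPoly (fun a => (f a).2) :=
  PolyTime.comp (PolyTime.of_right fun _ => rfl : IsPoly (Prod.snd : β × γ → γ)) hf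

@[fun_prop]
theorem IsPoly.cons {f : α → β} {g : α → List β} (hf : IsPoly f) (hg : IsPoly g) :
    IsPoly (fun a => f a :: g a) := by
  obtain ⟨P, q, h⟩ := PolyTime.pair hf hg
  exact ⟨P, q, h⟩

@[fun_prop]
theorem IsPoly.tail {f : α → List β} (hf : IsPoly f) : IsPoly (fun a => (f a).tail) :=
  PolyTime.comp (PolyTime.of_right (by rintro (_ | _) <;> rfl) : IsPoly (List.tail (α := β))) hf

@[fun_prop]
theorem IsPoly.ite {p : α → Prop} [DecidablePred p] {f g : α → β}
    (hp : IsPoly (fun a => decide (p a))) (hf : IsPoly f) (hg : IsPoly g) :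
    IsPoly (fun a => if p a then f a else g a) :=
  PolyTime.branch _ hp (fun a h => by rw [decide_eq_true h]; exact ⟨_, _, rfl⟩)
    (fun a h => by rw [decide_eq_false h]; rfl) (PolyTime.restrict hf _) (PolyTime.restrict hg _)

@[fun_prop]
theorem IsPoly.decideEqTrue {b : α → Bool} (hb : IsPoly b) :
    IsPoly (fun a => decide (b a = true)) := by
  simpa using hb

/-- A list can serve as its own test, because only the empty list is encoded by the leaf. -/
theorem IsPoly.of_isEmpty {l : α → List β} {f g : α → γ} (hl : IsPoly l)
    (hf : PolyTime (fun a : {a // ¬ l a = []} => enc a.1) enc (fun a => f a)) (hg : IsPoly g) :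
    IsPoly (fun a => if ¬ l a = [] then f a else g a) :=
  PolyTime.branch _ hl (fun a h => by
      obtain ⟨b, l', h⟩ := List.exists_cons_of_ne_nil h
      rw [h]; exact ⟨_, _, rfl⟩)
    (fun a h => by rw [not_not.1 h]; rfl) hf (PolyTime.restrict hg _)

@[fun_prop]
theorem IsPoly.isEmpty {l : α → List β} (hl : IsPoly l) : IsPoly (fun a => (l a).isEmpty) := by
  have := IsPoly.of_isEmpty hl (f := fun _ => false) (PolyTime.restrict (IsPoly.const _) _) (IsPoly.const true)
  convert this using 2 with a
  cases l a <;> simp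

@[fun_prop]
theorem IsPoly.headD {l : α → List β} {f : α → β} (hl : IsPoly l) (hf : IsPoly f) :
    IsPoly (fun a => (l a).headD (f a)) := by
  have h1 : PolyTime (fun a : {a // ¬ l a = []} => enc a.1) enc
      (fun a => (l a.1).head a.2) := by
    have h2 : PolyTime (fun l : {l : List β // ¬ l = []} => enc l.1) enc (fun l => l.1.head l.2) :=
      PolyTime.of_left (by rintro ⟨_ | _, h⟩ <;> trivial)
    have h3 : PolyTime (fun a : {a // ¬ l a = []} => enc a.1)
        (fun l : {l : List β // ¬ l = []} => enc l.1) (fun a => ⟨l a.1, a.2⟩) :=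
      PolyTime.restrict hl (fun a => ¬ l a = [])
    exact PolyTime.comp h2 h3
  have := IsPoly.of_isEmpty hl (f := fun a => (l a).headD (f a)) (by
    convert h1 using 2 with a
    obtain ⟨a, ha⟩ := a
    obtain ⟨b, l', h⟩ := List.exists_cons_of_ne_nil ha
    simp [h]) hf
  convert this using 2 with a
  cases l a <;> simp

theorem IsPoly.size_le {f : α → β} (hf : IsPoly f) :
    ∃ q : ℕ[X], ∀ a, (enc (f a)).size ≤ q.eval (enc a).size := PolyTime.size_le hf

theorem size_prod (x : α × β) : (enc x).size = 1 + (enc x.1).size + (enc x.2).size := rfl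
theorem size_nil : (enc ([] : List α)).size = 1 := rfl
theorem size_cons (a : α) (l : List α) : (enc (a :: l)).size = 1 + (enc a).size + (enc l).size := rfl

theorem size_list (l : List α) : (enc l).size = (l.map fun a => (enc a).size + 1).sum + 1 := by
  induction l with
  | nil => rfl
  | cons a l ih => rw [size_cons, ih, List.map_cons, List.sum_cons]; omega

theorem length_lt_size (l : List α) : l.length < (enc l).size := by
  induction l with
  | nil => simp [size_nil]
  | cons a l ih => rw [size_cons, List.length_cons]; omega

theorem size_lt_of_mem {l : List α} {a : α} (h : a ∈ l) : (enc a).size < (enc l).size := by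
  induction l with
  | nil => simp at h
  | cons b l ih =>
    rw [size_cons]
    rcases List.mem_cons.1 h with rfl | h
    · omega
    · have := ih h; omega

theorem size_le_of_sublist {l l' : List α} (h : List.Sublist l l') :
    (enc l).size ≤ (enc l').size := by
  induction h with
  | slnil => exact le_rfl
  | cons a _ ih => rw [size_cons]; omega
  | cons_cons a _ ih => rw [size_cons, size_cons]; omega

theorem size_le_of_forall {l : List α} {m b : ℕ} (hl : l.length ≤ m)
    (h : ∀ a ∈ l, (enc a).size ≤ b) : (enc l).size ≤ m * (b + 1) + 1 := by
  induction l generalizing m with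
  | nil => simp [size_nil]
  | cons a l ih =>
    obtain ⟨m, rfl⟩ : ∃ m', m = m' + 1 := ⟨m - 1, by simp at hl; omega⟩
    have h1 := ih (m := m) (by simpa using hl) (fun a ha => h a (List.mem_cons_of_mem _ ha))
    have h2 := h a List.mem_cons_self
    rw [size_cons, Nat.add_mul]; omega

/-- The loop works on triples of input, remaining list and accumulator. The accumulators that occur
are the folds of prefixes, so a polynomial bound on these bounds every round, and there are at most
as many rounds as list entries. -/
theorem IsPoly.foldl {l : α → List β} {s : α → γ} {f : α → γ → β → γ}
    (hl : IsPoly l) (hs : IsPoly s) (hf : IsPoly (fun x : α × γ × β => f x.1 x.2.1 x.2.2))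
    (q : ℕ[X])
    (hq : ∀ a l', l' <+: l a → (enc (l'.foldl (f a) (s a))).size ≤ q.eval (enc a).size) :
    IsPoly (fun a => (l a).foldl (f a) (s a)) := by
  have hstep : IsPoly (fun x : α × (β × List β) × γ => (x.1, x.2.1.2, f x.1 x.2.2 x.2.1.1)) := by
    refine .prodMk (by fun_prop) (.prodMk (by fun_prop) ?_)
    exact hf.comp (f := fun x : α × (β × List β) × γ => (x.1, x.2.2, x.2.1.1)) (by fun_prop)
  have hinit : IsPoly (fun a => (a, l a, s a)) := by fun_prop
  obtain ⟨P, p, hP⟩ := hstep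
  obtain ⟨P₀, p₀, hP₀⟩ := hinit
  obtain ⟨r, hr⟩ := hl.size_le
  -- σ bounds the size of every state, τ the time of one test and of one execution of the body.
  set σ : ℕ[X] := X + r + q + 2 with hσ
  set τ : ℕ[X] := 2 * σ + 1 + p.comp σ with hτ
  -- The test extracts the remaining list, which is the leaf exactly when the fold is finished; the
  -- last program extracts the accumulator.
  refine ⟨.seq P₀ (.seq (.loop (.seq .right .left) P) (.seq .right .right)),
    p₀ + ((r + 1) * (2 * τ + 1) + (2 * σ + 1) + 1) + 1, fun a => ?_⟩
  let st : ℕ → α × List β × γ := fun i => (a, (l a).drop i, ((l a).take i).foldl (f a) (s a))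
  have hst : ∀ i, (enc (st i)).size ≤ σ.eval (enc a).size := fun i => by
    have h1 := size_le_of_sublist (List.drop_sublist i (l a))
    have h2 := hq a _ (List.take_prefix i (l a))
    have h3 := hr a
    simp only [st, size_prod, hσ, eval_add, eval_X, eval_ofNat]
    omega
  have hτe : τ.eval (enc a).size = 2 * σ.eval (enc a).size + 1 + p.eval (σ.eval (enc a).size) := by simp [hτ, eval_comp]
  obtain ⟨t, ht, hR⟩ := Runs.loop_iterate (T := .seq .right .left) (P := P) (τ.eval (enc a).size) (l a).length
    (fun i => enc (st i)) (fun i hi => by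
      have h1 := (enc (st i)).size_right_le
      have h2 := hst i
      have h3 : (enc (st i)).right.left = .cons (enc (l a)[i]) (enc ((l a).drop (i + 1))) := by
        have : (enc (st i)).right.left = enc ((l a).drop i) := rfl
        rw [this, List.drop_eq_getElem_cons hi]; rfl
      exact ⟨_, _, _, by omega, h3 ▸ (Runs.right _).seq (Runs.left _)⟩)
    (by
      have h1 := (enc (st (l a).length)).size_right_le
      have h2 := hst (l a).length
      have h3 : (enc (st (l a).length)).right.left = .nil := by
        have : (enc (st (l a).length)).right.left = enc ((l a).drop (l a).length) := rfl
        rw [this, List.drop_length]; rfl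
      exact ⟨_, by omega, h3 ▸ (Runs.right _).seq (Runs.left _)⟩)
    (fun i hi => by
      obtain ⟨t, ht, h⟩ := hP (a, ((l a)[i], (l a).drop (i + 1)), ((l a).take i).foldl (f a) (s a))
      have h1 : enc (a, ((l a)[i], (l a).drop (i + 1)), ((l a).take i).foldl (f a) (s a)) =
          enc (st i) := by
        simp only [st, List.drop_eq_getElem_cons hi]; rfl
      have h2 : st (i + 1) =
          (a, (l a).drop (i + 1), f a (((l a).take i).foldl (f a) (s a)) (l a)[i]) := by
        simp only [st, List.take_succ_eq_append_getElem hi, List.foldl_append, List.foldl_cons,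
          List.foldl_nil]
      rw [h1] at ht h
      have h3 := eval_mono p (hst i)
      exact ⟨t, by omega, by rw [h2]; exact h⟩)
    (by have := hst (l a).length; omega)
  obtain ⟨t₀, ht₀, hR₀⟩ := hP₀ a
  have hend : (enc (st (l a).length)).right.right = enc ((l a).foldl (f a) (s a)) := by
    have : (enc (st (l a).length)).right.right =
      enc (((l a).take (l a).length).foldl (f a) (s a)) := rfl
    rw [this, List.take_length]
  have hlen : (l a).length + 1 ≤ r.eval (enc a).size + 1 := by
    have := length_lt_size (l a)
    have := hr a
    omega
  have h1 := (enc (st (l a).length)).size_right_le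
  have h2 := hst (l a).length
  refine ⟨_, ?_, hR₀.seq (hR.seq (hend ▸ (Runs.right _).seq (Runs.right _)))⟩
  have h4 := Nat.mul_le_mul_right (2 * τ.eval (enc a).size + 1) hlen
  simp only [eval_add, eval_mul, eval_ofNat, eval_one]
  omega

/-- Additive growth by a polynomial in the input, repeated at most once per list entry, remains
polynomial. -/
theorem IsPoly.foldl_of_growth {l : α → List β} {s : α → γ} {f : α → γ → β → γ}
    (hl : IsPoly l) (hs : IsPoly s) (hf : IsPoly (fun x : α × γ × β => f x.1 x.2.1 x.2.2))
    (q : ℕ[X])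
    (hq : ∀ a, ∀ b ∈ l a, ∀ c, (enc (f a c b)).size ≤ (enc c).size + q.eval (enc a).size) :
    IsPoly (fun a => (l a).foldl (f a) (s a)) := by
  obtain ⟨r, hr⟩ := hl.size_le
  obtain ⟨p, hp⟩ := hs.size_le
  refine IsPoly.foldl hl hs hf (p + r * q) fun a l' hl' => ?_
  have key : ∀ (l' : List β) (c : γ), (∀ b ∈ l', b ∈ l a) →
      (enc (l'.foldl (f a) c)).size ≤ (enc c).size + l'.length * q.eval (enc a).size := by
    intro l'
    induction l' with
    | nil => simp
    | cons b l' ih =>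
      intro c hc
      have h1 := ih (f a c b) (fun b hb => hc b (List.mem_cons_of_mem _ hb))
      have h2 := hq a b (hc b List.mem_cons_self) c
      rw [List.foldl_cons, List.length_cons, Nat.add_mul]
      omega
  have h1 := key l' (s a) (fun b hb => hl'.subset hb)
  have h2 := hp a
  have h3 : l'.length ≤ r.eval (enc a).size :=
    hl'.length_le.trans ((length_lt_size _).le.trans (hr a))
  have h4 := Nat.mul_le_mul_right (q.eval (enc a).size) h3
  simp only [eval_add, eval_mul]
  omega

end Basic

end PolyModel

/-! ### List operations in polynomial time -/

namespace PolyModel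

open Enc (enc)
open Polynomial

section ListFolds

variable {β γ : Type}

theorem foldl_filter_eq (p : β → Bool) (l : List β) (acc : List β) :
    l.foldl (fun acc b => if p b = true then b :: acc else acc) acc =
      (l.filter p).reverse ++ acc := by
  induction l generalizing acc with
  | nil => simp
  | cons b l ih =>
    by_cases h : p b = true
    · simp [ih, h]
    · simp [ih, h]

theorem foldl_zip_eq [Inhabited γ] (l : List β) (l' : List γ) (acc : List (β × γ)) :
    (l.foldl (fun (st : List γ × List (β × γ)) b =>
      (st.1.tail, if st.1.isEmpty = true then st.2 else (b, st.1.headD default) :: st.2))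
      (l', acc)).2 = (l.zip l').reverse ++ acc := by
  induction l generalizing l' acc with
  | nil => simp
  | cons b l ih =>
    rw [List.foldl_cons, ih]
    cases l' <;> simp

theorem foldl_const_eq_iterate (g : γ → γ) (l : List β) (s : γ) :
    l.foldl (fun s _ => g s) s = g^[l.length] s := by
  induction l generalizing s with
  | nil => rfl
  | cons b l ih => rw [List.foldl_cons, ih, List.length_cons, Function.iterate_succ_apply]

end ListFolds

section Lists

variable {α β γ δ : Type} [Enc α] [Enc β] [Enc γ] [Enc δ]

@[fun_prop]
theorem IsPoly.reverseAppend {l l' : α → List β} (hl : IsPoly l) (hl' : IsPoly l') :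
    IsPoly (fun a => (l a).reverse ++ l' a) := by
  obtain ⟨r, hr⟩ := hl.size_le
  have := IsPoly.foldl_of_growth (f := fun _ acc b => b :: acc) hl hl' (by fun_prop) (1 + r)
    (fun a b hb c => by
      have h1 := hr a
      have h2 := size_lt_of_mem hb
      simp only [size_cons, eval_add, eval_one]
      omega)
  convert this using 2 with a
  simp

@[fun_prop]
theorem IsPoly.reverse {l : α → List β} (hl : IsPoly l) : IsPoly (fun a => (l a).reverse) := by
  have h := IsPoly.reverseAppend hl (IsPoly.const ([] : List β))
  simpa only [List.append_nil] using h

@[fun_prop]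
theorem IsPoly.append {l l' : α → List β} (hl : IsPoly l) (hl' : IsPoly l') :
    IsPoly (fun a => l a ++ l' a) := by
  simpa using IsPoly.reverseAppend (IsPoly.reverse hl) hl'

@[fun_prop]
theorem IsPoly.map {l : α → List β} {g : α → β → γ} (hl : IsPoly l)
    (hg : IsPoly (fun z : α × β => g z.1 z.2)) : IsPoly (fun a => (l a).map (g a)) := by
  obtain ⟨r, hr⟩ := hl.size_le
  obtain ⟨q, hq⟩ := hg.size_le
  have h := IsPoly.foldl_of_growth (f := fun a acc b => g a b :: acc) hl (IsPoly.const ([] : List γ))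
    (IsPoly.cons (hg.comp (f := fun x : α × List γ × β => (x.1, x.2.2)) (by fun_prop)) (by fun_prop))
    (1 + q.comp (1 + X + r))
    (fun a b hb c => by
      have h1 := hr a
      have h2 := size_lt_of_mem hb
      have h3 := hq (a, b)
      have h4 := eval_mono q (x := (enc (a, b)).size) (y := 1 + (enc a).size + r.eval (enc a).size)
        (by rw [size_prod]; dsimp only; omega)
      simp only [size_cons, eval_add, eval_one, eval_comp, eval_X] at *
      omega)
  have h' := h.reverse
  convert h' using 2 with a
  simp

@[fun_prop]
theorem IsPoly.filter {l : α → List β} {p : α → β → Bool} (hl : IsPoly l)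
    (hp : IsPoly (fun z : α × β => p z.1 z.2)) : IsPoly (fun a => (l a).filter (p a)) := by
  obtain ⟨r, hr⟩ := hl.size_le
  have h := IsPoly.foldl_of_growth (f := fun a acc b => if p a b = true then b :: acc else acc) hl
    (IsPoly.const ([] : List β))
    (IsPoly.ite (hp.comp (f := fun x : α × List β × β => (x.1, x.2.2)) (by fun_prop)).decideEqTrue (by fun_prop)
      (by fun_prop))
    (1 + r)
    (fun a b hb c => by
      have h1 := hr a
      have h2 := size_lt_of_mem hb
      split_ifs <;> simp only [size_cons, eval_add, eval_one] <;> omega)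
  have h' := h.reverse
  convert h' using 2 with a
  simp [foldl_filter_eq]

@[fun_prop]
theorem IsPoly.not {p : α → Bool} (hp : IsPoly p) : IsPoly (fun a => !p a) := by
  have := IsPoly.ite hp.decideEqTrue (IsPoly.const false) (IsPoly.const true)
  convert this using 2 with a
  cases p a <;> rfl

@[fun_prop]
theorem IsPoly.and {p q : α → Bool} (hp : IsPoly p) (hq : IsPoly q) :
    IsPoly (fun a => p a && q a) := by
  have := IsPoly.ite hp.decideEqTrue hq (IsPoly.const false)
  convert this using 2 with a
  cases p a <;> rfl

@[fun_prop]
theorem IsPoly.or {p q : α → Bool} (hp : IsPoly p) (hq : IsPoly q) :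
    IsPoly (fun a => p a || q a) := by
  have := IsPoly.ite hp.decideEqTrue (IsPoly.const true) hq
  convert this using 2 with a
  cases p a <;> rfl

@[fun_prop]
theorem IsPoly.xor {p q : α → Bool} (hp : IsPoly p) (hq : IsPoly q) :
    IsPoly (fun a => p a ^^ q a) := by
  have := IsPoly.ite hp.decideEqTrue (IsPoly.not hq) hq
  convert this using 2 with a
  cases p a <;> simp

@[fun_prop]
theorem IsPoly.decideNot {p : α → Prop} [DecidablePred p] (hp : IsPoly (fun a => decide (p a))) :
    IsPoly (fun a => decide (¬ p a)) := by
  simpa using hp.not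

@[fun_prop]
theorem IsPoly.decideAnd {p q : α → Prop} [DecidablePred p] [DecidablePred q]
    (hp : IsPoly (fun a => decide (p a))) (hq : IsPoly (fun a => decide (q a))) :
    IsPoly (fun a => decide (p a ∧ q a)) := by
  simpa using hp.and hq

@[fun_prop]
theorem IsPoly.any {l : α → List β} {p : α → β → Bool} (hl : IsPoly l)
    (hp : IsPoly (fun z : α × β => p z.1 z.2)) : IsPoly (fun a => (l a).any (p a)) := by
  have h : IsPoly (fun a => !((l a).filter (p a)).isEmpty) := by fun_prop
  convert h using 2 with a
  rw [Bool.eq_iff_iff]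
  simp

@[fun_prop]
theorem IsPoly.all {l : α → List β} {p : α → β → Bool} (hl : IsPoly l)
    (hp : IsPoly (fun z : α × β => p z.1 z.2)) : IsPoly (fun a => (l a).all (p a)) := by
  have h : IsPoly (fun a => !((l a).any (fun b => !p a b))) := by
    have : IsPoly (fun z : α × β => !p z.1 z.2) := hp.not
    fun_prop
  convert h using 2 with a
  rw [Bool.eq_iff_iff]
  simp

@[fun_prop]
theorem IsPoly.flatten {l : α → List (List β)} (hl : IsPoly l) :
    IsPoly (fun a => (l a).flatten) := by
  obtain ⟨r, hr⟩ := hl.size_le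
  have key : ∀ l l' : List β, (enc (l.reverse ++ l')).size ≤ (enc l').size + (enc l).size := by
    intro l l'
    simp only [size_list, List.map_append, List.sum_append, List.map_reverse, List.sum_reverse]
    omega
  have h := IsPoly.foldl_of_growth (f := fun a acc b => List.reverse b ++ acc) hl
    (IsPoly.const ([] : List β)) (by fun_prop) r
    (fun a b hb c => by
      have h1 := hr a
      have h2 := size_lt_of_mem hb
      have h3 := key b c
      omega)
  have h' := h.reverse
  convert h' using 2 with a
  have : ∀ (L : List (List β)) (acc : List β),
      L.foldl (fun acc b => List.reverse b ++ acc) acc = L.flatten.reverse ++ acc := by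
    intro L
    induction L with
    | nil => simp
    | cons b L ih => intro acc; simp [ih]
  simp [this]

@[fun_prop]
theorem IsPoly.zip [Inhabited γ] {l : α → List β} {l' : α → List γ} (hl : IsPoly l)
    (hl' : IsPoly l') : IsPoly (fun a => (l a).zip (l' a)) := by
  obtain ⟨r, hr⟩ := hl.size_le
  have h := IsPoly.foldl_of_growth (f := fun _ (st : List γ × List (β × γ)) b =>
      (st.1.tail, if st.1.isEmpty = true then st.2 else (b, st.1.headD default) :: st.2)) hl
    (s := fun a => (l' a, [])) (by fun_prop) (by fun_prop) (1 + r)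
    (fun a b hb c => by
      have h1 := hr a
      have h2 := size_lt_of_mem hb
      obtain ⟨_ | ⟨x, c⟩, d⟩ := c
      · simp [size_prod]
      · simp only [size_prod, size_cons, List.tail_cons, List.isEmpty_cons, List.headD_cons,
          eval_add, eval_one, Bool.false_eq_true, if_false]
        omega)
  have h' := h.snd.reverse
  convert h' using 2 with a
  rw [foldl_zip_eq]
  simp

theorem IsPoly.foldr {l : α → List β} {s : α → γ} {f : α → β → γ → γ}
    (hl : IsPoly l) (hs : IsPoly s) (hf : IsPoly (fun x : α × β × γ => f x.1 x.2.1 x.2.2))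
    (q : ℕ[X])
    (hq : ∀ a l', l' <:+ l a → (enc (l'.foldr (f a) (s a))).size ≤ q.eval (enc a).size) :
    IsPoly (fun a => (l a).foldr (f a) (s a)) := by
  have := IsPoly.foldl (f := fun a c b => f a b c) hl.reverse hs
    (hf.comp (f := fun x : α × γ × β => (x.1, x.2.2, x.2.1)) (by fun_prop)) q (fun a l' hl' => by
      have := hq a l'.reverse (by simpa using List.reverse_suffix.2 hl')
      rwa [List.foldr_reverse] at this)
  convert this using 2 with a
  simp

end Lists

/-! ### Arithmetic on binary numbers -/

section Nat

variable {α β γ δ : Type} [Enc α] [Enc β] [Enc γ] [Enc δ]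

theorem enc_nat (m : ℕ) : enc m = enc m.bits := rfl

theorem size_nat_le (m : ℕ) : (enc m).size ≤ 4 * m.size + 1 := by
  rw [enc_nat, ← Nat.size_eq_bits_len]
  have := size_le_of_forall (l := m.bits) (b := 3) le_rfl (fun b _ => by cases b <;> decide)
  omega

theorem size_nat_le_of_lt {m i : ℕ} (h : m < 2 ^ i) : (enc m).size ≤ 4 * i + 1 := by
  have := Nat.size_le.2 h
  have := size_nat_le m
  omega

theorem size_nat_le_self (m : ℕ) : (enc m).size ≤ 4 * m + 1 := size_nat_le_of_lt Nat.lt_two_pow_self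

theorem lt_two_pow_size (m : ℕ) : m < 2 ^ (enc m).size := by
  refine (Nat.lt_size_self m).trans_le (Nat.pow_le_pow_right two_pos ?_)
  rw [enc_nat, ← Nat.size_eq_bits_len]
  exact (length_lt_size _).le

@[fun_prop]
theorem IsPoly.bits {f : α → ℕ} (hf : IsPoly f) : IsPoly (fun a => (f a).bits) :=
  PolyTime.comp (PolyTime.of_eq fun _ => rfl : IsPoly Nat.bits) hf

/-- A number and the list of its bits are the same tree, so the same program computes both. -/
theorem IsPoly.of_bits {f : α → ℕ} (hf : IsPoly (fun a => (f a).bits)) : IsPoly f := by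
  obtain ⟨P, q, h⟩ := hf
  exact ⟨P, q, h⟩

theorem isEmpty_bits (m : ℕ) : m.bits.isEmpty = decide (m = 0) := by
  rw [Bool.eq_iff_iff]
  simp [← List.length_eq_zero_iff, Nat.size_eq_bits_len, Nat.size_eq_zero]

/-- The test prevents a leading zero digit, as zero has the empty list of bits. -/
theorem bits_bit (b : Bool) (m : ℕ) :
    (Nat.bit b m).bits = if (m.bits.isEmpty && !b) = true then [] else b :: m.bits := by
  rw [isEmpty_bits]
  by_cases h : m = 0
  · subst h; cases b <;> simp
  · rw [Nat.bits_append_bit _ _ (fun h' => absurd h' h)]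
    simp [h]

@[fun_prop]
theorem IsPoly.bit {b : α → Bool} {f : α → ℕ} (hb : IsPoly b) (hf : IsPoly f) :
    IsPoly (fun a => Nat.bit (b a) (f a)) := by
  refine IsPoly.of_bits ?_
  simp only [bits_bit]
  fun_prop

/-- The value of a list of binary digits, most significant first, preceded by a number. -/
def digitsValue (l : List Bool) (t : ℤ) : ℤ := l.foldl (fun t b => b.toNat + 2 * t) t

theorem digitsValue_natCast (l : List Bool) (t : ℕ) :
    digitsValue l t = (l.foldl (fun t b => Nat.bit b t) t : ℕ) := by
  induction l generalizing t with
  | nil => rfl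
  | cons b l ih =>
    simp only [digitsValue, List.foldl_cons] at ih ⊢
    rw [← ih, Nat.bit_val]
    push_cast
    ring_nf

theorem digitsValue_neg_one_neg (l : List Bool) {t : ℤ} (ht : t < 0) : digitsValue l t < 0 := by
  induction l generalizing t with
  | nil => exact ht
  | cons b l ih =>
    have hb : (b.toNat : ℤ) ≤ 1 := by cases b <;> simp
    exact ih (t := b.toNat + 2 * t) (by omega)

@[fun_prop]
theorem IsPoly.ofDigits {l : α → List Bool} (hl : IsPoly l) :
    IsPoly (fun a => (l a).foldl (fun t b => Nat.bit b t) 0) :=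
  IsPoly.foldl_of_growth (f := fun _ t b => Nat.bit b t) hl (IsPoly.const 0) (by fun_prop) 4
    (fun a b _ c => by
      rw [enc_nat, enc_nat, bits_bit]
      have hb : (enc b).size ≤ 3 := by cases b <;> decide
      split_ifs
      · have := (enc c.bits).size_pos
        rw [size_nil]; simp only [eval_ofNat]; omega
      · rw [size_cons]; simp only [eval_ofNat]; omega)

/-- One step of the addition (or, if `neg`, of the subtraction) of two binary numbers. The state
consists of the remaining digits, the carry and the digits of the result. -/
def rippleStep (neg : Bool) (st : List Bool × List Bool × Bool × List Bool) :
    List Bool × List Bool × Bool × List Bool :=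
  (st.1.tail, st.2.1.tail,
    ((st.1.headD false ^^ neg) && (st.2.1.headD false || st.2.2.1)) ||
      (st.2.1.headD false && st.2.2.1),
    (st.1.headD false ^^ (st.2.1.headD false ^^ st.2.2.1)) :: st.2.2.2)

@[fun_prop]
theorem IsPoly.rippleStep (neg : Bool) {f : α → List Bool × List Bool × Bool × List Bool}
    (hf : IsPoly f) : IsPoly (fun a => rippleStep neg (f a)) := by
  unfold PolyModel.rippleStep
  fun_prop

theorem headD_bits (m : ℕ) : m.bits.headD false = m.testBit 0 := by
  induction m using Nat.binaryRec' with
  | zero => simp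
  | bit b m h _ => rw [Nat.bits_append_bit _ _ h]; simp

theorem tail_bits (m : ℕ) : m.bits.tail = (m / 2).bits := by
  induction m using Nat.binaryRec' with
  | zero => simp
  | bit b m h _ => rw [Nat.bits_append_bit _ _ h]; simp [Nat.bit_div_two]

/-- The invariant of addition and subtraction alike: a step splits the lowest digit off x ± (y + c)
and leaves an expression of the same form in the halves. It is stated in the integers so that a
borrow makes sense. -/
theorem rippleStep_bits (neg : Bool) (x y : ℕ) (c : Bool) (out : List Bool) :
    ∃ (c' d : Bool), rippleStep neg (x.bits, y.bits, c, out) =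
      ((x / 2).bits, (y / 2).bits, c', d :: out) ∧
      (x : ℤ) + (if neg then -1 else 1) * (y + c.toNat) =
        d.toNat + 2 * ((x / 2 : ℕ) + (if neg then -1 else 1) * ((y / 2 : ℕ) + c'.toNat)) := by
  refine ⟨_, _, by simp only [rippleStep, tail_bits]; rfl, ?_⟩
  simp only [headD_bits, Nat.testBit_zero]
  rcases Nat.mod_two_eq_zero_or_one x with hx | hx <;>
    rcases Nat.mod_two_eq_zero_or_one y with hy | hy <;> cases c <;> cases neg <;>
    simp [hx, hy] <;> omega

/-- When both numbers are used up, the signed carry remains as the part in front of the emitted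
digits: a leading 1 for addition, and -1 for a subtraction with negative result. -/
theorem iterate_rippleStep_bits (neg : Bool) (m : ℕ) (x y : ℕ) (c : Bool) (out : List Bool)
    (hx : x < 2 ^ m) (hy : y < 2 ^ m) :
    ∃ (c' : Bool) (out' : List Bool), (rippleStep neg)^[m] (x.bits, y.bits, c, out) =
      ([], [], c', out') ∧
      digitsValue out (x + (if neg then -1 else 1) * (y + c.toNat)) =
        digitsValue out' ((if neg then -1 else 1) * c'.toNat) := by
  induction m generalizing x y c out with
  | zero =>
    obtain rfl : x = 0 := by simpa using hx
    obtain rfl : y = 0 := by simpa using hy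
    exact ⟨c, out, by simp, by simp⟩
  | succ m ih =>
    obtain ⟨c₁, d, h₁, h₂⟩ := rippleStep_bits neg x y c out
    obtain ⟨c₂, out₂, h₃, h₄⟩ := ih (x / 2) (y / 2) c₁ (d :: out) (by omega) (by omega)
    refine ⟨c₂, out₂, by rw [Function.iterate_succ_apply, h₁, h₃], ?_⟩
    rw [← h₄, h₂]
    simp [digitsValue]

/-- The result of the ripple-carry addition or subtraction, from the digits of both numbers. -/
def ripple (neg : Bool) (x y : List Bool) : List Bool × List Bool × Bool × List Bool :=
  -- The list that is folded over is only a clock; its entries are ignored.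
  (true :: (x ++ y)).foldl (fun st _ => rippleStep neg st) (x, y, false, [])

theorem IsPoly.ripple (neg : Bool) {x y : α → List Bool} (hx : IsPoly x) (hy : IsPoly y) :
    IsPoly (fun a => ripple neg (x a) (y a)) :=
  IsPoly.foldl_of_growth (f := fun _ st _ => PolyModel.rippleStep neg st)
    (l := fun a => true :: (x a ++ y a)) (s := fun a => (x a, y a, false, []))
    (by fun_prop) (by fun_prop) (by fun_prop) 6
    (fun a b _ c => by
      obtain ⟨x, y, c, out⟩ := c
      have h (b : Bool) : 1 ≤ (enc b).size ∧ (enc b).size ≤ 3 := by cases b <;> decide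
      have hx : (enc x.tail).size ≤ (enc x).size := size_le_of_sublist (List.tail_sublist x)
      have hy : (enc y.tail).size ≤ (enc y).size := size_le_of_sublist (List.tail_sublist y)
      simp only [PolyModel.rippleStep, size_prod, size_cons, eval_ofNat]
      have := h c
      have := (h (((x.headD false ^^ neg) && (y.headD false || c)) || (y.headD false && c))).2
      have := (h (x.headD false ^^ (y.headD false ^^ c))).2
      omega)

theorem ripple_bits (neg : Bool) (x y : ℕ) :
    ∃ (c : Bool) (out : List Bool), ripple neg x.bits y.bits = ([], [], c, out) ∧
      (x : ℤ) + (if neg then -1 else 1) * y = digitsValue out ((if neg then -1 else 1) * c.toNat) := by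
  have hx : x < 2 ^ (x.bits.length + y.bits.length + 1) :=
    (Nat.lt_size_self x).trans_le (Nat.pow_le_pow_right two_pos (by
      rw [← Nat.size_eq_bits_len]; omega))
  have hy : y < 2 ^ (x.bits.length + y.bits.length + 1) :=
    (Nat.lt_size_self y).trans_le (Nat.pow_le_pow_right two_pos (by
      rw [← Nat.size_eq_bits_len]; omega))
  obtain ⟨c, out, h₁, h₂⟩ := iterate_rippleStep_bits neg _ x y false [] hx hy
  refine ⟨c, out, ?_, by simpa [digitsValue] using h₂⟩
  rw [ripple, foldl_const_eq_iterate, List.length_cons, List.length_append, h₁]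

@[fun_prop]
theorem IsPoly.natAdd {f g : α → ℕ} (hf : IsPoly f) (hg : IsPoly g) :
    IsPoly (fun a => f a + g a) := by
  have h := (((IsPoly.ripple false hf.bits hg.bits).snd.snd.fst).cons
    ((IsPoly.ripple false hf.bits hg.bits).snd.snd.snd)).ofDigits
  convert h using 2 with a
  obtain ⟨c, out, h₁, h₂⟩ := ripple_bits false (f a) (g a)
  have h₃ := digitsValue_natCast (c :: out) 0
  rw [h₁]
  rw [← Int.natCast_inj, ← h₃]
  simpa [digitsValue] using h₂

@[fun_prop]
theorem IsPoly.natSub {f g : α → ℕ} (hf : IsPoly f) (hg : IsPoly g) :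
    IsPoly (fun a => f a - g a) := by
  -- A borrow at the end means that the difference is negative, and it is then truncated to zero.
  have h := IsPoly.ite ((IsPoly.ripple true hf.bits hg.bits).snd.snd.fst).decideEqTrue (IsPoly.const 0)
    ((IsPoly.ripple true hf.bits hg.bits).snd.snd.snd).ofDigits
  convert h using 2 with a
  obtain ⟨c, out, h₁, h₂⟩ := ripple_bits true (f a) (g a)
  have h₃ := digitsValue_natCast out 0
  rw [h₁]
  cases c
  · simp at h₂ h₃ ⊢
    omega
  · have := digitsValue_neg_one_neg out (t := -1) (by omega)
    simp at h₂ ⊢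
    omega

@[fun_prop]
theorem IsPoly.natLE {f g : α → ℕ} (hf : IsPoly f) (hg : IsPoly g) :
    IsPoly (fun a => decide (f a ≤ g a)) := by
  have h : IsPoly (fun a => (f a - g a).bits.isEmpty) := by fun_prop
  convert h using 2 with a
  rw [isEmpty_bits]
  simp [Nat.sub_eq_zero_iff_le]

@[fun_prop]
theorem IsPoly.natLT {f g : α → ℕ} (hf : IsPoly f) (hg : IsPoly g) :
    IsPoly (fun a => decide (f a < g a)) :=
  IsPoly.natLE (f := fun a => f a + 1) (by fun_prop) hg

@[fun_prop]
theorem IsPoly.natEq {f g : α → ℕ} (hf : IsPoly f) (hg : IsPoly g) :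
    IsPoly (fun a => decide (f a = g a)) := by
  have h : IsPoly (fun a => decide (f a ≤ g a) && decide (g a ≤ f a)) := by fun_prop
  convert h using 2 with a
  rw [Bool.eq_iff_iff]
  simp [le_antisymm_iff]

-- Horner's scheme on the bits of the first factor. Every accumulator is the second factor times the
-- value of a block of bits, so its length is bounded by a sum of lengths.
@[fun_prop]
theorem IsPoly.natMul {f g : α → ℕ} (hf : IsPoly f) (hg : IsPoly g) :
    IsPoly (fun a => f a * g a) := by
  obtain ⟨p, hp⟩ := hf.size_le
  obtain ⟨q, hq⟩ := hg.size_le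
  have key : ∀ (l : List Bool) (b : ℕ),
      l.foldr (fun d t => Nat.bit false t + if d = true then b else 0) 0 =
        l.foldr Nat.bit 0 * b := by
    intro l b
    induction l with
    | nil => simp
    | cons d l ih => rw [List.foldr_cons, ih]; cases d <;> simp [Nat.bit_val] <;> ring
  have hbits : ∀ m : ℕ, m.bits.foldr Nat.bit 0 = m := by
    intro m
    induction m using Nat.binaryRec' with
    | zero => simp
    | bit b m h ih => rw [Nat.bits_append_bit _ _ h]; simp [ih]
  have hlt : ∀ l : List Bool, l.foldr Nat.bit 0 < 2 ^ l.length := by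
    intro l
    induction l with
    | nil => simp
    | cons d l ih => cases d <;> simp [Nat.bit_val, pow_succ] <;> omega
  have h := IsPoly.foldr (l := fun a => (f a).bits) (s := fun _ => 0)
    (f := fun a d t => Nat.bit false t + if d = true then g a else 0) (by fun_prop)
    (by fun_prop) (by fun_prop) (4 * (p + q) + 1)
    (fun a l' hl' => by
      rw [key]
      have h1 := hlt l'
      have h2 := lt_two_pow_size (g a)
      have h3 : l'.length ≤ p.eval (enc a).size :=
        hl'.length_le.trans ((length_lt_size _).le.trans (hp a))
      refine (size_nat_le_of_lt (i := l'.length + (enc (g a)).size) ?_).trans ?_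
      · rw [pow_add]
        exact Nat.mul_lt_mul'' h1 h2
      · have := hq a
        simp only [eval_add, eval_mul, eval_ofNat, eval_one]
        omega)
  convert h using 2 with a
  rw [key, hbits]

@[fun_prop]
theorem IsPoly.natPow {f : α → ℕ} (hf : IsPoly f) (n : ℕ) : IsPoly (fun a => f a ^ n) := by
  induction n with
  | zero => simpa using IsPoly.const 1
  | succ n ih => simpa only [pow_succ] using ih.natMul hf

@[fun_prop]
theorem IsPoly.length {l : α → List β} (hl : IsPoly l) : IsPoly (fun a => (l a).length) := by
  obtain ⟨r, hr⟩ := hl.size_le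
  have key : ∀ (l : List β) (n : ℕ), l.foldl (fun n _ => n + 1) n = n + l.length := by
    intro l
    induction l with
    | nil => simp
    | cons b l ih => intro n; simp [ih]; ring
  have h := IsPoly.foldl (s := fun _ => 0) (f := fun _ n _ => n + 1) hl (by fun_prop)
    (by fun_prop) (4 * r + 1) (fun a l' hl' => by
      rw [key]
      have h1 := size_nat_le_self (0 + l'.length)
      have h2 := hl'.length_le
      have h3 := length_lt_size (l a)
      have h4 := hr a
      simp only [eval_add, eval_mul, eval_ofNat, eval_one]
      omega)
  convert h using 2 with a
  simp [key]

@[fun_prop]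
theorem IsPoly.rangeLength {l : α → List β} (hl : IsPoly l) :
    IsPoly (fun a => List.range (l a).length) := by
  obtain ⟨r, hr⟩ := hl.size_le
  have key : ∀ l : List β, l.foldl (fun (out : List ℕ) _ => out.length :: out) [] =
      (List.range l.length).reverse := by
    intro l
    induction l using List.reverseRecOn with
    | nil => simp
    | append_singleton l b ih => simp [ih, List.range_succ]
  have h := IsPoly.foldl (s := fun _ => []) (f := fun _ (out : List ℕ) _ => out.length :: out) hl
    (by fun_prop) (by fun_prop) (r * (4 * r + 1 + 1) + 1) (fun a l' hl' => by
      rw [key]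
      have h2 := hl'.length_le
      have h3 := length_lt_size (l a)
      have h4 := hr a
      have := size_le_of_forall (l := (List.range l'.length).reverse)
        (m := r.eval (enc a).size) (b := 4 * r.eval (enc a).size + 1) (by simp; omega)
        (fun i hi => by
          have hi : i < l'.length := by simpa using hi
          have := size_nat_le_self i
          omega)
      simpa only [eval_add, eval_mul, eval_ofNat, eval_one] using this)
  convert h.reverse using 2 with a
  simp [key]

@[fun_prop]
theorem IsPoly.zipIdx {l : α → List β} (hl : IsPoly l) : IsPoly (fun a => (l a).zipIdx) := by
  have h : IsPoly (fun a => (l a).zip (List.range (l a).length)) := by fun_prop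
  convert h using 2 with a
  rw [List.zipIdx_eq_zip_range', List.range_eq_range']

@[fun_prop]
theorem IsPoly.getD {l : α → List β} {i : α → ℕ} {d : α → β} (hl : IsPoly l) (hi : IsPoly i)
    (hd : IsPoly d) : IsPoly (fun a => (l a).getD (i a) (d a)) := by
  have h : IsPoly (fun a =>
      (((l a).zipIdx.filter fun z => decide (z.2 = i a)).map fun z => z.1).headD (d a)) := by fun_prop
  convert h using 2 with a
  have key : ∀ (l : List β) (n i : ℕ) (d : β),
      l.getD i d = (((l.zipIdx n).filter fun z => decide (z.2 = n + i)).map fun z => z.1).headD d := by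
    intro l
    induction l with
    | nil => simp
    | cons b l ih =>
      intro n i d
      cases i with
      | zero => simp
      | succ i =>
        rw [List.getD_cons_succ, ih (n + 1) i d, List.zipIdx_cons, List.filter_cons_of_neg (by simp)]
        simp only [Nat.add_assoc, Nat.add_comm 1 i]
  simpa using key (l a) 0 (i a) (d a)

-- Only lengths of lists have to be divided, so counting modulo the divisor along the list replaces
-- long division.
@[fun_prop]
theorem IsPoly.lengthDivMod {l : α → List β} {f : α → ℕ} (hl : IsPoly l) (hf : IsPoly f) :
    IsPoly (fun a => ((l a).length % f a, (l a).length / f a)) := by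
  obtain ⟨r, hr⟩ := hl.size_le
  have key : ∀ (l : List β) (k : ℕ),
      l.foldl (fun (st : ℕ × ℕ) _ => if st.1 + 1 = k then (0, st.2 + 1) else (st.1 + 1, st.2)) (0, 0) =
        (l.length % k, l.length / k) := by
    intro l k
    induction l using List.reverseRecOn with
    | nil => simp
    | append_singleton l b ih =>
      rw [List.foldl_append, ih, List.length_append, List.length_singleton, List.foldl_cons,
        List.foldl_nil]
      have h := Nat.div_add_mod l.length k
      rcases Nat.eq_zero_or_pos k with rfl | hk
      · simp
      have hlt := Nat.mod_lt l.length hk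
      dsimp only
      split_ifs with h1
      · have : l.length + 1 = k * (l.length / k + 1) := by rw [Nat.mul_add]; omega
        rw [this, Nat.mul_mod_right, Nat.mul_div_cancel_left _ hk]
      · have : l.length + 1 = (l.length % k + 1) + k * (l.length / k) := by omega
        have hlt' : l.length % k + 1 < k := by omega
        rw [this, Nat.add_mul_mod_self_left, Nat.add_mul_div_left _ _ hk, Nat.mod_eq_of_lt hlt',
          Nat.div_eq_of_lt hlt', Nat.zero_add]
  have h := IsPoly.foldl (s := fun _ => ((0, 0) : ℕ × ℕ))
    (f := fun a st _ => if st.1 + 1 = f a then (0, st.2 + 1) else (st.1 + 1, st.2)) hl (by fun_prop)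
    (by fun_prop) (8 * r + 3) (fun a l' hl' => by
      rw [key, size_prod]
      have h1 := size_nat_le_self (l'.length % f a)
      have h2 := size_nat_le_self (l'.length / f a)
      have h3 := hl'.length_le
      have h4 := length_lt_size (l a)
      have h5 := hr a
      have h6 := Nat.mod_le l'.length (f a)
      have h7 := Nat.div_le_self l'.length (f a)
      simp only [eval_add, eval_mul, eval_ofNat]
      omega)
  convert h using 2 with a
  rw [key]

@[fun_prop]
theorem IsPoly.lengthDiv {l : α → List β} {f : α → ℕ} (hl : IsPoly l) (hf : IsPoly f) :
    IsPoly (fun a => (l a).length / f a) := (hl.lengthDivMod hf).snd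

@[fun_prop]
theorem IsPoly.lengthMod {l : α → List β} {f : α → ℕ} (hl : IsPoly l) (hf : IsPoly f) :
    IsPoly (fun a => (l a).length % f a) := (hl.lengthDivMod hf).fst

@[fun_prop]
theorem IsPoly.rangeMod {l : α → List β} {f : α → ℕ} (hl : IsPoly l) (hf : IsPoly f) :
    IsPoly (fun a => (List.range (l a).length).map (· % f a)) := by
  obtain ⟨r, hr⟩ := hl.size_le
  have key : ∀ (l : List β) (k : ℕ), l.foldl (fun (out : List ℕ) _ => out.length % k :: out) [] =
      ((List.range l.length).map (· % k)).reverse := by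
    intro l k
    induction l using List.reverseRecOn with
    | nil => simp
    | append_singleton l b ih => simp [ih, List.range_succ]
  have h := IsPoly.foldl (s := fun _ => [])
    (f := fun a (out : List ℕ) _ => out.length % f a :: out) hl
    (by fun_prop) (by fun_prop) (r * (4 * r + 1 + 1) + 1) (fun a l' hl' => by
      rw [key]
      have h2 := hl'.length_le
      have h3 := length_lt_size (l a)
      have h4 := hr a
      have := size_le_of_forall (l := ((List.range l'.length).map (· % f a)).reverse)
        (m := r.eval (enc a).size) (b := 4 * r.eval (enc a).size + 1) (by simp; omega)
        (fun i hi => by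
          obtain ⟨j, hj, rfl⟩ : ∃ j < l'.length, j % f a = i := by simpa using hi
          have := size_nat_le_self (j % f a)
          have := Nat.mod_le j (f a)
          omega)
      simpa only [eval_add, eval_mul, eval_ofNat, eval_one] using this)
  convert h.reverse using 2 with a
  simp [key]

@[fun_prop]
theorem IsPoly.boolEq {f g : α → Bool} (hf : IsPoly f) (hg : IsPoly g) :
    IsPoly (fun a => decide (f a = g a)) := by
  have h : IsPoly (fun a => !(f a ^^ g a)) := by fun_prop
  convert h using 2 with a
  cases f a <;> cases g a <;> rfl

omit [Enc β] [Enc γ] in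
@[fun_prop]
theorem IsPoly.prodEq [DecidableEq β] [DecidableEq γ] {f g : α → β × γ}
    (hβ : IsPoly (fun a => decide ((f a).1 = (g a).1)))
    (hγ : IsPoly (fun a => decide ((f a).2 = (g a).2))) :
    IsPoly (fun a => decide (f a = g a)) := by
  convert hβ.and hγ using 2 with a
  rw [Bool.eq_iff_iff]
  simp [Prod.ext_iff]

@[fun_prop]
theorem IsPoly.listEq [DecidableEq β] [Inhabited β] (hβ : IsPoly (fun z : β × β => decide (z.1 = z.2)))
    {f g : α → List β} (hf : IsPoly f) (hg : IsPoly g) :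
    IsPoly (fun a => decide (f a = g a)) := by
  have h : IsPoly (fun a => decide ((f a).length = (g a).length) &&
      ((f a).zip (g a)).all (fun z => decide (z.1 = z.2))) :=
    IsPoly.and (by fun_prop) (IsPoly.all (p := fun _ (z : β × β) => decide (z.1 = z.2)) (by fun_prop)
      (hβ.comp (f := fun x : α × β × β => x.2) (by fun_prop)))
  convert h using 2 with a
  rw [Bool.eq_iff_iff]
  simp only [decide_eq_true_eq, Bool.and_eq_true, List.all_eq_true]
  have key : ∀ l l' : List β, l.length = l'.length → (∀ z ∈ l.zip l', z.1 = z.2) → l = l' := by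
    intro l
    induction l with
    | nil => intro l' h _; exact (List.length_eq_zero_iff.1 h.symm).symm
    | cons b l ih =>
      rintro (_ | ⟨c, l'⟩) h h'
      · simp at h
      · have := ih l' (by simpa using h) (fun z hz => h' z (by simp [hz]))
        have := h' (b, c) (by simp)
        simp_all
  refine ⟨fun h => ?_, fun h => key _ _ h.1 h.2⟩
  rw [h]
  refine ⟨rfl, fun z hz => ?_⟩
  rw [List.zip, List.zipWith_self, List.mem_map] at hz
  obtain ⟨b, _, rfl⟩ := hz
  rfl

end Nat

/-! ### Arithmetic on integers -/

section Int

variable {α : Type} [Enc α]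

@[fun_prop]
theorem IsPoly.natAbs {f : α → ℤ} (hf : IsPoly f) : IsPoly (fun a => (f a).natAbs) :=
  PolyTime.comp (PolyTime.of_right fun _ => rfl : IsPoly Int.natAbs) hf

@[fun_prop]
theorem IsPoly.intNeg {f : α → ℤ} (hf : IsPoly f) : IsPoly (fun a => decide (f a < 0)) :=
  PolyTime.comp (PolyTime.of_left fun _ => rfl : IsPoly (fun z : ℤ => decide (z < 0))) hf

theorem IsPoly.signed {b : α → Bool} {f : α → ℕ} (hb : IsPoly b) (hf : IsPoly f) :
    IsPoly (fun a => if b a = true then -(f a : ℤ) else (f a : ℤ)) := by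
  -- Zero must not receive a minus sign, because its code carries the sign bit of a nonnegative
  -- number.
  have h : IsPoly (fun a => (b a && !decide (f a = 0), f a)) := by fun_prop
  obtain ⟨P, q, h⟩ := h
  refine ⟨P, q, fun a => ?_⟩
  obtain ⟨t, ht, hr⟩ := h a
  refine ⟨t, ht, ?_⟩
  convert hr using 1
  change Data.cons _ _ = Data.cons _ _
  congr 1
  · change encBool _ = encBool _
    congr 1
    rw [Bool.eq_iff_iff]
    dsimp only
    split_ifs with h <;> simp [h]
    omega
  · change encNat _ = encNat _
    congr 1
    dsimp only
    split_ifs <;> simp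

@[fun_prop]
theorem IsPoly.natCastInt {f : α → ℕ} (hf : IsPoly f) : IsPoly (fun a => (f a : ℤ)) := by
  simpa using IsPoly.signed (IsPoly.const false) hf

@[fun_prop]
theorem IsPoly.intSub {f g : α → ℤ} (hf : IsPoly f) (hg : IsPoly g) :
    IsPoly (fun a => f a - g a) := by
  have h := IsPoly.ite (p := fun a => decide (f a < 0) = decide (g a < 0)) (by fun_prop)
    (IsPoly.ite (p := fun a => (g a).natAbs ≤ (f a).natAbs) (by fun_prop)
      (IsPoly.signed (b := fun a => decide (f a < 0)) (f := fun a => (f a).natAbs - (g a).natAbs)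
        (by fun_prop) (by fun_prop))
      (IsPoly.signed (b := fun a => !decide (f a < 0)) (f := fun a => (g a).natAbs - (f a).natAbs)
        (by fun_prop) (by fun_prop)))
    (IsPoly.signed (b := fun a => decide (f a < 0)) (f := fun a => (f a).natAbs + (g a).natAbs)
      (by fun_prop) (by fun_prop))
  convert h using 2 with a
  by_cases h1 : f a < 0 <;> by_cases h2 : g a < 0 <;>
    by_cases h3 : (g a).natAbs ≤ (f a).natAbs <;> simp only [h1, h2, h3, decide_true, decide_false, if_true, if_false, Bool.not_true,
      Bool.not_false, Bool.false_eq_true, reduceCtorEq] <;> omega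

@[fun_prop]
theorem IsPoly.intLT {f g : α → ℤ} (hf : IsPoly f) (hg : IsPoly g) :
    IsPoly (fun a => decide (f a < g a)) := by
  have h : IsPoly (fun a => decide (f a - g a < 0)) := by fun_prop
  convert h using 2 with a
  rw [Bool.eq_iff_iff]
  simp

@[fun_prop]
theorem IsPoly.intEq {f g : α → ℤ} (hf : IsPoly f) (hg : IsPoly g) :
    IsPoly (fun a => decide (f a = g a)) := by
  have h : IsPoly (fun a => decide ((f a - g a).natAbs = 0)) := by fun_prop
  convert h using 2 with a
  rw [Bool.eq_iff_iff]
  simp [sub_eq_zero]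

end Int

end PolyModel

/-! ### Reduction and lifting as functions on lists -/

namespace EqualClustering

open PolyModel
open Enc (enc)
open Polynomial

/-- The number of occurrences of `y` in a list. -/
def occ {β : Type} [DecidableEq β] (y : β) (l : List β) : ℕ := (l.filter fun z => decide (z = y)).length

/-- Tag the points of a list. The tag `0` marks an open point; as soon as there are `s` equal open
points, they form a group and get the next tag. The number of groups is returned as well. -/
def tagPoints (s : ℕ) (X : List (List ℤ)) : List (List ℤ × ℕ) × ℕ :=
  X.foldr (fun x st =>
    -- Only the count of `x` has grown, and by one, so testing for equality keeps all open counts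
    -- below a positive `s`.
    if occ (x, 0) ((x, 0) :: st.1) = s then
      (((x, 0) :: st.1).map fun z => if z = (x, 0) then (x, st.2 + 1) else z, st.2 + 1)
    else ((x, 0) :: st.1, st.2)) ([], 0)

/-- Whether an indexed tagged point is deleted: among the open copies of a point that has at least
`e + B + 1` of them, the first `e` ones are deleted. -/
def isDeleted (e B : ℕ) (T : List (List ℤ × ℕ)) (z : (List ℤ × ℕ) × ℕ) : Bool :=
  decide (z.1.2 = 0 ∧ e + B + 1 ≤ occ z.1 T ∧
    (T.zipIdx.filter fun w => decide (w.1 = z.1 ∧ w.2 < z.2)).length < e)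

/-- The indexed tagged points that are retained. -/
def retained (e B : ℕ) (T : List (List ℤ × ℕ)) : List ((List ℤ × ℕ) × ℕ) :=
  T.zipIdx.filter fun z => decide (z.1.2 = 0 ∧ ¬ isDeleted e B T z = true)

/-- For `p = 0`, replace every coordinate of `u` by its rank among the points of `V`. -/
def rankPoint (p : ℕ) (V : List (List ℤ)) (u : List ℤ) : List ℤ :=
  if p = 0 then (List.range u.length).map fun h =>
    ((V.filter fun v => decide (v.getD h 0 < u.getD h 0)).length : ℤ)
  else u

/-- Whether two points are close to each other: they differ in at most `B ^ max p 1` coordinates, by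
at most `2 * B` in each. -/
def close (p B : ℕ) (x y : List ℤ) : Bool :=
  decide (((List.range x.length).filter fun h => !decide (x.getD h 0 = y.getD h 0)).length ≤
    B ^ max p 1) &&
  (List.range x.length).all fun h => decide ((x.getD h 0 - y.getD h 0).natAbs ≤ 2 * B)

/-- The connected components of a list of points. -/
def components (p B : ℕ) (W : List (List ℤ)) : List (List (List ℤ)) :=
  W.foldr (fun x G => (x :: (G.filter fun g => g.any fun y => close p B x y).flatten) ::
    G.filter fun g => !g.any fun y => close p B x y) []

/-- The component of a point, with its number. -/
def componentOf (G : List (List (List ℤ))) (u : List ℤ) : List (List ℤ) × ℕ :=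
  (G.zipIdx.filter fun z => z.1.any fun v => decide (v = u)).headD ([], 0)

/-- A coordinate of a point, relative to the first point of its component. -/
def relCoord (G : List (List (List ℤ))) (u : List ℤ) (h : ℕ) : ℤ :=
  u.getD h 0 - ((componentOf G u).1.headD []).getD h 0

/-- The coordinates in which not all relative coordinates vanish. -/
def usedCoords (G : List (List (List ℤ))) (W : List (List ℤ)) : List ℕ :=
  (List.range (W.headD []).length).filter fun h => W.any fun u => !decide (relCoord G u h = 0)

/-- The numbers smaller than `min B d`, preceded by an additional `0`. -/
def labelCoords (B : ℕ) (u : List ℤ) : List ℕ :=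
  -- Writing out `B` labels could take exponential time, as `B` is given in binary; limiting their
  -- number by the dimension avoids this.
  0 :: (List.range u.length).filter fun h => decide (h < B)

/-- The new coordinates of a point: its relative coordinates, followed by copies of a label of its
component. -/
def newPoint (p B : ℕ) (W : List (List ℤ)) (u : List ℤ) : List ℤ :=
  ((usedCoords (components p B W) W).map fun h => relCoord (components p B W) u h) ++
    (labelCoords B u).map fun _ => (((componentOf (components p B W) u).2 * (B + 1) : ℕ) : ℤ)

/-- The points of the reduced instance. -/
def newPoints (p B : ℕ) (X : List (List ℤ)) : List (List ℤ) :=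
  X.map fun u => newPoint p B (X.dedup.map fun v => rankPoint p X.dedup v)
    (rankPoint p X.dedup u)

/-- The size of the clusters of an instance with points `X`. -/
def clusterSize (k : ℕ) (X : List (List ℤ)) : ℕ := X.length / k

/-- The number of points that are deleted from every cluster. -/
def excess (k B : ℕ) (X : List (List ℤ)) : ℕ := clusterSize k X - (2 * B + 1)

/-- The number of clusters of the reduced instance. -/
def newK (k : ℕ) (X : List (List ℤ)) : ℕ := k - (tagPoints (clusterSize k X) X).2

/-- The retained indexed points of an instance. -/
def kernelPoints (k B : ℕ) (X : List (List ℤ)) : List ((List ℤ × ℕ) × ℕ) :=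
  retained (excess k B X) B (tagPoints (clusterSize k X) X).1

/-- Whether the reduced instance is not the trivial one. -/
def isReducible (k B : ℕ) (X : List (List ℤ)) : Bool :=
  decide (1 ≤ newK k X) && decide (newK k X ≤ B) &&
  decide ((kernelPoints k B X).length = newK k X * (clusterSize k X - excess k B X)) &&
  decide (((kernelPoints k B X).map fun z => z.1.1).dedup.length ≤ 2 * B)

/-- The reduction, on the level of lists. -/
def reduceLists (p : ℕ) (k B : ℕ) (X : List (List ℤ)) : ℕ × ℕ × ℕ × List (List (List ℤ)) :=
  if isReducible k B X = true then
    (((newPoints p B ((kernelPoints k B X).map fun z => z.1.1)).headD []).length, newK k X, B,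
      [newPoints p B ((kernelPoints k B X).map fun z => z.1.1)])
  -- If one of the tests fails, then the optimum is 0 or at least (B + 1)/2, so that every solution
  -- is good enough.
  else (0, 1, 0, [[]])

/-- The cluster of an indexed tagged point in the lifted solution, given the list `K` of the clusters
of the points of the reduced instance. -/
def liftCluster (k B : ℕ) (X : List (List ℤ)) (K : List ℕ) (z : (List ℤ × ℕ) × ℕ) : ℕ :=
  if ¬ z.1.2 = 0 then newK k X + (z.1.2 - 1)
  else if isDeleted (excess k B X) B (tagPoints (clusterSize k X) X).1 z = true then
    -- A deleted point joins a cluster that contains at least `B + 1` retained copies of it; for a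
    -- cheap solution there is exactly one.
    ((((kernelPoints k B X).zip K).filter fun w => decide (w.1.1.1 = z.1.1 ∧
      B + 1 ≤ (((kernelPoints k B X).zip K).filter fun w' =>
        decide (w'.1.1.1 = z.1.1 ∧ w'.2 = w.2)).length)).map fun w => w.2).headD 0
  else ((((kernelPoints k B X).zip K).filter fun w => decide (w.1.2 = z.2)).map fun w => w.2).headD 0

/-- The clusters of all points in the lifted solution, if it is a solution. -/
def liftPref (k B : ℕ) (X : List (List ℤ)) (K : List ℕ) : List ℕ :=
  (tagPoints (clusterSize k X) X).1.zipIdx.map fun z => liftCluster k B X K z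

/-- The clusters of all points in the lifted solution. -/
def liftLists (k B : ℕ) (X : List (List ℤ)) (K : List ℕ) : List ℕ :=
  if ((liftPref k B X K).all fun j =>
      decide (j < k ∧ occ j (liftPref k B X K) ≤ clusterSize k X)) = true then
    liftPref k B X K
  -- Dealing out the points in turn is always an equal clustering, which makes the lifting total.
  else (List.range X.length).map (· % k)

theorem tagPoints_cons (s : ℕ) (x : List ℤ) (X : List (List ℤ)) :
    tagPoints s (x :: X) = if occ (x, 0) ((x, 0) :: (tagPoints s X).1) = s then
      (((x, 0) :: (tagPoints s X).1).map fun z => if z = (x, 0) then (x, (tagPoints s X).2 + 1)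
        else z, (tagPoints s X).2 + 1)
      else ((x, 0) :: (tagPoints s X).1, (tagPoints s X).2) := rfl

theorem tagPoints_map_fst (s : ℕ) (X : List (List ℤ)) : (tagPoints s X).1.map Prod.fst = X := by
  induction X with
  | nil => rfl
  | cons x X ih =>
    rw [tagPoints_cons]
    split_ifs
    · conv_rhs => rw [← ih]
      simp only [List.map_cons, List.map_map, if_true, List.cons.injEq, true_and]
      refine List.map_congr_left fun z _ => ?_
      simp only [Function.comp]
      split_ifs with h
      · rw [h]
      · rfl
    · rw [List.map_cons, ih]

theorem tagPoints_snd_le (s : ℕ) (X : List (List ℤ)) :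
    (tagPoints s X).2 ≤ X.length ∧ ∀ z ∈ (tagPoints s X).1, z.2 ≤ (tagPoints s X).2 := by
  induction X with
  | nil => simp [tagPoints]
  | cons x X ih =>
    rw [tagPoints_cons, List.length_cons]
    split_ifs
    · refine ⟨by dsimp only; omega, fun z hz => ?_⟩
      simp only [List.mem_map] at hz
      obtain ⟨w, hw, rfl⟩ := hz
      split_ifs with h
      · exact le_rfl
      · rcases List.mem_cons.1 hw with rfl | hw
        · exact absurd rfl h
        · exact (ih.2 w hw).trans (Nat.le_succ _)
    · refine ⟨by dsimp only; omega, fun z hz => ?_⟩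
      rcases List.mem_cons.1 hz with rfl | hz
      · exact Nat.zero_le _
      · exact ih.2 z hz

theorem components_cons (p B : ℕ) (x : List ℤ) (W : List (List ℤ)) :
    components p B (x :: W) =
      (x :: ((components p B W).filter fun g => g.any fun y => close p B x y).flatten) ::
        (components p B W).filter fun g => !g.any fun y => close p B x y := rfl

theorem components_flatten_perm (p B : ℕ) (W : List (List ℤ)) :
    (components p B W).flatten.Perm W := by
  induction W with
  | nil => rfl
  | cons x W ih =>
    rw [components_cons, List.flatten_cons, List.cons_append, ← List.flatten_append]
    refine List.Perm.cons x (List.Perm.trans ?_ ih)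
    exact (List.filter_append_perm _ (components p B W)).flatten

theorem components_ne_nil (p B : ℕ) (W : List (List ℤ)) : ∀ g ∈ components p B W, g ≠ [] := by
  induction W with
  | nil => simp [components]
  | cons x W ih =>
    rw [components_cons]
    intro g hg
    rcases List.mem_cons.1 hg with rfl | hg
    · simp
    · exact ih g (List.mem_of_mem_filter hg)

/-! ### Running time of the reduction and of the lifting -/

section Poly

variable {α β : Type} [Enc α] [Enc β]

@[fun_prop]
theorem isPoly_occ [DecidableEq β] (hβ : IsPoly (fun z : β × β => decide (z.1 = z.2)))
    {f : α → β} {l : α → List β} (hf : IsPoly f) (hl : IsPoly l) :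
    IsPoly (fun a => occ (f a) (l a)) := by
  have : IsPoly (fun a => (l a).filter fun z => decide (z = f a)) :=
    IsPoly.filter hl (hβ.comp (f := fun z : α × β => (z.2, f z.1)) (by fun_prop))
  exact this.length

-- The accumulator stays small because all tags are bounded by the number of points.
@[fun_prop]
theorem isPoly_tagPoints {s : α → ℕ} {X : α → List (List ℤ)} (hs : IsPoly s) (hX : IsPoly X) :
    IsPoly (fun a => tagPoints (s a) (X a)) := by
  obtain ⟨r, hr⟩ := hX.size_le
  refine IsPoly.foldr (l := X) (s := fun _ => (([], 0) : List (List ℤ × ℕ) × ℕ))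
    (f := fun a (x : List ℤ) (st : List (List ℤ × ℕ) × ℕ) =>
      if occ (x, 0) ((x, 0) :: st.1) = s a then
        (((x, 0) :: st.1).map fun z => if z = (x, 0) then (x, st.2 + 1) else z, st.2 + 1)
      else ((x, 0) :: st.1, st.2)) hX (by fun_prop) (by fun_prop)
    (1 + (r * ((1 + r + (4 * r + 1)) + 1) + 1) + (4 * r + 1)) (fun a l' hl' => ?_)
  have h1 := hr a
  have h2 := length_lt_size (X a)
  have h3 := hl'.length_le
  have h4 := tagPoints_snd_le (s a) l'
  have h5 := tagPoints_map_fst (s a) l'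
  change (enc (tagPoints (s a) l')).size ≤ _
  have h6 := size_le_of_forall (l := (tagPoints (s a) l').1) (m := r.eval (enc a).size)
    (b := 1 + r.eval (enc a).size + (4 * r.eval (enc a).size + 1)) (by
      have : (tagPoints (s a) l').1.length = l'.length := by
        simpa using congrArg List.length h5
      omega) (fun z hz => by
      have h7 := h4.2 z hz
      have h8 : z.1 ∈ X a := hl'.subset (h5 ▸ List.mem_map_of_mem hz)
      have h9 := size_lt_of_mem h8
      have h10 := size_nat_le_self z.2
      rw [size_prod]
      omega)
  have h7 := size_nat_le_self (tagPoints (s a) l').2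
  rw [size_prod]
  simp only [eval_add, eval_mul, eval_ofNat, eval_one]
  omega

@[fun_prop]
theorem isPoly_dedup {X : α → List (List ℤ)} (hX : IsPoly X) : IsPoly (fun a => (X a).dedup) := by
  obtain ⟨r, hr⟩ := hX.size_le
  have key : ∀ l : List (List ℤ), l.foldr
      (fun x acc => if (acc.any fun y => decide (y = x)) = true then acc else x :: acc) [] = l.dedup := by
    intro l
    induction l with
    | nil => rfl
    | cons x l ih =>
      rw [List.foldr_cons, ih]
      by_cases h : x ∈ l
      · simp [h]
      · simp [h]
  have h := IsPoly.foldr (l := X) (s := fun _ => ([] : List (List ℤ)))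
    (f := fun _ (x : List ℤ) (acc : List (List ℤ)) =>
      if (acc.any fun y => decide (y = x)) = true then acc else x :: acc) hX (by fun_prop)
    (by fun_prop) r (fun a l' hl' => by
      rw [key]
      exact (size_le_of_sublist ((List.dedup_sublist l').trans hl'.sublist)).trans (hr a))
  simpa only [key] using h

@[fun_prop]
theorem isPoly_close (p : ℕ) {B : α → ℕ} {x y : α → List ℤ} (hB : IsPoly B) (hx : IsPoly x)
    (hy : IsPoly y) : IsPoly (fun a => close p (B a) (x a) (y a)) := by
  unfold close
  fun_prop

-- The components of a suffix are a rearrangement of its points into nonempty blocks, which bounds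
-- both the number and the length of the blocks.
@[fun_prop]
theorem isPoly_components (p : ℕ) {B : α → ℕ} {W : α → List (List ℤ)} (hB : IsPoly B)
    (hW : IsPoly W) : IsPoly (fun a => components p (B a) (W a)) := by
  obtain ⟨r, hr⟩ := hW.size_le
  refine IsPoly.foldr (l := W) (s := fun _ => ([] : List (List (List ℤ))))
    (f := fun a x G => (x :: (G.filter fun g => g.any fun y => close p (B a) x y).flatten) ::
      G.filter fun g => !g.any fun y => close p (B a) x y) hW (by fun_prop) (by fun_prop)
    (r * ((r * (r + 1) + 1) + 1) + 1) (fun a l' hl' => ?_)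
  change (enc (components p (B a) l')).size ≤ _
  have h1 := hr a
  have h2 := length_lt_size (W a)
  have h3 := hl'.length_le
  have h4 := components_flatten_perm p (B a) l'
  have h5 := h4.length_eq
  have h6 := components_ne_nil p (B a) l'
  have h7 : ∀ G : List (List (List ℤ)), (∀ g ∈ G, g ≠ []) → G.length ≤ G.flatten.length := by
    intro G
    induction G with
    | nil => simp
    | cons g G ih =>
      intro hG
      have h1 := ih (fun g hg => hG g (List.mem_cons_of_mem _ hg))
      have h2 := List.length_pos_of_ne_nil (hG g List.mem_cons_self)
      rw [List.length_cons, List.flatten_cons, List.length_append]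
      omega
  have h8 := h7 _ h6
  have h9 := size_le_of_forall (l := components p (B a) l') (m := r.eval (enc a).size)
    (b := r.eval (enc a).size * (r.eval (enc a).size + 1) + 1) (by omega) (fun g hg => by
      have h10 : List.Sublist g (components p (B a) l').flatten := List.sublist_flatten_of_mem hg
      have h11 := h10.length_le
      refine size_le_of_forall (by omega) fun u hu => ?_
      have := size_lt_of_mem (hl'.subset (h4.subset (h10.subset hu)))
      omega)
  simpa only [eval_add, eval_mul, eval_one] using h9

@[fun_prop]
theorem isPoly_componentOf {G : α → List (List (List ℤ))} {u : α → List ℤ} (hG : IsPoly G)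
    (hu : IsPoly u) : IsPoly (fun a => componentOf (G a) (u a)) := by
  unfold componentOf
  fun_prop

@[fun_prop]
theorem isPoly_relCoord {G : α → List (List (List ℤ))} {u : α → List ℤ} {h : α → ℕ} (hG : IsPoly G)
    (hu : IsPoly u) (hh : IsPoly h) : IsPoly (fun a => relCoord (G a) (u a) (h a)) := by
  unfold relCoord
  fun_prop

@[fun_prop]
theorem isPoly_newPoint (p : ℕ) {B : α → ℕ} {W : α → List (List ℤ)} {u : α → List ℤ}
    (hB : IsPoly B) (hW : IsPoly W) (hu : IsPoly u) :
    IsPoly (fun a => newPoint p (B a) (W a) (u a)) := by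
  unfold newPoint usedCoords labelCoords
  fun_prop

@[fun_prop]
theorem isPoly_rankPoint (p : ℕ) {V : α → List (List ℤ)} {u : α → List ℤ} (hV : IsPoly V)
    (hu : IsPoly u) : IsPoly (fun a => rankPoint p (V a) (u a)) := by
  unfold rankPoint
  by_cases hp : p = 0
  · simp only [hp, if_true]
    fun_prop
  · simpa only [hp, if_false] using hu

@[fun_prop]
theorem isPoly_newPoints (p : ℕ) {B : α → ℕ} {X : α → List (List ℤ)} (hB : IsPoly B)
    (hX : IsPoly X) : IsPoly (fun a => newPoints p (B a) (X a)) := by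
  unfold newPoints
  fun_prop

@[fun_prop]
theorem isPoly_excess {k B : α → ℕ} {X : α → List (List ℤ)} (hk : IsPoly k) (hB : IsPoly B)
    (hX : IsPoly X) : IsPoly (fun a => excess (k a) (B a) (X a)) := by
  unfold excess clusterSize
  fun_prop

@[fun_prop]
theorem isPoly_clusterSize {k : α → ℕ} {X : α → List (List ℤ)} (hk : IsPoly k)
    (hX : IsPoly X) : IsPoly (fun a => clusterSize (k a) (X a)) := by
  unfold clusterSize
  fun_prop

@[fun_prop]
theorem isPoly_newK {k : α → ℕ} {X : α → List (List ℤ)} (hk : IsPoly k)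
    (hX : IsPoly X) : IsPoly (fun a => newK (k a) (X a)) := by
  unfold newK
  fun_prop

@[fun_prop]
theorem isPoly_isDeleted {e B : α → ℕ} {T : α → List (List ℤ × ℕ)} {z : α → (List ℤ × ℕ) × ℕ}
    (he : IsPoly e) (hB : IsPoly B) (hT : IsPoly T) (hz : IsPoly z) :
    IsPoly (fun a => isDeleted (e a) (B a) (T a) (z a)) := by
  unfold isDeleted
  fun_prop

@[fun_prop]
theorem isPoly_kernelPoints {k B : α → ℕ} {X : α → List (List ℤ)} (hk : IsPoly k) (hB : IsPoly B)
    (hX : IsPoly X) : IsPoly (fun a => kernelPoints (k a) (B a) (X a)) := by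
  unfold kernelPoints retained
  fun_prop

@[fun_prop]
theorem isPoly_reduceLists (p : ℕ) {k B : α → ℕ} {X : α → List (List ℤ)} (hk : IsPoly k)
    (hB : IsPoly B) (hX : IsPoly X) : IsPoly (fun a => reduceLists p (k a) (B a) (X a)) := by
  unfold reduceLists isReducible
  fun_prop

@[fun_prop]
theorem isPoly_liftPref {k B : α → ℕ} {X : α → List (List ℤ)} {K : α → List ℕ} (hk : IsPoly k)
    (hB : IsPoly B) (hX : IsPoly X) (hK : IsPoly K) :
    IsPoly (fun a => liftPref (k a) (B a) (X a) (K a)) := by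
  unfold liftPref liftCluster
  fun_prop

@[fun_prop]
theorem isPoly_liftLists {k B : α → ℕ} {X : α → List (List ℤ)} {K : α → List ℕ} (hk : IsPoly k)
    (hB : IsPoly B) (hX : IsPoly X) (hK : IsPoly K) :
    IsPoly (fun a => liftLists (k a) (B a) (X a) (K a)) := by
  unfold liftLists
  fun_prop

end Poly

end EqualClustering

/-! ### The ℓ_p-distance on lattice points -/

namespace EqualClustering

open Finset

section Distance

variable {p d : ℕ}

/-- The contribution of one coordinate to the `ℓ_p`-norm, before taking the root. -/
noncomputable def coordNorm (p : ℕ) (t : ℝ) : ℝ := if p = 0 then (if t = 0 then 0 else 1) else |t| ^ p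

theorem coordNorm_nonneg (p : ℕ) (t : ℝ) : 0 ≤ coordNorm p t := by
  unfold coordNorm
  split_ifs <;> positivity

theorem coordNorm_zero (p : ℕ) : coordNorm p 0 = 0 := by
  unfold coordNorm
  split_ifs with h h'
  · rfl
  · exact absurd rfl h'
  · rw [abs_zero, zero_pow h]

theorem coordNorm_neg (p : ℕ) (t : ℝ) : coordNorm p (-t) = coordNorm p t := by
  simp [coordNorm]

theorem one_le_coordNorm (p : ℕ) {z : ℤ} (hz : z ≠ 0) : 1 ≤ coordNorm p z := by
  unfold coordNorm
  split_ifs with h h'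
  · simp_all
  · exact le_rfl
  · exact one_le_pow₀ (by exact_mod_cast Int.one_le_abs hz)

/-- The root that is taken in the `ℓ_p`-norm. -/
noncomputable def root (p : ℕ) (t : ℝ) : ℝ := if p = 0 then t else t ^ (1 / (p : ℝ))

theorem lpNorm_eq (x : Fin d → ℝ) : lpNorm p x = root p (∑ h, coordNorm p (x h)) := by
  unfold lpNorm root coordNorm
  split_ifs with h
  · rw [card_filter]
    push_cast
    exact sum_congr rfl fun h _ => by split_ifs <;> simp_all
  · rfl

theorem root_le_root {s t : ℝ} (hs : 0 ≤ s) (hst : s ≤ t) : root p s ≤ root p t := by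
  unfold root
  split_ifs
  · exact hst
  · exact Real.rpow_le_rpow hs hst (by positivity)

theorem root_zero : root p 0 = 0 := by
  unfold root
  split_ifs with h
  · rfl
  · exact Real.zero_rpow (by positivity)

theorem root_one : root p 1 = 1 := by
  unfold root
  split_ifs <;> simp

/-- The `ℓ_p`-distance. -/
noncomputable def lpDist (p : ℕ) (x y : Fin d → ℝ) : ℝ := lpNorm p (fun h => x h - y h)

theorem lpDist_eq (x y : Fin d → ℝ) : lpDist p x y = root p (∑ h, coordNorm p (x h - y h)) := lpNorm_eq _

theorem lpDist_self (x : Fin d → ℝ) : lpDist p x x = 0 := by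
  simp [lpDist_eq, coordNorm_zero, root_zero]

theorem lpDist_comm (x y : Fin d → ℝ) : lpDist p x y = lpDist p y x := by
  rw [lpDist_eq, lpDist_eq]
  congr 1
  exact sum_congr rfl fun h _ => by rw [← coordNorm_neg, neg_sub]

theorem lpDist_nonneg (x y : Fin d → ℝ) : 0 ≤ lpDist p x y := by
  rw [lpDist_eq, ← root_zero (p := p)]
  exact root_le_root le_rfl (sum_nonneg fun h _ => coordNorm_nonneg _ _)

/-- For p = 0 the inequality holds coordinate by coordinate; otherwise it is Minkowski's inequality.
-/
theorem lpDist_triangle (x y z : Fin d → ℝ) : lpDist p x z ≤ lpDist p x y + lpDist p y z := by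
  rcases eq_or_ne p 0 with rfl | hp
  · simp only [lpDist_eq, root, coordNorm, if_true, ← sum_add_distrib]
    refine sum_le_sum fun h _ => ?_
    by_cases h1 : x h - y h = 0
    · by_cases h2 : y h - z h = 0
      · have : x h - z h = 0 := by linarith
        simp [this, h1, h2]
      · simp only [h1, h2, if_true, if_false]; split_ifs <;> norm_num
    · simp only [h1, if_false]; split_ifs <;> norm_num
  · have h := Real.Lp_add_le univ (fun h => x h - y h) (fun h => y h - z h) (p := p)
      (by exact_mod_cast Nat.one_le_iff_ne_zero.2 hp)
    simpa [lpDist, lpNorm, hp] using h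

theorem lpDist_eq_zero {x y : Fin d → ℝ} (h : x = y) : lpDist p x y = 0 := h ▸ lpDist_self _

theorem coord_le_lpDist (x y : Fin d → ℝ) (s : Finset (Fin d)) :
    root p (∑ h ∈ s, coordNorm p (x h - y h)) ≤ lpDist p x y := by
  rw [lpDist_eq]
  exact root_le_root (sum_nonneg fun h _ => coordNorm_nonneg _ _)
    (sum_le_sum_of_subset_of_nonneg (subset_univ _) fun h _ _ => coordNorm_nonneg _ _)

/-- A coordinate in which two integer points differ contributes at least 1 under the root. All lower
bounds on costs rest on this. -/
theorem one_le_lpDist {u v : Fin d → ℤ} (h : u ≠ v) :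
    1 ≤ lpDist p (fun h => (u h : ℝ)) (fun h => (v h : ℝ)) := by
  obtain ⟨i, hi⟩ := Function.ne_iff.1 h
  refine le_trans ?_ (coord_le_lpDist _ _ {i})
  rw [sum_singleton, ← root_one (p := p)]
  refine root_le_root zero_le_one ?_
  rw [← Int.cast_sub]
  exact one_le_coordNorm p (sub_ne_zero.2 hi)

theorem abs_sub_le_lpDist (hp : p ≠ 0) (x y : Fin d → ℝ) (h : Fin d) : |x h - y h| ≤ lpDist p x y := by
  refine le_trans (le_of_eq ?_) (coord_le_lpDist x y {h})
  simp only [sum_singleton, root, coordNorm, hp, if_false]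
  rw [one_div, Real.pow_rpow_inv_natCast (abs_nonneg _) hp]

/-- Every coordinate with different entries contributes at least 1 to the sum under the root, and
that sum is at most B^p, or B if p = 0. -/
theorem card_ne_le_of_dist_le {u v : Fin d → ℤ} {B : ℕ}
    (h : lpDist p (fun h => (u h : ℝ)) (fun h => (v h : ℝ)) ≤ B) :
    (univ.filter fun h => u h ≠ v h).card ≤ B ^ max p 1 := by
  have h1 : ((univ.filter fun h => u h ≠ v h).card : ℝ) ≤
      ∑ h, coordNorm p ((u h : ℝ) - (v h : ℝ)) := by
    rw [card_filter]
    push_cast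
    refine sum_le_sum fun h _ => ?_
    split_ifs with h1
    · rw [← Int.cast_sub]
      exact one_le_coordNorm p (sub_ne_zero.2 h1)
    · exact coordNorm_nonneg _ _
  rw [lpDist_eq] at h
  rcases eq_or_ne p 0 with rfl | hp
  · have : ((univ.filter fun h => u h ≠ v h).card : ℝ) ≤ B := h1.trans (by simpa [root] using h)
    simpa using (by exact_mod_cast this : (univ.filter fun h => u h ≠ v h).card ≤ B)
  · rw [max_eq_left (Nat.one_le_iff_ne_zero.2 hp)]
    have h2 : ∑ h, coordNorm p ((u h : ℝ) - (v h : ℝ)) ≤ (B : ℝ) ^ p := by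
      simp only [root, hp, if_false, one_div] at h
      rwa [Real.rpow_inv_le_iff_of_pos (sum_nonneg fun h _ => coordNorm_nonneg _ _) (by positivity)
        (by positivity), Real.rpow_natCast] at h
    exact_mod_cast h1.trans h2

end Distance

/-! ### Cluster costs, majority points and lower bounds -/

section Cost

variable {p : ℕ} {I : Instance}

/-- A point of an instance, with real coordinates. -/
def pt (I : Instance) (i : Fin I.n) : Fin I.d → ℝ := fun h => (I.pts i h : ℝ)

theorem one_le_lpDist_pt {i j : Fin I.n} (h : I.pts i ≠ I.pts j) : 1 ≤ lpDist p (pt I i) (pt I j) :=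
  one_le_lpDist h

theorem clusterCost_eq (X : Finset (Fin I.n)) :
    clusterCost p I X = ⨅ c : Fin I.d → ℝ, ∑ i ∈ X, lpDist p c (pt I i) := rfl

theorem sum_lpDist_nonneg (X : Finset (Fin I.n)) (c : Fin I.d → ℝ) :
    0 ≤ ∑ i ∈ X, lpDist p c (pt I i) := sum_nonneg fun _ _ => lpDist_nonneg _ _

theorem clusterCost_le (X : Finset (Fin I.n)) (c : Fin I.d → ℝ) :
    clusterCost p I X ≤ ∑ i ∈ X, lpDist p c (pt I i) :=
  ciInf_le ⟨0, by rintro _ ⟨c, rfl⟩; exact sum_lpDist_nonneg X c⟩ c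

theorem le_clusterCost {X : Finset (Fin I.n)} {b : ℝ}
    (h : ∀ c : Fin I.d → ℝ, b ≤ ∑ i ∈ X, lpDist p c (pt I i)) : b ≤ clusterCost p I X :=
  le_ciInf h

theorem clusterCost_nonneg (X : Finset (Fin I.n)) : 0 ≤ clusterCost p I X :=
  le_clusterCost (sum_lpDist_nonneg X)

theorem exists_center_lt {X : Finset (Fin I.n)} {b : ℝ} (h : clusterCost p I X < b) :
    ∃ c : Fin I.d → ℝ, ∑ i ∈ X, lpDist p c (pt I i) < b := exists_lt_of_ciInf_lt h

theorem clusterCost_mono {X Y : Finset (Fin I.n)} (h : X ⊆ Y) :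
    clusterCost p I X ≤ clusterCost p I Y :=
  le_clusterCost fun c => (clusterCost_le X c).trans
    (sum_le_sum_of_subset_of_nonneg h fun _ _ _ => lpDist_nonneg _ _)

/-- The triangle inequality through any median charges the distance to the two points themselves. -/
theorem lpDist_le_clusterCost {X : Finset (Fin I.n)} {i j : Fin I.n} (hi : i ∈ X) (hj : j ∈ X) :
    lpDist p (pt I i) (pt I j) ≤ clusterCost p I X := by
  refine le_clusterCost fun c => ?_
  rcases eq_or_ne i j with rfl | hij
  · rw [lpDist_self]; exact sum_lpDist_nonneg X c
  · calc lpDist p (pt I i) (pt I j) ≤ lpDist p (pt I i) c + lpDist p c (pt I j) := lpDist_triangle _ _ _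
      _ = ∑ l ∈ ({i, j} : Finset _), lpDist p c (pt I l) := by rw [sum_pair hij, lpDist_comm]
      _ ≤ _ := sum_le_sum_of_subset_of_nonneg
          (by intro l hl; simp only [mem_insert, mem_singleton] at hl; rcases hl with rfl | rfl <;> assumption)
          fun _ _ _ => lpDist_nonneg _ _

theorem clusterCost_eq_zero {X : Finset (Fin I.n)} (h : ∀ i ∈ X, ∀ j ∈ X, I.pts i = I.pts j) :
    clusterCost p I X = 0 := by
  refine le_antisymm ?_ (clusterCost_nonneg X)
  rcases X.eq_empty_or_nonempty with rfl | ⟨i, hi⟩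
  · simpa using clusterCost_le (p := p) (I := I) ∅ 0
  · refine (clusterCost_le X (pt I i)).trans (le_of_eq (sum_eq_zero fun j hj => ?_))
    exact lpDist_eq_zero (by unfold pt; rw [h i hi j hj])

/-- The points of `X` that are equal to the `i`-th point. -/
def copies (I : Instance) (X : Finset (Fin I.n)) (i : Fin I.n) : Finset (Fin I.n) :=
  X.filter fun j => I.pts j = I.pts i

/-- If at least half of the points of a cluster are equal to some point, then this point is an
optimal median. -/
theorem sum_lpDist_le_of_card_le {X : Finset (Fin I.n)} {i : Fin I.n}
    (h : X.card ≤ 2 * (copies I X i).card) (c : Fin I.d → ℝ) :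
    ∑ j ∈ X, lpDist p (pt I i) (pt I j) ≤ ∑ j ∈ X, lpDist p c (pt I j) := by
  have hs := card_filter_add_card_filter_not (s := X) fun j => I.pts j = I.pts i
  rw [← sum_filter_add_sum_filter_not X (fun j => I.pts j = I.pts i),
    ← sum_filter_add_sum_filter_not X (fun j => I.pts j = I.pts i) (fun j => lpDist p c (pt I j))]
  have h1 : ∑ j ∈ X.filter (fun j => I.pts j = I.pts i), lpDist p (pt I i) (pt I j) = 0 :=
    sum_eq_zero fun j hj => lpDist_eq_zero (by unfold pt; rw [(mem_filter.1 hj).2])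
  have h2 : ∑ j ∈ X.filter (fun j => I.pts j = I.pts i), lpDist p c (pt I j) =
      (copies I X i).card * lpDist p c (pt I i) := by
    rw [← nsmul_eq_mul, ← sum_const]
    exact sum_congr rfl fun j hj => by unfold pt; rw [(mem_filter.1 hj).2]
  -- Moving the median from `c` to the majority point costs every other point at most the distance
  -- between the two. Every copy saves exactly this distance, and there are at least as many copies.
  have h3 : ∑ j ∈ X.filter (fun j => ¬ I.pts j = I.pts i), lpDist p (pt I i) (pt I j) ≤
      (X.filter (fun j => ¬ I.pts j = I.pts i)).card * lpDist p c (pt I i) +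
        ∑ j ∈ X.filter (fun j => ¬ I.pts j = I.pts i), lpDist p c (pt I j) := by
    rw [← nsmul_eq_mul, ← sum_const, ← sum_add_distrib]
    refine sum_le_sum fun j _ => ?_
    rw [lpDist_comm c (pt I i)]
    exact lpDist_triangle _ _ _
  have h4 : ((X.filter (fun j => ¬ I.pts j = I.pts i)).card : ℝ) ≤ (copies I X i).card := by
    have : (X.filter (fun j => ¬ I.pts j = I.pts i)).card ≤ (copies I X i).card := by
      unfold copies at *
      omega
    exact_mod_cast this
  have h5 := mul_le_mul_of_nonneg_right h4 (lpDist_nonneg (p := p) c (pt I i))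
  linarith

theorem card_sub_copies_le (X : Finset (Fin I.n)) (i : Fin I.n) :
    (X.card : ℝ) - (copies I X i).card ≤ ∑ j ∈ X, lpDist p (pt I i) (pt I j) := by
  have hs := card_filter_add_card_filter_not (s := X) fun j => I.pts j = I.pts i
  have h1 : ((X.filter (fun j => ¬ I.pts j = I.pts i)).card : ℝ) ≤
      ∑ j ∈ X, lpDist p (pt I i) (pt I j) := by
    refine le_trans ?_ (sum_le_sum_of_subset_of_nonneg
      (filter_subset (fun j => ¬ I.pts j = I.pts i) X) fun _ _ _ => lpDist_nonneg _ _)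
    rw [card_eq_sum_ones]
    push_cast
    exact sum_le_sum fun j hj => one_le_lpDist_pt (Ne.symm (mem_filter.1 hj).2)
  have : (X.card : ℝ) = (copies I X i).card + (X.filter (fun j => ¬ I.pts j = I.pts i)).card := by
    rw [← hs]; push_cast; rfl
  linarith

/-- A cluster of small cost has a majority point, which is an optimal median. -/
theorem exists_majority {X : Finset (Fin I.n)} (h : 2 * clusterCost p I X < X.card) :
    ∃ i ∈ X, X.card < 2 * (copies I X i).card ∧
      (∑ j ∈ X, lpDist p (pt I i) (pt I j) ≤ clusterCost p I X) ∧
      (X.card : ℝ) - (copies I X i).card ≤ clusterCost p I X := by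
  obtain ⟨c, hc⟩ := exists_center_lt (show clusterCost p I X < X.card / 2 by linarith)
  have hX : X.Nonempty := by
    rw [← card_pos]
    have := clusterCost_nonneg (p := p) X
    exact_mod_cast (by linarith : (0 : ℝ) < X.card)
  -- The candidate for the majority is a point nearest to an almost optimal median.
  obtain ⟨i, hi, hmin⟩ := exists_min_image X (fun i => lpDist p c (pt I i)) hX
  set r := lpDist p c (pt I i) with hr
  have hcard : X.card < 2 * (copies I X i).card := by
    by_contra hcon
    have hcon' : 2 * ((copies I X i).card : ℝ) ≤ X.card := by exact_mod_cast not_lt.1 hcon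
    -- A point different from the nearest one has distance at least `r` by minimality and at least
    -- `1 - r` by the triangle inequality. If the copies made up at most half of the cluster, the
    -- average distance would be at least (r + (1 - r))/2 = 1/2.
    have h1 : ∀ j ∈ X, (if I.pts j = I.pts i then r else max r (1 - r)) ≤ lpDist p c (pt I j) := by
      intro j hj
      split_ifs with h1
      · exact hmin j hj
      · refine max_le (hmin j hj) ?_
        have h2 := one_le_lpDist_pt (p := p) (Ne.symm h1)
        have h3 := lpDist_triangle (p := p) (pt I i) c (pt I j)
        rw [lpDist_comm (pt I i) c] at h3
        linarith
    have h2 := sum_le_sum h1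
    rw [sum_ite, sum_const, sum_const, nsmul_eq_mul, nsmul_eq_mul] at h2
    have hs := card_filter_add_card_filter_not (s := X) fun j => I.pts j = I.pts i
    have hs' : (X.card : ℝ) = (copies I X i).card + (X.filter (fun j => ¬ I.pts j = I.pts i)).card := by
      rw [← hs]; push_cast; rfl
    change ((copies I X i).card : ℝ) * r + _ ≤ _ at h2
    have h3 : max r (1 - r) ≥ r := le_max_left _ _
    have h4 : max r (1 - r) ≥ 1 - r := le_max_right _ _
    have h5 : (0 : ℝ) ≤ ((copies I X i).card : ℝ) := by positivity
    nlinarith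
  refine ⟨i, hi, hcard, le_clusterCost fun c' => sum_lpDist_le_of_card_le hcard.le c', ?_⟩
  exact (card_sub_copies_le X i).trans (le_clusterCost fun c' => sum_lpDist_le_of_card_le hcard.le c')

/-- A cluster with `t ≥ 2` different points has cost at least `t / 2`. -/
theorem card_image_le_clusterCost {X : Finset (Fin I.n)} (h : 2 ≤ (X.image I.pts).card) :
    ((X.image I.pts).card : ℝ) ≤ 2 * clusterCost p I X := by
  obtain ⟨Y, hYX, hinj, hY⟩ := exists_subset_injOn_image_eq_of_surjOn (f := I.pts) (X : Set (Fin I.n))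
    (X.image I.pts) (by rw [coe_image]; exact Set.surjOn_image _ _)
  replace hYX : Y ⊆ X := by exact_mod_cast hYX
  have ht : Y.card = (X.image I.pts).card := by rw [← hY, card_image_of_injOn hinj]
  rw [← ht] at h ⊢
  have key : ∀ c : Fin I.d → ℝ, (Y.card : ℝ) / 2 ≤ ∑ i ∈ X, lpDist p c (pt I i) := fun c => by
    refine le_trans ?_ (sum_le_sum_of_subset_of_nonneg hYX fun _ _ _ => lpDist_nonneg _ _)
    set S := ∑ i ∈ Y, lpDist p c (pt I i) with hS
    -- With t different points, adding the inequality 1 ≤ d(c,i) + d(c,j) over all ordered pairs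
    -- gives t(t - 1) ≤ 2(t - 1)S.
    have h1 : ∀ i ∈ Y, (Y.card : ℝ) - 1 ≤ ((Y.card : ℝ) - 1) * lpDist p c (pt I i) +
        (S - lpDist p c (pt I i)) := fun i hi => by
      have h2 : ((Y.erase i).card : ℝ) = Y.card - 1 := by
        rw [card_erase_of_mem hi, Nat.cast_sub (by omega)]; simp
      rw [← sum_erase_eq_sub (f := fun i => lpDist p c (pt I i)) hi, ← h2, ← nsmul_eq_mul,
        ← sum_const, ← sum_add_distrib, card_eq_sum_ones]
      push_cast
      refine sum_le_sum fun j hj => ?_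
      have h3 : I.pts i ≠ I.pts j := fun h4 => (mem_erase.1 hj).1 (hinj (mem_erase.1 hj).2 hi h4.symm)
      have h5 := one_le_lpDist_pt (p := p) h3
      have h6 := lpDist_triangle (p := p) (pt I i) c (pt I j)
      rw [lpDist_comm (pt I i) c] at h6
      linarith
    have h2 := sum_le_sum h1
    simp only [sum_add_distrib, sum_sub_distrib, ← mul_sum, sum_const, nsmul_eq_mul, ← hS] at h2
    have h3 : (2 : ℝ) ≤ Y.card := by exact_mod_cast h
    nlinarith
  have := le_clusterCost key
  linarith

theorem one_le_clusterCost {X : Finset (Fin I.n)} {i j : Fin I.n} (hi : i ∈ X) (hj : j ∈ X)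
    (hij : I.pts i ≠ I.pts j) : 1 ≤ clusterCost p I X :=
  (one_le_lpDist_pt hij).trans (lpDist_le_clusterCost hi hj)

end Cost

end EqualClustering

/-! ### Rounding fractional injections, and exchanging points -/

namespace EqualClustering

open Finset

/-- Injections can be chosen separately in each fibre, since different fibres have disjoint images.
-/
theorem exists_injective_comp_eq {A J V : Type*} [Fintype A] [Fintype J] [DecidableEq V] (f : A → V)
    (f' : J → V)
    (h : ∀ v, (univ.filter fun a => f a = v).card ≤ (univ.filter fun j => f' j = v).card) :
    ∃ π : A → J, Function.Injective π ∧ ∀ a, f' (π a) = f a := by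
  have h' : ∀ v, Nonempty ({a // f a = v} ↪ {j // f' j = v}) := fun v => by
    rw [Function.Embedding.nonempty_iff_card_le, Fintype.card_subtype, Fintype.card_subtype]
    exact h v
  refine ⟨fun a => ((h' (f a)).some ⟨a, rfl⟩).1, fun a b hab => ?_,
    fun a => ((h' (f a)).some ⟨a, rfl⟩).2⟩
  have h1 : f a = f b := by
    rw [← ((h' (f a)).some ⟨a, rfl⟩).2, ← ((h' (f b)).some ⟨b, rfl⟩).2]
    exact congrArg f' hab
  have key : ∀ (v w : V) (hv : f a = v) (hw : f b = w), v = w →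
      ((h' v).some ⟨a, hv⟩).1 = ((h' w).some ⟨b, hw⟩).1 → a = b := by
    rintro v w hv hw rfl h2
    simpa using (h' v).some.injective (Subtype.ext h2)
  exact key _ _ rfl rfl h1 hab

/-- A fractional injection of minimal weight can be rounded to an injection. -/
theorem exists_injective_sum_le {A J : Type*} [Fintype A] [Fintype J] [DecidableEq A]
    [DecidableEq J] (M W : A → J → ℝ) (hM : ∀ a j, 0 ≤ M a j) (hrow : ∀ a, ∑ j, M a j = 1)
    (hcol : ∀ j, ∑ a, M a j ≤ 1) :
    ∃ π : A → J, Function.Injective π ∧ ∑ a, W a (π a) ≤ ∑ a, ∑ j, M a j * W a j := by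
  -- The fractional injection is completed to a doubly stochastic matrix with blocks 0, M, Mᵀ and a
  -- diagonal block that supplies the missing mass of the columns.
  let N : Matrix (A ⊕ J) (A ⊕ J) ℝ := Matrix.of fun r c =>
    match r, c with
    | .inl _, .inl _ => 0
    | .inl a, .inr j => M a j
    | .inr j, .inl a => M a j
    | .inr j, .inr j' => if j = j' then 1 - ∑ a, M a j else 0
  let U : A ⊕ J → A ⊕ J → ℝ := fun r c =>
    match r, c with
    | .inl a, .inr j => W a j
    | _, _ => 0
  have hN : N ∈ doublyStochastic ℝ (A ⊕ J) := by
    rw [mem_doublyStochastic_iff_sum]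
    refine ⟨?_, ?_, ?_⟩
    · rintro (a | j) (b | j')
      · exact le_rfl
      · exact hM a j'
      · exact hM b j
      · simp only [N, Matrix.of_apply]
        split_ifs
        · linarith [hcol j]
        · exact le_rfl
    · rintro (a | j) <;> simp [N, hrow]
    · rintro (a | j) <;> simp [N, hrow]
  obtain ⟨w, hw0, hw1, hwN⟩ := exists_eq_sum_perm_of_mem_doublyStochastic hN
  have happ : ∀ r c, N r c = ∑ σ : Equiv.Perm (A ⊕ J), w σ * (if σ r = c then 1 else 0) := by
    intro r c
    rw [← hwN, Matrix.sum_apply]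
    refine sum_congr rfl fun σ _ => ?_
    simp [Equiv.Perm.permMatrix, PEquiv.toMatrix_apply, Equiv.toPEquiv_apply]
  have htot : ∑ σ : Equiv.Perm (A ⊕ J), w σ * ∑ r, U r (σ r) = ∑ a, ∑ j, M a j * W a j := by
    have h1 : ∑ r, ∑ c, N r c * U r c = ∑ a, ∑ j, M a j * W a j := by
      simp [Fintype.sum_sum_type, N, U]
    rw [← h1]
    simp_rw [happ, sum_mul, mul_sum]
    rw [sum_comm]
    refine sum_congr rfl fun r _ => ?_
    rw [sum_comm]
    refine sum_congr rfl fun σ _ => ?_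
    simp
  -- The fractional weight is a convex combination of the weights of permutations, so one that
  -- occurs with positive coefficient is at most the average.
  obtain ⟨σ, hσ, hle⟩ : ∃ σ, 0 < w σ ∧ ∑ r, U r (σ r) ≤ ∑ a, ∑ j, M a j * W a j := by
    by_contra! hcon
    have h1 : ∑ σ : Equiv.Perm (A ⊕ J), w σ * (∑ a, ∑ j, M a j * W a j) <
        ∑ σ : Equiv.Perm (A ⊕ J), w σ * ∑ r, U r (σ r) := by
      obtain ⟨σ, hσ⟩ : ∃ σ, 0 < w σ := by
        by_contra! hn
        have : ∑ σ, w σ ≤ 0 := sum_nonpos fun σ _ => hn σ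
        linarith
      refine sum_lt_sum (fun σ _ => ?_) ⟨σ, mem_univ _, mul_lt_mul_of_pos_left (hcon σ hσ) hσ⟩
      rcases (hw0 σ).eq_or_lt with h | h
      · rw [← h]; simp
      · exact (mul_lt_mul_of_pos_left (hcon σ h) h).le
    rw [← sum_mul, hw1, one_mul, htot] at h1
    exact lt_irrefl _ h1
  -- The zero block prevents a permutation of positive coefficient from sending an element of `A` to
  -- an element of `A`.
  have hinr : ∀ a, ∃ j, σ (.inl a) = .inr j := by
    intro a
    rcases h : σ (.inl a) with b | j
    · have h1 : N (.inl a) (.inl b) = 0 := rfl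
      rw [happ] at h1
      have h2 := (sum_eq_zero_iff_of_nonneg (fun τ _ => mul_nonneg (hw0 τ) (by positivity))).1 h1 σ
        (mem_univ _)
      simp [h, hσ.ne'] at h2
    · exact ⟨j, rfl⟩
  choose π hπ using hinr
  refine ⟨π, fun a b hab => ?_, ?_⟩
  · have : σ (.inl a) = σ (.inl b) := by rw [hπ, hπ, hab]
    simpa using this
  · simpa [Fintype.sum_sum_type, hπ, U] using hle

section Exchange

variable {p d : ℕ} {ι κ : Type*} [Fintype ι] [DecidableEq ι] [DecidableEq κ]

/-- Every cluster receives exactly `s` points. -/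
def IsBalanced (a : ι → κ) (s : ℕ) : Prop := ∀ j, (univ.filter fun i => a i = j).card = s

omit [DecidableEq ι] in
theorem IsBalanced.comp_perm {a : ι → κ} {s : ℕ} (h : IsBalanced a s) (σ : Equiv.Perm ι) :
    IsBalanced (fun i => a (σ i)) s := fun j => by
  rw [← h j]
  exact card_bij (fun i _ => σ i) (by simp) (by simp)
    (fun i hi => ⟨σ.symm i, by simpa using hi, by simp⟩)

/-- Some points can be moved to clusters whose medians they are, by exchanging them with other
points, without increasing the sum of the distances to the medians. -/
theorem exists_exchange (x : ι → Fin d → ℝ) (c : κ → Fin d → ℝ) (g : ι → Option κ) (s : ℕ)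
    (hg : ∀ i j, g i = some j → c j = x i)
    (hs : ∀ j, (univ.filter fun i => g i = some j).card ≤ s) (a : ι → κ) (ha : IsBalanced a s) :
    ∃ a' : ι → κ, IsBalanced a' s ∧ (∀ i j, g i = some j → a' i = j) ∧
      ∑ i, lpDist p (c (a' i)) (x i) ≤ ∑ i, lpDist p (c (a i)) (x i) := by
  -- Induction on the number of misplaced points.
  induction hN : (univ.filter fun i => ∃ j, g i = some j ∧ a i ≠ j).card using Nat.strong_induction_on
    generalizing a with
  | _ N ih =>
    by_cases hex : ∃ y j, g y = some j ∧ a y ≠ j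
    swap
    · push Not at hex
      exact ⟨a, ha, hex, le_rfl⟩
    obtain ⟨y, j, hy, hay⟩ := hex
    -- The cluster has `s` points and at most `s` are destined for it. As one of these is missing,
    -- some occupant may leave.
    obtain ⟨z, hz, hgz⟩ : ∃ z, a z = j ∧ g z ≠ some j := by
      by_contra! hcon
      have h1 : (univ.filter fun i => a i = j) ⊂ univ.filter fun i => g i = some j := by
        rw [ssubset_iff_of_subset (fun i hi => by simpa using hcon i (by simpa using hi))]
        exact ⟨y, by simpa using hy, by simpa using hay⟩
      have := card_lt_card h1
      have := hs j
      have := ha j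
      omega
    have hzy : z ≠ y := by rintro rfl; exact hgz hy
    obtain ⟨a', h1, h2, h3⟩ := ih _ (by
        rw [← hN]
        refine card_lt_card ?_
        rw [ssubset_iff_of_subset]
        · refine ⟨y, by simp [hy, hay], ?_⟩
          simp [hy, hz]
        · intro i
          simp only [mem_filter, mem_univ, true_and]
          rintro ⟨l, hl, hne⟩
          refine ⟨l, hl, ?_⟩
          by_cases hiy : i = y
          · subst hiy
            rw [hy] at hl
            simp at hl
            simp [hl, hz] at hne
          · by_cases hiz : i = z
            · subst hiz
              rw [hz]
              rintro rfl
              exact hgz hl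
            · rwa [Equiv.swap_apply_of_ne_of_ne hiy hiz] at hne)
      (fun i => a (Equiv.swap y z i)) (ha.comp_perm _) rfl
    refine ⟨a', h1, h2, h3.trans ?_⟩
    have hsplit : ∀ f : ι → ℝ, ∑ i, f i = f y + f z + ∑ i ∈ (univ.erase y).erase z, f i := fun f => by
      rw [add_assoc, add_sum_erase _ _ (by simp [hzy]), add_sum_erase _ _ (mem_univ _)]
    rw [hsplit, hsplit (fun i => lpDist p (c (a i)) (x i))]
    have h4 : ∑ i ∈ (univ.erase y).erase z, lpDist p (c (a (Equiv.swap y z i))) (x i) =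
        ∑ i ∈ (univ.erase y).erase z, lpDist p (c (a i)) (x i) :=
      sum_congr rfl fun i hi => by
        have hi' : i ≠ z ∧ i ≠ y := by simpa using hi
        rw [Equiv.swap_apply_of_ne_of_ne hi'.2 hi'.1]
    rw [h4, Equiv.swap_apply_left, Equiv.swap_apply_right, hz, hg y j hy, lpDist_self]
    -- After the swap `y` sits on its median. The new distance of `z` is at most the old distance of
    -- `y` plus the old distance of `z`, because the median of `z` was the point `y`.
    have := lpDist_triangle (p := p) (c (a y)) (x y) (x z)
    linarith

end Exchange

/-! ### Making groups into clusters at the cost of a factor 2 -/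

section Grouping

variable {p : ℕ} {I : Instance}

theorem cost_nonneg (K : Clustering I) : 0 ≤ cost p I K := sum_nonneg fun _ _ => clusterCost_nonneg _

theorem clusterCost_le_cost (K : Clustering I) (j : Fin I.k) :
    clusterCost p I (univ.filter fun i => K.assign i = j) ≤ cost p I K :=
  single_le_sum (f := fun j => clusterCost p I (univ.filter fun i => K.assign i = j))
    (fun _ _ => clusterCost_nonneg _) (mem_univ j)

theorem sum_lpDist_fiberwise {κ : Type*} [Fintype κ] [DecidableEq κ] (a : Fin I.n → κ)
    (c : κ → Fin I.d → ℝ) :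
    ∑ j, ∑ i ∈ univ.filter (fun i => a i = j), lpDist p (c j) (pt I i) =
      ∑ i, lpDist p (c (a i)) (pt I i) := by
  rw [← sum_fiberwise (s := univ) (g := a)]
  exact sum_congr rfl fun j _ => sum_congr rfl fun i hi => by rw [(mem_filter.1 hi).2]

theorem cost_le_sum_lpDist (K : Clustering I) (c : Fin I.k → Fin I.d → ℝ) :
    cost p I K ≤ ∑ i, lpDist p (c (K.assign i)) (pt I i) := by
  rw [← sum_lpDist_fiberwise]
  exact sum_le_sum fun j _ => clusterCost_le _ _

theorem exists_centers_lt {K : Clustering I} {b : ℝ} (h : cost p I K < b) :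
    ∃ c : Fin I.k → Fin I.d → ℝ, ∑ i, lpDist p (c (K.assign i)) (pt I i) < b := by
  have hk : (0 : ℝ) < I.k := by exact_mod_cast I.k_pos
  set ε := (b - cost p I K) / I.k with hε
  have hε0 : 0 < ε := div_pos (by linarith) hk
  choose c hc using fun j => exists_center_lt
    (show clusterCost p I (univ.filter fun i => K.assign i = j) <
      clusterCost p I (univ.filter fun i => K.assign i = j) + ε by linarith)
  refine ⟨c, ?_⟩
  rw [← sum_lpDist_fiberwise]
  have : Nonempty (Fin I.k) := ⟨⟨0, I.k_pos⟩⟩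
  refine (sum_lt_sum_of_nonempty univ_nonempty fun j _ => hc j).trans_le ?_
  rw [sum_add_distrib, sum_const, card_univ, Fintype.card_fin, nsmul_eq_mul, hε,
    mul_div_cancel₀ _ hk.ne']
  change cost p I K + _ ≤ _
  linarith

theorem Clustering.isBalanced (K : Clustering I) : IsBalanced K.assign (I.n / I.k) := K.card_eq

/-- A partial partition of the points into groups of `n / k` equal points. -/
structure IsGrouping (I : Instance) {G : ℕ} (grp : Fin I.n → Option (Fin G)) : Prop where
  card_eq : ∀ t, (univ.filter fun i => grp i = some t).card = I.n / I.k
  pts_eq : ∀ i j t, grp i = some t → grp j = some t → I.pts i = I.pts j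

/-- The groups are clusters of a clustering. -/
def RespectsGroups {G : ℕ} (grp : Fin I.n → Option (Fin G)) (K : Clustering I)
    (π : Fin G → Fin I.k) : Prop :=
  Function.Injective π ∧ ∀ i t, grp i = some t → K.assign i = π t

variable {G : ℕ} {grp : Fin I.n → Option (Fin G)}

/-- As soon as the medians assigned to the groups are the points of the groups, the exchange
argument applies. What remains is to choose medians that are not much more expensive. -/
theorem IsGrouping.exists_respectsGroups_of_centers (hgrp : IsGrouping I grp) (rep : Fin G → Fin I.n)
    (hrep : ∀ t, grp (rep t) = some t) (K : Clustering I) (c : Fin I.k → Fin I.d → ℝ)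
    (π : Fin G → Fin I.k) (hπ : Function.Injective π) (hc : ∀ t, c (π t) = pt I (rep t)) :
    ∃ K' : Clustering I, RespectsGroups grp K' π ∧
      cost p I K' ≤ ∑ i, lpDist p (c (K.assign i)) (pt I i) := by
  obtain ⟨a, ha, hg, hle⟩ := exists_exchange (p := p) (pt I) c (fun i => (grp i).map π) (I.n / I.k)
    (fun i j hij => by
      obtain ⟨t, ht, rfl⟩ := Option.map_eq_some_iff.1 hij
      rw [hc t]
      unfold pt
      rw [hgrp.pts_eq _ _ t (hrep t) ht])
    (fun j => by
      by_cases hj : ∃ t, π t = j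
      · obtain ⟨t, rfl⟩ := hj
        rw [← hgrp.card_eq t]
        refine card_le_card fun i hi => ?_
        simp only [mem_filter, mem_univ, true_and, Option.map_eq_some_iff] at hi ⊢
        obtain ⟨t', ht', h⟩ := hi
        rwa [← hπ h]
      · rw [filter_eq_empty_iff.2]
        · simp
        · intro i _ hi
          obtain ⟨t, _, h⟩ := Option.map_eq_some_iff.1 hi
          exact hj ⟨t, h⟩) K.assign K.isBalanced
  refine ⟨⟨a, ha⟩, ⟨hπ, fun i t hit => hg i _ (by simp [hit])⟩, ?_⟩
  exact (cost_le_sum_lpDist _ c).trans hle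

/-- The clusters of a cheap clustering have majorities, which makes it possible to rearrange it at
no cost. -/
theorem IsGrouping.exists_respectsGroups_of_majority (hgrp : IsGrouping I grp)
    (rep : Fin G → Fin I.n) (hrep : ∀ t, grp (rep t) = some t) (K : Clustering I)
    (hK : 2 * cost p I K < (I.n / I.k : ℕ)) :
    ∃ (K' : Clustering I) (π : Fin G → Fin I.k), RespectsGroups grp K' π ∧
      cost p I K' ≤ cost p I K := by
  set s := I.n / I.k with hs
  have hcard : ∀ j, (univ.filter fun i => K.assign i = j).card = s := K.card_eq
  have hmaj := fun j => exists_majority (p := p) (X := univ.filter fun i => K.assign i = j) (by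
    have := clusterCost_le_cost (p := p) K j
    rw [hcard]; linarith)
  choose m hm hm2 hmle hmcard using hmaj
  -- Each location has at most as many groups as clusters with that majority. One group too many
  -- would contain `s` points that are not in the majority, forcing `s` to be at most the cost.
  obtain ⟨π, hπ, hπm⟩ := exists_injective_comp_eq (fun t => I.pts (rep t)) (fun j => I.pts (m j)) (by
    intro v
    by_contra! hcon
    set J := univ.filter fun j => I.pts (m j) = v
    set A := univ.filter fun t => I.pts (rep t) = v
    have h1 : A.card * s ≤ (univ.filter fun i => I.pts i = v).card := by
      have h2 : (A.biUnion fun t => univ.filter fun i => grp i = some t).card = A.card * s := by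
        rw [card_biUnion, sum_const_nat fun t _ => hgrp.card_eq t]
        intro t _ t' _ htt'
        rw [Function.onFun, disjoint_left]
        intro i hi hi'
        simp only [mem_filter, mem_univ, true_and] at hi hi'
        exact htt' (Option.some_injective _ (hi.symm.trans hi'))
      rw [← h2]
      refine card_le_card fun i hi => ?_
      simp only [mem_biUnion, mem_filter, mem_univ, true_and, A] at hi ⊢
      obtain ⟨t, ht, hit⟩ := hi
      rw [← ht, hgrp.pts_eq _ _ t hit (hrep t)]
    -- Clusters with majority `v` contain at most `s` copies of it; in every other cluster the
    -- number of copies is at most the cost of the cluster.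
    have h3 : ((univ.filter fun i => I.pts i = v).card : ℝ) ≤ J.card * s + cost p I K := by
      have h4 : (univ.filter fun i => I.pts i = v).card =
          ∑ j, ((univ.filter fun i => K.assign i = j).filter fun i => I.pts i = v).card := by
        rw [card_eq_sum_card_fiberwise (f := K.assign) (t := univ) (by simp)]
        exact sum_congr rfl fun j _ => by rw [filter_comm]
      rw [h4]
      push_cast
      calc ∑ j, (((univ.filter fun i => K.assign i = j).filter fun i => I.pts i = v).card : ℝ)
          ≤ ∑ j, ((if I.pts (m j) = v then (s : ℝ) else 0) +
              clusterCost p I (univ.filter fun i => K.assign i = j)) := by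
            refine sum_le_sum fun j _ => ?_
            split_ifs with h
            · have : ((univ.filter fun i => K.assign i = j).filter fun i => I.pts i = v).card ≤ s :=
                (card_filter_le _ _).trans (hcard j).le
              have := clusterCost_nonneg (p := p) (univ.filter fun i => K.assign i = j)
              have : ((((univ.filter fun i => K.assign i = j).filter fun i => I.pts i = v).card : ℕ) : ℝ) ≤ s := by
                exact_mod_cast (by assumption)
              linarith
            · refine le_trans ?_ ((hmcard j).trans_eq (zero_add _).symm)
              have h5 := card_union_of_disjoint (s := copies I (univ.filter fun i => K.assign i = j) (m j))
                (t := (univ.filter fun i => K.assign i = j).filter fun i => I.pts i = v) (by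
                  rw [disjoint_left]
                  intro i hi hi'
                  exact h ((mem_filter.1 hi).2.symm.trans (mem_filter.1 hi').2))
              have h6 : (copies I (univ.filter fun i => K.assign i = j) (m j) ∪
                (univ.filter fun i => K.assign i = j).filter fun i => I.pts i = v).card ≤
                  (univ.filter fun i => K.assign i = j).card :=
                card_le_card (union_subset (filter_subset _ _) (filter_subset _ _))
              rw [h5] at h6
              have : ((copies I (univ.filter fun i => K.assign i = j) (m j)).card : ℝ) +
                ((univ.filter fun i => K.assign i = j).filter fun i => I.pts i = v).card ≤
                  (univ.filter fun i => K.assign i = j).card := by exact_mod_cast h6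
              linarith
        _ = J.card * s + cost p I K := by
            rw [sum_add_distrib, ← sum_filter, sum_const, nsmul_eq_mul]
            rfl
    have h5 : ((A.card * s : ℕ) : ℝ) ≤ J.card * s + cost p I K := le_trans (by exact_mod_cast h1) h3
    have h6 : (J.card + 1) * s ≤ A.card * s := Nat.mul_le_mul_right s hcon
    have h7 : (((J.card + 1) * s : ℕ) : ℝ) ≤ ((A.card * s : ℕ) : ℝ) := by exact_mod_cast h6
    push_cast at h5 h7
    have := cost_nonneg (p := p) K
    linarith)
  obtain ⟨K', h1, h2⟩ := hgrp.exists_respectsGroups_of_centers (p := p) rep hrep K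
    (fun j => pt I (m j)) π hπ (fun t => by unfold pt; rw [hπm])
  refine ⟨K', π, h1, h2.trans ?_⟩
  rw [← sum_lpDist_fiberwise K.assign (fun j => pt I (m j))]
  exact sum_le_sum fun j _ => hmle j

/-- Replacing some medians by the points of groups. -/
theorem IsGrouping.exists_respectsGroups_of_le (hgrp : IsGrouping I grp)
    (rep : Fin G → Fin I.n) (hrep : ∀ t, grp (rep t) = some t) (hs : 0 < I.n / I.k)
    (K : Clustering I) (c : Fin I.k → Fin I.d → ℝ) :
    ∃ (K' : Clustering I) (π : Fin G → Fin I.k), RespectsGroups grp K' π ∧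
      cost p I K' ≤ max 1 (2 - 2 / ((I.n / I.k : ℕ) : ℝ)) *
        ∑ i, lpDist p (c (K.assign i)) (pt I i) := by
  set s := I.n / I.k with hs'
  have hsR : (0 : ℝ) < s := by exact_mod_cast hs
  let m : Fin G → Fin I.k → ℕ := fun t j => (univ.filter fun i => grp i = some t ∧ K.assign i = j).card
  -- Group `t` is distributed over the clusters in proportions `m t j / s`; the weight bounds the
  -- change in cost when its point becomes the median of cluster `j`.
  obtain ⟨π, hπ, hle⟩ := exists_injective_sum_le (fun t j => (m t j : ℝ) / s)
    (fun t j => ((s : ℝ) - 2 * m t j) * lpDist p (c j) (pt I (rep t))) (fun t j => by positivity)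
    (fun t => by
      rw [← sum_div, ← Nat.cast_sum, div_eq_one_iff_eq hsR.ne', Nat.cast_inj, hs', ← hgrp.card_eq t,
        card_eq_sum_card_fiberwise (f := K.assign) (t := univ) (by simp)]
      exact sum_congr rfl fun j _ => by rw [filter_filter])
    (fun j => by
      rw [← sum_div, ← Nat.cast_sum, div_le_one hsR, Nat.cast_le, hs', ← K.card_eq j]
      rw [← card_biUnion]
      · refine card_le_card fun i hi => ?_
        simp only [mem_biUnion, mem_filter, mem_univ, true_and] at hi ⊢
        obtain ⟨t, ht⟩ := hi
        exact ht.2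
      · intro t _ t' _ htt'
        rw [Function.onFun, disjoint_left]
        intro i hi hi'
        simp only [mem_filter, mem_univ, true_and] at hi hi'
        exact htt' (Option.some_injective _ (hi.1.symm.trans hi'.1)))
  set T := ∑ i, lpDist p (c (K.assign i)) (pt I i) with hT
  set D := ∑ t, ∑ j, (m t j : ℝ) * lpDist p (c j) (pt I (rep t)) with hD
  -- `D` is the part of the total distance that is paid by grouped points.
  have hDT : D ≤ T := by
    have h1 : ∀ t j, (m t j : ℝ) * lpDist p (c j) (pt I (rep t)) =
        ∑ i ∈ univ.filter (fun i => grp i = some t ∧ K.assign i = j),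
          lpDist p (c (K.assign i)) (pt I i) := fun t j => by
      rw [← nsmul_eq_mul, ← sum_const]
      refine sum_congr rfl fun i hi => ?_
      simp only [mem_filter, mem_univ, true_and] at hi
      unfold pt
      rw [hgrp.pts_eq _ _ t hi.1 (hrep t), hi.2]
    have h2 : ∀ t, ∑ j, (m t j : ℝ) * lpDist p (c j) (pt I (rep t)) =
        ∑ i ∈ univ.filter (fun i => grp i = some t), lpDist p (c (K.assign i)) (pt I i) := fun t => by
      rw [← sum_fiberwise (s := univ.filter fun i => grp i = some t) (g := K.assign)]
      exact sum_congr rfl fun j _ => by rw [h1, filter_filter]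
    rw [hD, hT, ← sum_fiberwise (s := univ) (g := grp), Fintype.sum_option]
    have h3 : 0 ≤ ∑ i ∈ univ.filter (fun i => grp i = none), lpDist p (c (K.assign i)) (pt I i) :=
      sum_nonneg fun _ _ => lpDist_nonneg _ _
    rw [sum_congr rfl fun t _ => h2 t]
    linarith
  have hD0 : 0 ≤ D := sum_nonneg fun _ _ => sum_nonneg fun _ _ =>
    mul_nonneg (by positivity) (lpDist_nonneg _ _)
  have hle' : ∑ t, ((s : ℝ) - 2 * m t (π t)) * lpDist p (c (π t)) (pt I (rep t)) ≤
      (1 - 2 / s) * D := by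
    refine hle.trans ?_
    rw [hD, mul_sum]
    refine sum_le_sum fun t _ => ?_
    rw [mul_sum]
    refine sum_le_sum fun j _ => ?_
    rw [← mul_assoc, ← mul_assoc]
    refine mul_le_mul_of_nonneg_right ?_ (lpDist_nonneg _ _)
    -- Integrality of the counts produces the gain 2/s: each term m(s - 2m)/s is at most (1 - 2/s)m.
    have h1 : (m t j : ℝ) ≤ m t j * m t j := by exact_mod_cast Nat.le_mul_self _
    rw [div_mul_eq_mul_div, div_le_iff₀ hsR]
    have : (1 - 2 / (s : ℝ)) * m t j * s = s * m t j - 2 * m t j := by field_simp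
    rw [this]
    nlinarith
  let c' : Fin I.k → Fin I.d → ℝ := fun j =>
    if h : ∃ t, π t = j then pt I (rep h.choose) else c j
  have hc' : ∀ t, c' (π t) = pt I (rep t) := fun t => by
    have h : ∃ t', π t' = π t := ⟨t, rfl⟩
    simp only [c', h, dif_pos]
    rw [hπ h.choose_spec]
  obtain ⟨K', h1, h2⟩ := hgrp.exists_respectsGroups_of_centers (p := p) rep hrep K c' π hπ hc'
  refine ⟨K', π, h1, h2.trans ?_⟩
  have h3 : ∑ i, lpDist p (c' (K.assign i)) (pt I i) ≤
      T + ∑ t, ((s : ℝ) - 2 * m t (π t)) * lpDist p (c (π t)) (pt I (rep t)) := by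
    rw [hT, ← sum_lpDist_fiberwise, ← sum_lpDist_fiberwise K.assign c, ← sub_le_iff_le_add',
      ← sum_sub_distrib]
    rw [← sum_subset (subset_univ (univ.image π)) (fun j _ hj => by
      have : ¬ ∃ t, π t = j := by simpa using hj
      simp only [c', this, dif_neg, not_false_eq_true, sub_self]), sum_image hπ.injOn]
    refine sum_le_sum fun t _ => ?_
    rw [hc', ← sum_sub_distrib]
    set δ := lpDist p (c (π t)) (pt I (rep t)) with hδ
    -- A member of the group in this cluster saves `δ`; any other point of the cluster loses at most
    -- `δ`.
    have h4 : ∀ i ∈ univ.filter (fun i => K.assign i = π t),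
        lpDist p (pt I (rep t)) (pt I i) - lpDist p (c (π t)) (pt I i) ≤
          δ - 2 * if grp i = some t then δ else 0 := by
      intro i _
      split_ifs with h
      · have : pt I (rep t) = pt I i := by
          unfold pt; rw [hgrp.pts_eq _ _ t (hrep t) h]
        rw [this, lpDist_self, hδ, this]
        linarith
      · have := lpDist_triangle (p := p) (pt I (rep t)) (c (π t)) (pt I i)
        rw [lpDist_comm (pt I (rep t)) (c (π t))] at this
        linarith
    refine (sum_le_sum h4).trans (le_of_eq ?_)
    rw [sum_sub_distrib, sum_const, K.card_eq, ← mul_sum, ← sum_filter, sum_const, filter_filter,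
      nsmul_eq_mul, nsmul_eq_mul]
    have : (univ.filter fun i => K.assign i = π t ∧ grp i = some t).card = m t (π t) := by
      simp only [m, and_comm]
    rw [this]
    ring
  have h4 : (1 - 2 / (s : ℝ)) * D ≤ (max 1 (2 - 2 / (s : ℝ)) - 1) * T := by
    have h5 : 1 - 2 / (s : ℝ) ≤ max 1 (2 - 2 / (s : ℝ)) - 1 := by
      have := le_max_right 1 (2 - 2 / (s : ℝ)); linarith
    have h6 : 0 ≤ max 1 (2 - 2 / (s : ℝ)) - 1 := by
      have := le_max_left 1 (2 - 2 / (s : ℝ)); linarith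
    exact (mul_le_mul_of_nonneg_right h5 hD0).trans (mul_le_mul_of_nonneg_left hDT h6)
  linarith

instance : Finite (Clustering I) := Finite.of_injective Clustering.assign (by
  rintro ⟨a, ha⟩ ⟨b, hb⟩ h
  simpa using h)

/-- Every clustering of cost at most `B` can be rearranged so that the groups become clusters. -/
theorem IsGrouping.exists_respectsGroups (hgrp : IsGrouping I grp) (hs : 0 < I.n / I.k)
    (K : Clustering I) (hK : cost p I K ≤ I.B) :
    ∃ (K' : Clustering I) (π : Fin G → Fin I.k), RespectsGroups grp K' π ∧
      cost p I K' ≤ 2 * cost p I K ∧ (2 * cost p I K < I.B + 1 → cost p I K' ≤ I.B) := by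
  have hrep : ∀ t, ∃ i, grp i = some t := fun t => by
    have := hgrp.card_eq t
    obtain ⟨i, hi⟩ := card_pos.1 (this ▸ hs)
    exact ⟨i, by simpa using hi⟩
  choose rep hrep using hrep
  have h0 := cost_nonneg (p := p) K
  have hsR : (0 : ℝ) < (I.n / I.k : ℕ) := by exact_mod_cast hs
  rcases lt_or_ge (2 * cost p I K) (I.n / I.k : ℕ) with h | h
  · obtain ⟨K', π, h1, h2⟩ := hgrp.exists_respectsGroups_of_majority rep hrep K h
    exact ⟨K', π, h1, by linarith, fun _ => by linarith⟩
  -- Medians only approximate the infimum. As there are finitely many clusterings, the cheapest one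
  -- respecting the groups satisfies the bound with the infimum itself.
  · obtain ⟨K', ⟨π, hπ⟩, hmin⟩ := Set.exists_min_image
      {K' : Clustering I | ∃ π, RespectsGroups grp K' π} (cost p I) (Set.toFinite _) (by
        obtain ⟨K', π, h1, _⟩ := hgrp.exists_respectsGroups_of_le (p := p) rep hrep hs K (fun _ => 0)
        exact ⟨K', π, h1⟩)
    set f := max 1 (2 - 2 / ((I.n / I.k : ℕ) : ℝ)) with hf
    have hf0 : 0 < f := lt_of_lt_of_le one_pos (le_max_left _ _)
    have hle : cost p I K' ≤ f * cost p I K := by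
      by_contra! hcon
      obtain ⟨c, hc⟩ := exists_centers_lt (p := p) (K := K) (b := cost p I K' / f) (by
        rwa [lt_div_iff₀ hf0, mul_comm])
      obtain ⟨K'', π', h1, h2⟩ := hgrp.exists_respectsGroups_of_le (p := p) rep hrep hs K c
      have h3 := hmin K'' ⟨π', h1⟩
      rw [lt_div_iff₀ hf0, mul_comm] at hc
      linarith
    refine ⟨K', π, hπ, hle.trans (mul_le_mul_of_nonneg_right (max_le (by norm_num) ?_) h0),
      fun hlt => ?_⟩
    · have : 0 < 2 / ((I.n / I.k : ℕ) : ℝ) := by positivity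
      linarith
    -- In this case s ≤ 2·cost < B + 1, so the factor is at most max(1, 2 - 2/B).
    · have hsB : I.n / I.k ≤ I.B := by
        have : ((I.n / I.k : ℕ) : ℝ) < I.B + 1 := by linarith
        exact Nat.lt_succ_iff.1 (by exact_mod_cast this)
      have hsB' : ((I.n / I.k : ℕ) : ℝ) ≤ I.B := by exact_mod_cast hsB
      have hB0 : (0 : ℝ) < I.B := hsR.trans_le hsB'
      refine hle.trans ?_
      rcases max_cases 1 (2 - 2 / ((I.n / I.k : ℕ) : ℝ)) with ⟨h1, _⟩ | ⟨h1, h2⟩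
      · rw [hf, h1]; linarith
      · rw [hf, h1]
        have h3 : 2 / (I.B : ℝ) ≤ 2 / ((I.n / I.k : ℕ) : ℝ) :=
          div_le_div_of_nonneg_left (by norm_num) hsR hsB'
        have h4 : (2 - 2 / ((I.n / I.k : ℕ) : ℝ)) * cost p I K ≤ (2 - 2 / (I.B : ℝ)) * cost p I K :=
          mul_le_mul_of_nonneg_right (by linarith) h0
        refine h4.trans ?_
        have h5 : (2 - 2 / (I.B : ℝ)) * cost p I K ≤ (2 - 2 / (I.B : ℝ)) * ((I.B + 1) / 2) :=
          mul_le_mul_of_nonneg_left (by linarith) (by linarith)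
        refine h5.trans ?_
        -- The cost is below (B + 1)/2, and this identity shows that the improved factor brings it
        -- back under `B`; the factor 2 would only give `B + 1`.
        have h6 : (2 - 2 / (I.B : ℝ)) * ((I.B + 1) / 2) = I.B - 1 / I.B := by field_simp; ring
        rw [h6]
        have : 0 < 1 / (I.B : ℝ) := by positivity
        linarith

end Grouping

end EqualClustering

/-! ### Deleting surplus copies of majority points -/

namespace EqualClustering

open Finset

/-- The open points, which belong to no group. -/
def openPoints {I : Instance} {G : ℕ} (grp : Fin I.n → Option (Fin G)) : Finset (Fin I.n) :=
  univ.filter fun i => grp i = none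

/-- A greedy grouping of the points, together with a set of points to be deleted. -/
structure IsPruning (I : Instance) {G : ℕ} (grp : Fin I.n → Option (Fin G)) (e : ℕ)
    (del : Finset (Fin I.n)) : Prop extends IsGrouping I grp where
  pos : 0 < I.n / I.k
  e_eq : e = I.n / I.k - (2 * I.B + 1)
  copies_lt : ∀ i, (copies I (openPoints grp) i).card < I.n / I.k
  del_subset : del ⊆ openPoints grp
  card_del : ∀ i, (copies I del i).card =
    if e + I.B + 1 ≤ (copies I (openPoints grp) i).card then e else 0

variable {p : ℕ} {I I' : Instance} {G : ℕ} {grp : Fin I.n → Option (Fin G)} {e : ℕ}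
  {del : Finset (Fin I.n)}

theorem copies_subset (X : Finset (Fin I.n)) (i : Fin I.n) : copies I X i ⊆ X := filter_subset _ _

theorem copies_mono {X Y : Finset (Fin I.n)} (h : X ⊆ Y) (i : Fin I.n) : copies I X i ⊆ copies I Y i :=
  filter_subset_filter _ h

theorem mem_copies {X : Finset (Fin I.n)} {i j : Fin I.n} :
    j ∈ copies I X i ↔ j ∈ X ∧ I.pts j = I.pts i := mem_filter

theorem mem_openPoints {i : Fin I.n} : i ∈ openPoints grp ↔ grp i = none := by simp [openPoints]

theorem copies_add_copies_le {X : Finset (Fin I.n)} {i j : Fin I.n} (h : I.pts i ≠ I.pts j) :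
    (copies I X i).card + (copies I X j).card ≤ X.card := by
  rw [← card_union_of_disjoint]
  · exact card_le_card (union_subset (copies_subset X i) (copies_subset X j))
  · rw [disjoint_left]
    intro l hl hl'
    exact h ((mem_copies.1 hl).2.symm.trans (mem_copies.1 hl').2)

theorem RespectsGroups.open_of_notMem_range {K : Clustering I} {π : Fin G → Fin I.k} (hK : RespectsGroups grp K π)
    {i : Fin I.n} (hi : K.assign i ∉ Set.range π) : grp i = none := by
  by_contra hcon
  obtain ⟨t, ht⟩ := Option.ne_none_iff_exists'.1 hcon
  exact hi ⟨t, (hK.2 i t ht).symm⟩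

theorem RespectsGroups.card_notMem_range {K : Clustering I} {π : Fin G → Fin I.k}
    (hK : RespectsGroups grp K π) : (univ.filter fun j => j ∉ Set.range π).card + G = I.k := by
  classical
  have h1 := card_filter_add_card_filter_not (s := univ) (fun j => j ∉ Set.range π)
  have h2 : (univ.filter fun j => ¬ j ∉ Set.range π) = univ.image π := by
    ext j; simp
  rw [h2, card_image_of_injective _ hK.1, card_univ, Fintype.card_fin, card_univ,
    Fintype.card_fin] at h1
  exact h1

namespace IsPruning

variable (h : IsPruning I grp e del)
include h

theorem del_eq_empty (he : e = 0) : del = ∅ := by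
  rw [eq_empty_iff_forall_notMem]
  intro i hi
  have h1 := h.card_del i
  subst he
  rw [ite_self, card_eq_zero] at h1
  exact notMem_empty i (h1 ▸ mem_copies.2 ⟨hi, rfl⟩)

theorem le_copies_of_mem_del {i : Fin I.n} (hi : i ∈ del) :
    e + I.B + 1 ≤ (copies I (openPoints grp) i).card := by
  by_contra hcon
  have h1 := h.card_del i
  rw [if_neg hcon, card_eq_zero] at h1
  exact notMem_empty i (h1 ▸ mem_copies.2 ⟨hi, rfl⟩)

theorem card_grouped : (univ.filter fun i => ¬ grp i = none).card = G * (I.n / I.k) := by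
  have h1 : (univ.filter fun i => ¬ grp i = none) =
      univ.biUnion fun t => univ.filter fun i => grp i = some t := by
    ext i
    simp [Option.ne_none_iff_exists']
  rw [h1, card_biUnion, sum_const_nat fun t _ => h.card_eq t, card_univ, Fintype.card_fin]
  intro t _ t' _ htt'
  rw [Function.onFun, disjoint_left]
  intro i hi hi'
  simp only [mem_filter, mem_univ, true_and] at hi hi'
  exact htt' (Option.some_injective _ (hi.symm.trans hi'))

theorem card_retained : G * (I.n / I.k) + (openPoints grp \ del).card + del.card = I.n := by
  have h1 := card_filter_add_card_filter_not (s := univ) (fun i => grp i = none)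
  rw [h.card_grouped, card_univ, Fintype.card_fin] at h1
  have h2 := card_sdiff_add_card_eq_card h.del_subset
  change (openPoints grp).card + _ = _ at h1
  omega

theorem copies_retained (i : Fin I.n) :
    (copies I (openPoints grp \ del) i).card + (copies I del i).card =
      (copies I (openPoints grp) i).card := by
  rw [← card_union_of_disjoint]
  · congr 1
    rw [copies, copies, copies, ← filter_union, sdiff_union_of_subset h.del_subset]
  · exact (disjoint_sdiff_self_left).mono (copies_subset _ i) (copies_subset _ i)

section Restrict

variable {K : Clustering I} {π : Fin G → Fin I.k} (hK : RespectsGroups grp K π)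
include hK

theorem fiber_eq_group (t : Fin G) :
    (univ.filter fun i => K.assign i = π t) = univ.filter fun i => grp i = some t := by
  refine (eq_of_subset_of_card_le (fun i hi => ?_) ?_).symm
  · simp only [mem_filter, mem_univ, true_and] at hi ⊢
    exact hK.2 i t hi
  · rw [h.card_eq, K.card_eq]

theorem notMem_range_of_open {i : Fin I.n} (hi : grp i = none) : K.assign i ∉ Set.range π := by
  rintro ⟨t, ht⟩
  have h1 : i ∈ univ.filter fun i => K.assign i = π t := by simp [ht]
  rw [h.fiber_eq_group hK] at h1
  simp [hi] at h1

theorem clusterCost_group (t : Fin G) :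
    clusterCost p I (univ.filter fun i => K.assign i = π t) = 0 := by
  rw [h.fiber_eq_group hK]
  exact clusterCost_eq_zero fun i hi j hj => by
    simp only [mem_filter, mem_univ, true_and] at hi hj
    exact h.pts_eq i j t hi hj

theorem cost_eq_sum_open : cost p I K =
    ∑ j ∈ univ.filter (fun j => j ∉ Set.range π),
      clusterCost p I (univ.filter fun i => K.assign i = j) := by
  classical
  rw [cost, ← sum_filter_add_sum_filter_not univ (fun j => j ∉ Set.range π)]
  rw [add_eq_left]
  refine sum_eq_zero fun j hj => ?_
  obtain ⟨t, rfl⟩ : j ∈ Set.range π := by simpa using hj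
  exact h.clusterCost_group hK t

/-- The cluster consists of `n / k` open points, while any single point has fewer open copies than
that. -/
theorem exists_ne_of_open {j : Fin I.k} (hj : j ∉ Set.range π) :
    ∃ i₁ ∈ univ.filter (fun i => K.assign i = j), ∃ i₂ ∈ univ.filter (fun i => K.assign i = j),
      I.pts i₁ ≠ I.pts i₂ := by
  by_contra! hcon
  have h1 := K.card_eq j
  obtain ⟨i, hi⟩ := card_pos.1 (h1 ▸ h.pos)
  have h2 := h.copies_lt i
  rw [← h1] at h2
  refine absurd (card_le_card fun i' hi' => ?_) (not_le.2 h2)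
  rw [mem_copies, mem_openPoints]
  refine ⟨hK.open_of_notMem_range ?_, hcon i' hi' i hi⟩
  rw [(mem_filter.1 hi').2]
  exact hj

/-- Each cluster that is not a group contains two different points and so costs at least 1. -/
theorem card_open_le (hB : cost p I K ≤ I.B) :
    (univ.filter fun j => j ∉ Set.range π).card ≤ I.B := by
  have h1 : ((univ.filter fun j => j ∉ Set.range π).card : ℝ) ≤ cost p I K := by
    rw [h.cost_eq_sum_open hK, card_eq_sum_ones]
    push_cast
    refine sum_le_sum fun j hj => ?_
    obtain ⟨i₁, hi₁, i₂, hi₂, hne⟩ := h.exists_ne_of_open hK (by simpa using hj)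
    exact one_le_clusterCost hi₁ hi₂ hne
  exact_mod_cast h1.trans hB

/-- The open points lie in the clusters that are not groups, and each of these costs at least half
the number of its different points. -/
theorem card_image_open_le (hB : cost p I K ≤ I.B) :
    ((openPoints grp).image I.pts).card ≤ 2 * I.B := by
  classical
  have h1 : (openPoints grp).image I.pts ⊆ (univ.filter fun j => j ∉ Set.range π).biUnion
      fun j => (univ.filter fun i => K.assign i = j).image I.pts := by
    intro v hv
    obtain ⟨i, hi, rfl⟩ := mem_image.1 hv
    refine mem_biUnion.2 ⟨K.assign i, ?_, mem_image.2 ⟨i, by simp, rfl⟩⟩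
    simpa using h.notMem_range_of_open hK (mem_openPoints.1 hi)
  have h2 : (((openPoints grp).image I.pts).card : ℝ) ≤ 2 * cost p I K := by
    have h3 := (card_le_card h1).trans card_biUnion_le
    refine (Nat.cast_le.2 h3).trans ?_
    rw [h.cost_eq_sum_open hK, mul_sum]
    push_cast
    refine sum_le_sum fun j hj => ?_
    refine card_image_le_clusterCost ?_
    obtain ⟨i₁, hi₁, i₂, hi₂, hne⟩ := h.exists_ne_of_open hK (by simpa using hj)
    exact one_lt_card.2 ⟨_, mem_image_of_mem _ hi₁, _, mem_image_of_mem _ hi₂, hne⟩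
  exact_mod_cast (by linarith : (((openPoints grp).image I.pts).card : ℝ) ≤ 2 * I.B)

/-- A clustering can be rearranged so that the same number of points is deleted from every cluster
that is not a group. -/
theorem exists_restrict (hB : cost p I K ≤ I.B) :
    ∃ K' : Clustering I, RespectsGroups grp K' π ∧
      (∀ j ∉ Set.range π, ((openPoints grp \ del).filter fun i => K'.assign i = j).card =
        I.n / I.k - e) ∧
      ∑ j ∈ univ.filter (fun j => j ∉ Set.range π),
        clusterCost p I ((openPoints grp \ del).filter fun i => K'.assign i = j) ≤ cost p I K := by
  classical
  rcases Nat.eq_zero_or_pos e with he | he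
  · refine ⟨K, hK, fun j hj => ?_, ?_⟩
    · rw [h.del_eq_empty he, sdiff_empty, he, Nat.sub_zero, ← K.card_eq j]
      congr 1
      ext i
      simp only [mem_filter, mem_univ, true_and, mem_openPoints, and_iff_right_iff_imp]
      rintro rfl
      exact hK.open_of_notMem_range hj
    · rw [h.cost_eq_sum_open hK]
      refine sum_le_sum fun j _ => clusterCost_mono fun i hi => ?_
      simp only [mem_filter, mem_univ, true_and] at hi ⊢
      exact hi.2
  have hs : 2 * I.B + 1 + e = I.n / I.k := by have := h.e_eq; omega
  have hsR : ((I.n / I.k : ℕ) : ℝ) = 2 * I.B + 1 + e := by rw [← hs]; push_cast; rfl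
  have heR : (0 : ℝ) ≤ e := by positivity
  have hmaj := fun j => exists_majority (p := p) (X := univ.filter fun i => K.assign i = j) (by
    have := clusterCost_le_cost (p := p) K j
    rw [K.card_eq, hsR]; linarith)
  choose m hm hm2 hmle hmcard using hmaj
  have hmj : ∀ j, K.assign (m j) = j := fun j => by simpa using hm j
  have hopen : ∀ j ∉ Set.range π, copies I (univ.filter fun i => K.assign i = j) (m j) ⊆
      copies I (openPoints grp) (m j) := fun j hj => copies_mono (fun i hi => by
    rw [mem_openPoints]
    exact hK.open_of_notMem_range (by rwa [(mem_filter.1 hi).2])) _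
  -- The cluster has 2B + 1 + e points, and at most B of them differ from the majority point.
  have hbig : ∀ j, e + I.B + 1 ≤ (copies I (univ.filter fun i => K.assign i = j) (m j)).card := by
    intro j
    have h1 := hmcard j
    have h2 := clusterCost_le_cost (p := p) K j
    rw [K.card_eq, hsR] at h1
    have : ((e + I.B + 1 : ℕ) : ℝ) ≤ (copies I (univ.filter fun i => K.assign i = j) (m j)).card := by
      push_cast; linarith
    exact_mod_cast this
  -- Two clusters with the same majority point would contain 2(e + B + 1) > s open copies of it.
  have hinj : ∀ j ∉ Set.range π, ∀ j' ∉ Set.range π, I.pts (m j) = I.pts (m j') → j = j' := by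
    intro j hj j' hj' heq
    by_contra hne
    have h1 : copies I (openPoints grp) (m j') = copies I (openPoints grp) (m j) := by
      unfold copies; rw [heq]
    have h2 := card_union_of_disjoint
      (s := copies I (univ.filter fun i => K.assign i = j) (m j))
      (t := copies I (univ.filter fun i => K.assign i = j') (m j')) (by
        rw [disjoint_left]
        intro i hi hi'
        have h3 := (mem_filter.1 (mem_copies.1 hi).1).2
        have h4 := (mem_filter.1 (mem_copies.1 hi').1).2
        exact hne (h3.symm.trans h4))
    have h3 := card_le_card (union_subset (hopen j hj) (h1 ▸ hopen j' hj'))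
    have h4 := h.copies_lt (m j)
    have := hbig j
    have := hbig j'
    omega
  -- If it were the majority nowhere, all its open copies, more than `B` of them, would be paid for.
  have hex : ∀ i ∈ del, ∃ j, j ∉ Set.range π ∧ I.pts (m j) = I.pts i := by
    intro i hi
    by_contra! hcon
    have h1 := h.le_copies_of_mem_del hi
    have h2 : ((copies I (openPoints grp) i).card : ℝ) ≤ cost p I K := by
      rw [h.cost_eq_sum_open hK]
      have h3 : (copies I (openPoints grp) i).card ≤ ∑ j ∈ univ.filter (fun j => j ∉ Set.range π),
          (copies I (univ.filter fun i => K.assign i = j) i).card := by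
        refine le_trans (card_le_card fun i' hi' => ?_) card_biUnion_le
        rw [mem_copies, mem_openPoints] at hi'
        refine mem_biUnion.2 ⟨K.assign i', ?_, mem_copies.2 ⟨by simp, hi'.2⟩⟩
        simpa using h.notMem_range_of_open hK hi'.1
      refine (Nat.cast_le.2 h3).trans ?_
      push_cast
      refine sum_le_sum fun j hj => ?_
      have h4 := copies_add_copies_le (X := univ.filter fun i => K.assign i = j)
        (hcon j (by simpa using hj))
      have h5 := hmcard j
      have h6 : ((copies I (univ.filter fun i => K.assign i = j) (m j)).card : ℝ) +
        (copies I (univ.filter fun i => K.assign i = j) i).card ≤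
          (univ.filter fun i => K.assign i = j).card := by exact_mod_cast h4
      linarith
    have h3 : ((e + I.B + 1 : ℕ) : ℝ) ≤ I.B := (Nat.cast_le.2 h1).trans (h2.trans hB)
    have h4 : e + I.B + 1 ≤ I.B := by exact_mod_cast h3
    omega
  have : Nonempty (Fin I.k) := ⟨⟨0, I.k_pos⟩⟩
  choose! w hw hwm using hex
  -- Deleted points are sent to the cluster whose majority they equal. Grouped points are given
  -- their present cluster as destination, so that the exchange does not disturb the groups.
  let g : Fin I.n → Option (Fin I.k) := fun i =>
    if i ∈ del then some (w i) else (grp i).map π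
  have hgrep : ∀ t, ∃ i, grp i = some t := fun t => by
    obtain ⟨i, hi⟩ := card_pos.1 ((h.card_eq t).symm ▸ h.pos)
    exact ⟨i, by simpa using hi⟩
  have hmπ : ∀ i t, grp i = some t → pt I (m (π t)) = pt I i := by
    intro i t hit
    have h1 := hm (π t)
    rw [h.fiber_eq_group hK] at h1
    unfold pt
    rw [h.pts_eq _ _ t (by simpa using h1) hit]
  have hgdel : ∀ j ∉ Set.range π, (univ.filter fun i => g i = some j) = copies I del (m j) := by
    intro j hj
    ext i
    rw [mem_copies, mem_filter]
    simp only [mem_univ, true_and, g]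
    split_ifs with hi
    · simp only [Option.some.injEq, hi, true_and]
      constructor
      · rintro rfl
        exact (hwm i hi).symm
      · intro h1
        exact hinj _ (hw i hi) _ hj ((hwm i hi).trans h1)
    · simp only [hi, false_and, iff_false, Option.map_eq_some_iff, not_exists, not_and]
      intro t _ h1
      exact hj ⟨t, h1⟩
  have hggrp : ∀ t, (univ.filter fun i => g i = some (π t)) ⊆ univ.filter fun i => grp i = some t := by
    intro t i hi
    simp only [mem_filter, mem_univ, true_and, g] at hi ⊢
    split_ifs at hi with hdel
    · have := hw i hdel
      rw [Option.some_injective _ hi] at this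
      exact absurd ⟨t, rfl⟩ this
    · obtain ⟨t', ht', h1⟩ := Option.map_eq_some_iff.1 hi
      rwa [← hK.1 h1]
  have hcarddel : ∀ j ∉ Set.range π, (copies I del (m j)).card = e := fun j hj => by
    rw [h.card_del, if_pos ((hbig j).trans (card_le_card (hopen j hj)))]
  obtain ⟨a, ha, hag, hale⟩ := exists_exchange (p := p) (pt I) (fun j => pt I (m j)) g (I.n / I.k)
    (fun i j hij => by
      simp only [g] at hij
      split_ifs at hij with hi
      · obtain rfl := Option.some_injective _ hij
        unfold pt
        rw [hwm i hi]
      · obtain ⟨t, ht, rfl⟩ := Option.map_eq_some_iff.1 hij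
        exact hmπ i t ht)
    (fun j => by
      by_cases hj : j ∈ Set.range π
      · obtain ⟨t, rfl⟩ := hj
        exact (card_le_card (hggrp t)).trans (h.card_eq t).le
      · rw [hgdel j hj, hcarddel j hj]
        omega) K.assign K.isBalanced
  have hresp : RespectsGroups grp ⟨a, ha⟩ π := ⟨hK.1, fun i t hit => hag i _ (by
    have : i ∉ del := fun hi => by
      have := mem_openPoints.1 (h.del_subset hi)
      simp [hit] at this
    simp [g, this, hit])⟩
  refine ⟨⟨a, ha⟩, hresp, fun j hj => ?_, ?_⟩
  · have h1 : (univ.filter fun i => a i = j) =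
        ((openPoints grp \ del).filter fun i => a i = j) ∪ copies I del (m j) := by
      rw [← hgdel j hj]
      ext i
      simp only [mem_filter, mem_univ, true_and, mem_union, mem_sdiff, mem_openPoints]
      constructor
      · intro hi
        by_cases hdel : i ∈ del
        · right
          have h2 : g i = some (w i) := by simp [g, hdel]
          have h3 := hag i _ h2
          rw [h2, ← h3, hi]
        · left
          exact ⟨⟨hresp.open_of_notMem_range (by simpa [hi] using hj), hdel⟩, hi⟩
      · rintro (hi | hi)
        · exact hi.2
        · exact hag i j hi
    have h2 := ha j
    rw [h1, card_union_of_disjoint, hcarddel j hj] at h2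
    · change ((openPoints grp \ del).filter fun i => a i = j).card = _
      omega
    · exact (disjoint_sdiff_self_left).mono (filter_subset _ _) (copies_subset _ _)
  · rw [← sum_lpDist_fiberwise K.assign (fun j => pt I (m j))] at hale
    rw [← sum_lpDist_fiberwise a (fun j => pt I (m j))] at hale
    have h1 := hale.trans (sum_le_sum fun j _ => hmle j)
    refine le_trans ?_ h1
    refine (sum_le_sum_of_subset_of_nonneg (subset_univ _)
      fun _ _ _ => clusterCost_nonneg _).trans ?_
    refine sum_le_sum fun j _ => (clusterCost_mono ?_).trans (clusterCost_le _ _)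
    intro i hi
    simp only [mem_filter, mem_univ, true_and] at hi ⊢
    exact hi.2

/-- This is one of the conditions tested by the reduction; it holds because every remaining cluster
loses exactly `e` points. -/
theorem card_retained_eq (hB : cost p I K ≤ I.B) :
    (openPoints grp \ del).card =
      (univ.filter fun j => j ∉ Set.range π).card * (I.n / I.k - e) := by
  classical
  obtain ⟨K', hK', hcard, _⟩ := h.exists_restrict hK hB
  rw [card_eq_sum_card_fiberwise (f := K'.assign) (t := univ.filter fun j => j ∉ Set.range π)]
  · exact sum_const_nat fun j hj => hcard j (by simpa using hj)
  · intro i hi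
    have hi' : i ∈ openPoints grp \ del := hi
    simpa using h.notMem_range_of_open hK' (mem_openPoints.1 (mem_sdiff.1 hi').1)

end Restrict

end IsPruning

end EqualClustering

/-! ### Passing between clusterings of the two instances -/

namespace EqualClustering

open Finset

/-- `I'` is the reduced instance: its points correspond to the open points of `I` that are not
deleted, and cheap clusters cost the same in both instances. -/
structure IsKernelization (p : ℕ) (I I' : Instance) {G : ℕ} (grp : Fin I.n → Option (Fin G)) (e : ℕ)
    (del : Finset (Fin I.n)) (emb : Fin I'.n ↪ Fin I.n) : Prop extends IsPruning I grp e del where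
  k_eq : I'.k + G = I.k
  n_eq : I'.n / I'.k = I.n / I.k - e
  map_eq : univ.map emb = openPoints grp \ del
  cost_map_le : ∀ Y : Finset (Fin I'.n), clusterCost p I' Y ≤ I.B →
    clusterCost p I (Y.map emb) ≤ clusterCost p I' Y
  cost_le_map : ∀ Y : Finset (Fin I'.n), clusterCost p I (Y.map emb) ≤ I.B →
    clusterCost p I' Y ≤ clusterCost p I (Y.map emb)

variable {p : ℕ} {I I' : Instance} {G : ℕ} {grp : Fin I.n → Option (Fin G)} {e : ℕ}
  {del : Finset (Fin I.n)} {emb : Fin I'.n ↪ Fin I.n}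

/-- The points of the reduced instance in the same cluster as `i'` that are copies of `i`. -/
def clusterCopies (I : Instance) {I' : Instance} (emb : Fin I'.n ↪ Fin I.n) (K' : Clustering I')
    (i : Fin I.n) (i' : Fin I'.n) : Finset (Fin I'.n) :=
  univ.filter fun l => I.pts (emb l) = I.pts i ∧ K'.assign l = K'.assign i'

namespace IsKernelization

variable (h : IsKernelization p I I' grp e del emb)
include h

theorem mem_range {i : Fin I.n} : (∃ i', emb i' = i) ↔ i ∈ openPoints grp \ del := by
  rw [← h.map_eq]; simp

theorem emb_mem (i' : Fin I'.n) : emb i' ∈ openPoints grp \ del := h.mem_range.1 ⟨i', rfl⟩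

/-- A cheap clustering that respects the groups induces a clustering of the reduced instance. -/
theorem exists_clustering_le {K : Clustering I} {π : Fin G → Fin I.k} (hK : RespectsGroups grp K π)
    (hB : cost p I K ≤ I.B) : ∃ K' : Clustering I', cost p I' K' ≤ cost p I K := by
  classical
  obtain ⟨K₁, hK₁, hcard, hle⟩ := h.exists_restrict hK hB
  have hk : Fintype.card {j // j ∉ Set.range π} = Fintype.card (Fin I'.k) := by
    have h1 := hK.card_notMem_range
    have h2 := h.k_eq
    rw [Fintype.card_subtype, Fintype.card_fin]
    omega
  let φ := Fintype.equivOfCardEq hk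
  have hr : ∀ i', K₁.assign (emb i') ∉ Set.range π := fun i' =>
    h.notMem_range_of_open hK₁ (mem_openPoints.1 (mem_sdiff.1 (h.emb_mem i')).1)
  have hmap : ∀ j : {j // j ∉ Set.range π},
      (univ.filter fun i' => φ ⟨K₁.assign (emb i'), hr i'⟩ = φ j).map emb =
        (openPoints grp \ del).filter fun i => K₁.assign i = j := by
    intro j
    rw [← h.map_eq, filter_map]
    congr 1
    ext i'
    simp [Subtype.ext_iff]
  refine ⟨⟨fun i' => φ ⟨K₁.assign (emb i'), hr i'⟩, fun j => ?_⟩, ?_⟩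
  · obtain ⟨j, rfl⟩ := φ.surjective j
    rw [← card_map emb, hmap, hcard j j.2, h.n_eq]
  · refine le_trans ?_ hle
    rw [cost, ← φ.sum_comp, sum_subtype (p := fun j => j ∉ Set.range π)
      (univ.filter fun j => j ∉ Set.range π) (by simp)
      (fun j => clusterCost p I ((openPoints grp \ del).filter fun i => K₁.assign i = j))]
    refine sum_le_sum fun j _ => ?_
    rw [← hmap j]
    refine h.cost_le_map _ ?_
    rw [hmap j]
    refine le_trans ?_ (hle.trans hB)
    exact single_le_sum (f := fun j : Fin I.k =>
      clusterCost p I ((openPoints grp \ del).filter fun i => K₁.assign i = j))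
      (fun _ _ => clusterCost_nonneg _) (by simpa using j.2)

/-- In a cheap clustering of the reduced instance the deleted values are exactly the majorities of
the clusters, each occurring once. Every cluster thus recovers `e` copies of its own median at no
cost. The last clause describes the placement by counting, as the lifting algorithm does. -/
theorem exists_placement (K' : Clustering I') (hB : cost p I' K' ≤ I.B) :
    ∃ w : Fin I.n → Fin I'.k, (∀ j, (del.filter fun i => w i = j).card = e) ∧
      (∀ j, clusterCost p I (((univ.filter fun i' => K'.assign i' = j).map emb) ∪
        del.filter fun i => w i = j) ≤ clusterCost p I' (univ.filter fun i' => K'.assign i' = j)) ∧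
      ∀ i ∈ del, (∃ i', I.pts (emb i') = I.pts i ∧ I.B + 1 ≤ (clusterCopies I emb K' i i').card) ∧
        ∀ i', I.B + 1 ≤ (clusterCopies I emb K' i i').card → w i = K'.assign i' := by
  classical
  have hle : ∀ j, clusterCost p I ((univ.filter fun i' => K'.assign i' = j).map emb) ≤
      clusterCost p I' (univ.filter fun i' => K'.assign i' = j) := fun j =>
    h.cost_map_le _ ((clusterCost_le_cost K' j).trans hB)
  rcases Nat.eq_zero_or_pos e with he | he
  · have hd := h.del_eq_empty he
    exact ⟨fun _ => ⟨0, I'.k_pos⟩, by simp [hd, he], by simpa [hd] using hle, by simp [hd]⟩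
  have hs : 2 * I.B + 1 + e = I.n / I.k := by have := h.e_eq; omega
  have hs' : I'.n / I'.k = 2 * I.B + 1 := by have := h.n_eq; omega
  have hZ : ∀ j, ((univ.filter fun i' => K'.assign i' = j).map emb).card = 2 * I.B + 1 := fun j => by
    rw [card_map, K'.card_eq, hs']
  have hleB : ∀ j, clusterCost p I ((univ.filter fun i' => K'.assign i' = j).map emb) ≤ I.B :=
    fun j => (hle j).trans ((clusterCost_le_cost K' j).trans hB)
  have hmaj := fun j => exists_majority (p := p)
    (X := (univ.filter fun i' => K'.assign i' = j).map emb) (by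
      rw [hZ]; push_cast; linarith [hleB j])
  choose m hm hm2 hmle hmcard using hmaj
  have hbig : ∀ j, I.B + 1 ≤ (copies I ((univ.filter fun i' => K'.assign i' = j).map emb) (m j)).card := by
    intro j
    have h1 := hmcard j
    rw [hZ] at h1
    push_cast at h1
    have h2 := hleB j
    have : ((I.B + 1 : ℕ) : ℝ) ≤
        (copies I ((univ.filter fun i' => K'.assign i' = j).map emb) (m j)).card := by
      push_cast; linarith
    exact_mod_cast this
  -- At least `B + 1` copies of a deleted point are retained; were they in the minority everywhere,
  -- the cost would exceed `B`.
  have hex : ∀ i ∈ del, ∃ j, I.pts (m j) = I.pts i := by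
    intro i hi
    by_contra! hcon
    have h1 := h.le_copies_of_mem_del hi
    have h2 := h.copies_retained i
    have h3 := h.card_del i
    rw [if_pos h1] at h3
    have h4 : ((copies I (openPoints grp \ del) i).card : ℝ) ≤ cost p I' K' := by
      have h5 : (copies I (openPoints grp \ del) i).card ≤
          ∑ j, (copies I ((univ.filter fun i' => K'.assign i' = j).map emb) i).card := by
        refine le_trans (card_le_card fun l hl => ?_) card_biUnion_le
        obtain ⟨hl, hl'⟩ := mem_copies.1 hl
        obtain ⟨l', rfl⟩ := h.mem_range.2 hl
        exact mem_biUnion.2 ⟨K'.assign l', mem_univ _, mem_copies.2 ⟨by simp, hl'⟩⟩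
      refine (Nat.cast_le.2 h5).trans ?_
      push_cast
      refine sum_le_sum fun j _ => ?_
      have h6 := copies_add_copies_le (X := (univ.filter fun i' => K'.assign i' = j).map emb) (hcon j)
      have h7 := hmcard j
      have h8 : ((copies I ((univ.filter fun i' => K'.assign i' = j).map emb) (m j)).card : ℝ) +
        (copies I ((univ.filter fun i' => K'.assign i' = j).map emb) i).card ≤
          ((univ.filter fun i' => K'.assign i' = j).map emb).card := by exact_mod_cast h6
      linarith [hle j]
    have h5 : (copies I (openPoints grp \ del) i).card ≤ I.B := by exact_mod_cast h4.trans hB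
    omega
  have hsub : del.image I.pts ⊆ univ.image fun j => I.pts (m j) := by
    intro v hv
    obtain ⟨i, hi, rfl⟩ := mem_image.1 hv
    obtain ⟨j, hj⟩ := hex i hi
    exact mem_image.2 ⟨j, mem_univ _, hj⟩
  have hcopies : ∀ i ∈ del, (copies I del i).card = e := fun i hi => by
    rw [h.card_del, if_pos (h.le_copies_of_mem_del hi)]
  have hdel : del.card = (del.image I.pts).card * e := by
    rw [card_eq_sum_card_image I.pts del]
    refine sum_const_nat fun v hv => ?_
    obtain ⟨i, hi, rfl⟩ := mem_image.1 hv
    exact hcopies i hi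
  -- Comparing the numbers of points of both instances shows that exactly `e` points per remaining
  -- cluster were deleted. With `e` copies per value, there are as many values as clusters.
  have hcard : (del.image I.pts).card = I'.k := by
    have h1 := h.card_retained
    have h2 : (openPoints grp \ del).card = I'.n := by rw [← h.map_eq]; simp
    have h3 : I'.n = I'.k * (2 * I.B + 1) := by rw [← hs', Nat.mul_div_cancel' I'.k_dvd]
    have h4 : I.n = I.k * (2 * I.B + 1 + e) := by rw [hs, Nat.mul_div_cancel' I.k_dvd]
    rw [h2, ← hs, h3, hdel] at h1
    have h5 : (del.image I.pts).card * e = I'.k * e := by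
      have := h4
      rw [← h.k_eq] at this
      nlinarith
    exact Nat.eq_of_mul_eq_mul_right he h5
  have himg : del.image I.pts = univ.image fun j => I.pts (m j) :=
    eq_of_subset_of_card_le hsub (by
      rw [hcard]
      exact card_image_le.trans (by simp))
  have hinj : Function.Injective fun j => I.pts (m j) := by
    have h1 : (univ.image fun j => I.pts (m j)).card = (univ : Finset (Fin I'.k)).card := by
      rw [← himg, hcard]; simp
    have h2 := card_image_iff.1 h1
    intro j j' hjj'
    exact h2 (by simp) (by simp) hjj'
  have : Nonempty (Fin I'.k) := ⟨⟨0, I'.k_pos⟩⟩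
  choose! w hw using hex
  have hW : ∀ j, ∃ i ∈ del, (del.filter fun i => w i = j) = copies I del i ∧
      I.pts i = I.pts (m j) := by
    intro j
    have h1 : I.pts (m j) ∈ del.image I.pts := by rw [himg]; exact mem_image_of_mem _ (mem_univ j)
    obtain ⟨i, hi, hij⟩ := mem_image.1 h1
    refine ⟨i, hi, ?_, hij⟩
    ext l
    rw [mem_filter, mem_copies]
    refine and_congr_right fun hl => ?_
    rw [hij]
    constructor
    · rintro rfl
      exact (hw l hl).symm
    · intro h2
      exact hinj ((hw l hl).trans h2)
  refine ⟨w, fun j => ?_, fun j => ?_, fun i hi => ⟨?_, fun i' hi' => ?_⟩⟩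
  · obtain ⟨i, hi, hij, _⟩ := hW j
    rw [hij, hcopies i hi]
  · obtain ⟨i, hi, hij, him⟩ := hW j
    refine (clusterCost_le _ (pt I (m j))).trans ((le_trans ?_ (hmle j)).trans (hle j))
    rw [sum_union]
    · refine (add_le_iff_nonpos_right _).2 (sum_nonpos fun l hl => le_of_eq ?_)
      rw [hij] at hl
      have : pt I l = pt I (m j) := by unfold pt; rw [(mem_copies.1 hl).2, him]
      rw [this, lpDist_self]
    · rw [disjoint_left]
      intro l hl hl'
      obtain ⟨l', _, rfl⟩ := mem_map.1 hl
      exact (mem_sdiff.1 (h.emb_mem l')).2 (mem_filter.1 hl').1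
  · obtain ⟨i', hi', hi2⟩ := mem_map.1 (hm (w i))
    refine ⟨i', by rw [hi2]; exact hw i hi, ?_⟩
    refine (hbig (w i)).trans ?_
    rw [← card_map emb]
    refine card_le_card fun l hl => ?_
    obtain ⟨hl, hl'⟩ := mem_copies.1 hl
    obtain ⟨l', hl2, rfl⟩ := mem_map.1 hl
    refine mem_map_of_mem _ (mem_filter.2 ⟨mem_univ _, ?_, ?_⟩)
    · rw [hl', hw i hi]
    · rw [(mem_filter.1 hl2).2, (mem_filter.1 hi').2]
  · refine hinj ?_
    refine (hw i hi).trans ?_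
    by_contra hne
    have h1 := copies_add_copies_le
      (X := (univ.filter fun l => K'.assign l = K'.assign i').map emb) hne
    have h2 := hbig (K'.assign i')
    have h3 : I.B + 1 ≤
        (copies I ((univ.filter fun l => K'.assign l = K'.assign i').map emb) i).card := by
      refine hi'.trans ?_
      rw [← card_map emb]
      refine card_le_card fun l hl => ?_
      obtain ⟨l', hl', rfl⟩ := mem_map.1 hl
      obtain ⟨_, h4, h5⟩ := mem_filter.1 hl'
      exact mem_copies.2 ⟨mem_map_of_mem _ (by simpa using h5), h4⟩
    rw [hZ] at h1
    omega

theorem exists_lift (K' : Clustering I') (hB : cost p I' K' ≤ I.B) :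
    ∃ K : Clustering I, cost p I K ≤ cost p I' K' ∧
      (∀ i t, grp i = some t → (K.assign i : ℕ) = I'.k + t) ∧
      (∀ i', (K.assign (emb i') : ℕ) = K'.assign i') ∧
      ∀ i ∈ del, (∃ i', I.pts (emb i') = I.pts i ∧ I.B + 1 ≤ (clusterCopies I emb K' i i').card) ∧
        ∀ i', I.B + 1 ≤ (clusterCopies I emb K' i i').card → (K.assign i : ℕ) = K'.assign i' := by
  classical
  obtain ⟨w, hwcard, hwcost, hw⟩ := h.exists_placement K' hB
  -- The clusters of the reduced instance keep their numbers, and the groups follow.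
  let φ : Fin I'.k ⊕ Fin G ≃ Fin I.k := finSumFinEquiv.trans (finCongr h.k_eq)
  have hφl : ∀ j, (φ (Sum.inl j) : ℕ) = j := fun j => by simp [φ]
  have hφr : ∀ t, (φ (Sum.inr t) : ℕ) = I'.k + t := fun t => by simp [φ]
  have hex : ∀ i, ∃ c : Fin I'.k ⊕ Fin G, (∀ t, grp i = some t → c = Sum.inr t) ∧
      (∀ i', emb i' = i → c = Sum.inl (K'.assign i')) ∧ (i ∈ del → c = Sum.inl (w i)) := by
    intro i
    by_cases hi : i ∈ del
    · refine ⟨Sum.inl (w i), fun t ht => ?_, ?_, fun _ => rfl⟩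
      · have := mem_openPoints.1 (h.del_subset hi)
        simp [ht] at this
      · rintro i' rfl
        exact absurd hi (mem_sdiff.1 (h.emb_mem i')).2
    · cases hg : grp i with
      | some t =>
        refine ⟨Sum.inr t, fun t' ht => by rw [Option.some_injective _ ht], ?_, fun hi' => absurd hi' hi⟩
        rintro i' rfl
        have := mem_openPoints.1 (mem_sdiff.1 (h.emb_mem i')).1
        simp [hg] at this
      | none =>
        obtain ⟨i', rfl⟩ := h.mem_range.2 (mem_sdiff.2 ⟨mem_openPoints.2 hg, hi⟩)
        exact ⟨Sum.inl (K'.assign i'), by simp, fun i hi => by rw [emb.injective hi],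
          fun hi' => absurd hi' hi⟩
  choose c hcg hce hcd using hex
  have hfl : ∀ j, (univ.filter fun i => φ (c i) = φ (Sum.inl j)) =
      ((univ.filter fun i' => K'.assign i' = j).map emb) ∪ del.filter fun i => w i = j := by
    intro j
    ext i
    simp only [mem_filter, mem_univ, true_and, mem_union, mem_map, EmbeddingLike.apply_eq_iff_eq]
    constructor
    · intro hi
      by_cases hd : i ∈ del
      · right
        exact ⟨hd, Sum.inl_injective ((hcd i hd).symm.trans hi)⟩
      · left
        cases hg : grp i with
        | some t =>
          rw [hcg i t hg] at hi
          simp at hi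
        | none =>
          obtain ⟨i', rfl⟩ := h.mem_range.2 (mem_sdiff.2 ⟨mem_openPoints.2 hg, hd⟩)
          exact ⟨i', Sum.inl_injective ((hce _ i' rfl).symm.trans hi), rfl⟩
    · rintro (⟨i', rfl, rfl⟩ | ⟨hd, rfl⟩)
      · exact hce _ i' rfl
      · exact hcd i hd
  have hfr : ∀ t, (univ.filter fun i => φ (c i) = φ (Sum.inr t)) =
      univ.filter fun i => grp i = some t := by
    intro t
    ext i
    simp only [mem_filter, mem_univ, true_and, EmbeddingLike.apply_eq_iff_eq]
    refine ⟨fun hi => ?_, hcg i t⟩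
    cases hg : grp i with
    | some t' =>
      rw [hcg i t' hg] at hi
      rw [Sum.inr_injective hi]
    | none =>
      by_cases hd : i ∈ del
      · rw [hcd i hd] at hi
        simp at hi
      · obtain ⟨i', rfl⟩ := h.mem_range.2 (mem_sdiff.2 ⟨mem_openPoints.2 hg, hd⟩)
        rw [hce _ i' rfl] at hi
        simp at hi
  have hcard : ∀ j, (univ.filter fun i => φ (c i) = j).card = I.n / I.k := by
    intro j
    obtain ⟨j | t, rfl⟩ := φ.surjective j
    · rw [hfl, card_union_of_disjoint, card_map, K'.card_eq, hwcard, h.n_eq]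
      · have := h.e_eq
        have := h.pos
        omega
      · rw [disjoint_left]
        intro l hl hl'
        obtain ⟨l', _, rfl⟩ := mem_map.1 hl
        exact (mem_sdiff.1 (h.emb_mem l')).2 (mem_filter.1 hl').1
    · rw [hfr, h.card_eq]
  refine ⟨⟨fun i => φ (c i), hcard⟩, ?_, fun i t ht => ?_, fun i' => ?_, fun i hi => ?_⟩
  · rw [cost, ← φ.sum_comp, Fintype.sum_sum_type]
    refine (add_le_iff_nonpos_right _).2 (sum_nonpos fun t _ => le_of_eq ?_) |>.trans
      (sum_le_sum fun j _ => ?_)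
    · rw [hfr]
      exact clusterCost_eq_zero fun i hi j hj => by
        simp only [mem_filter, mem_univ, true_and] at hi hj
        exact h.pts_eq i j t hi hj
    · rw [hfl]
      exact hwcost j
  · simp only [hcg i t ht, hφr]
  · simp only [hce _ i' rfl, hφl]
  · refine ⟨(hw i hi).1, fun i' hi' => ?_⟩
    simp only [hcd i hi, hφl, (hw i hi).2 i' hi']

end IsKernelization

end EqualClustering

/-! ### Comparing costs after a change of coordinates -/

namespace EqualClustering

open Finset

section Transfer

variable {p d d' : ℕ} {ι : Type}

/-- The median cost does not increase if every coordinate is constant or can be matched to a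
coordinate with the same differences. -/
theorem iInf_sum_lpDist_le {Y : Finset ι} {x : ι → Fin d → ℤ} {y : ι → Fin d' → ℤ}
    (τ : Fin d → Option (Fin d')) (hτ : ∀ h h' t, τ h = some t → τ h' = some t → h = h')
    (hnone : ∀ h, τ h = none → ∀ i ∈ Y, ∀ j ∈ Y, x i h = x j h)
    (hsome : ∀ h t, τ h = some t → ∀ i ∈ Y, ∀ j ∈ Y,
      (p ≠ 0 → x i h - x j h = y i t - y j t) ∧ (y i t = y j t → x i h = x j h)) :
    (⨅ c : Fin d → ℝ, ∑ i ∈ Y, lpDist p c (fun h => (x i h : ℝ))) ≤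
      ⨅ c : Fin d' → ℝ, ∑ i ∈ Y, lpDist p c (fun h => (y i h : ℝ)) := by
  classical
  have key : ∀ h, ∃ φ : (Fin d' → ℝ) → ℝ, ∀ i ∈ Y, ∀ c,
      coordNorm p (φ c - x i h) ≤ match τ h with
        | none => 0
        | some t => coordNorm p (c t - y i t) := by
    intro h
    rcases Y.eq_empty_or_nonempty with rfl | ⟨i₀, hi₀⟩
    · exact ⟨fun _ => 0, by simp⟩
    cases ht : τ h with
    | none =>
      refine ⟨fun _ => x i₀ h, fun i hi c => ?_⟩
      rw [hnone h ht i₀ hi₀ i hi, sub_self, coordNorm_zero]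
    | some t =>
      rcases eq_or_ne p 0 with hp | hp
      -- For p = 0 a median coordinate matters only if it agrees with the entry of some point;
      -- otherwise every point already pays 1 there and any value will do.
      · refine ⟨fun c => if hc : ∃ i ∈ Y, c t = y i t then x hc.choose h else 0, fun i hi c => ?_⟩
        by_cases hci : c t = y i t
        · have hc : ∃ i ∈ Y, c t = y i t := ⟨i, hi, hci⟩
          have h1 := hc.choose_spec
          have h2 : y hc.choose t = y i t := by exact_mod_cast h1.2.symm.trans hci
          change coordNorm p ((if hc : ∃ i ∈ Y, c t = y i t then x hc.choose h else 0 : ℝ) - x i h) ≤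
            coordNorm p (c t - y i t)
          rw [dif_pos hc, (hsome h t ht _ h1.1 i hi).2 h2, sub_self, coordNorm_zero]
          exact coordNorm_nonneg _ _
        · have h1 : coordNorm p (c t - y i t) = 1 := by
            simp [coordNorm, hp, sub_eq_zero, hci]
          change _ ≤ coordNorm p (c t - y i t)
          rw [h1, coordNorm, if_pos hp]
          split_ifs <;> norm_num
      -- For p ≥ 1 equal differences mean that the two coordinates are translates of each other, so
      -- the median is translated too.
      · refine ⟨fun c => c t + (x i₀ h - y i₀ t), fun i hi c => le_of_eq ?_⟩
        have h1 := (hsome h t ht i₀ hi₀ i hi).1 hp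
        have h2 : (x i₀ h : ℝ) - x i h = y i₀ t - y i t := by exact_mod_cast h1
        congr 1
        linarith
  choose φ hφ using key
  refine le_ciInf fun c => ?_
  refine (ciInf_le ⟨0, by rintro _ ⟨c, rfl⟩; exact sum_nonneg fun _ _ => lpDist_nonneg _ _⟩
    (fun h => φ h c)).trans (sum_le_sum fun i hi => ?_)
  rw [lpDist_eq, lpDist_eq]
  refine root_le_root (sum_nonneg fun _ _ => coordNorm_nonneg _ _) ?_
  refine (sum_le_sum fun h _ => hφ h i hi c).trans ?_
  rw [← sum_filter_add_sum_filter_not univ (fun h => (τ h).isSome = true)]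
  have h1 : ∀ h ∈ univ.filter (fun h => ¬ (τ h).isSome = true), (match τ h with
        | none => 0
        | some t => coordNorm p (c t - y i t)) = 0 := by
    intro h hh
    have : τ h = none := by simpa using hh
    rw [this]
  rw [sum_eq_zero h1, add_zero]
  rcases Nat.eq_zero_or_pos d' with rfl | hd'
  · refine le_of_eq_of_le (sum_eq_zero fun h hh => ?_) (sum_nonneg fun _ _ => coordNorm_nonneg _ _)
    obtain ⟨t, ht⟩ := Option.isSome_iff_exists.1 (mem_filter.1 hh).2
    exact t.elim0
  have h2 : ∀ h ∈ univ.filter (fun h => (τ h).isSome = true), (match τ h with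
        | none => 0
        | some t => coordNorm p (c t - y i t)) =
      (fun t => coordNorm p (c t - y i t)) ((τ h).getD ⟨0, hd'⟩) := by
    intro h hh
    obtain ⟨t, ht⟩ := Option.isSome_iff_exists.1 (mem_filter.1 hh).2
    simp [ht]
  rw [sum_congr rfl h2, ← sum_image (f := fun t => coordNorm p (c t - y i t))
    (g := fun h => (τ h).getD ⟨0, hd'⟩)]
  · exact sum_le_sum_of_subset_of_nonneg (subset_univ _) fun _ _ _ => coordNorm_nonneg _ _
  · intro h hh h' hh' heq
    obtain ⟨t, ht⟩ := Option.isSome_iff_exists.1 (mem_filter.1 hh).2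
    obtain ⟨t', ht'⟩ := Option.isSome_iff_exists.1 (mem_filter.1 hh').2
    simp only [ht, ht', Option.getD_some] at heq
    exact hτ h h' t ht (heq ▸ ht')

theorem clusterCost_map {I I' : Instance} (emb : Fin I'.n ↪ Fin I.n) (Y : Finset (Fin I'.n)) :
    clusterCost p I (Y.map emb) =
      ⨅ c : Fin I.d → ℝ, ∑ i ∈ Y, lpDist p c (fun h => (I.pts (emb i) h : ℝ)) := by
  rw [clusterCost_eq]
  exact iInf_congr fun c => sum_map _ _ _

end Transfer

/-! ### Connected components of close points -/

section Components

variable {p B d : ℕ}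

theorem close_iff {x y : List ℤ} (hx : x.length = d) : close p B x y = true ↔
    ((range d).filter fun h => x.getD h 0 ≠ y.getD h 0).card ≤ B ^ max p 1 ∧
      ∀ h < d, (x.getD h 0 - y.getD h 0).natAbs ≤ 2 * B := by
  have h1 : ((List.range d).filter fun h => !decide (x.getD h 0 = y.getD h 0)).length =
      ((range d).filter fun h => x.getD h 0 ≠ y.getD h 0).card := by
    rw [← List.toFinset_card_of_nodup (List.nodup_range.filter _)]
    congr 1
    ext h
    simp
  unfold close
  rw [hx, h1]
  simp

theorem close_symm {x y : List ℤ} (hx : x.length = d) (hy : y.length = d)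
    (h : close p B x y = true) : close p B y x = true := by
  rw [close_iff hx] at h
  rw [close_iff hy]
  refine ⟨?_, fun i hi => ?_⟩
  · simpa only [ne_comm] using h.1
  · rw [← Int.natAbs_neg, neg_sub]
    exact h.2 i hi

/-- A new point absorbs all components that it is close to, so those left over contain nothing close
to it. -/
theorem components_pairwise (p B : ℕ) {W : List (List ℤ)} (hW : ∀ u ∈ W, u.length = d) :
    (components p B W).Pairwise fun g g' =>
      ∀ u ∈ g, ∀ v ∈ g', ¬ close p B u v = true ∧ ¬ close p B v u = true := by
  induction W with
  | nil => exact List.Pairwise.nil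
  | cons x W ih =>
    have hW' : ∀ u ∈ W, u.length = d := fun u hu => hW u (List.mem_cons_of_mem _ hu)
    specialize ih hW'
    rw [components_cons, List.pairwise_cons]
    refine ⟨fun g' hg' u hu v hv => ?_, ih.filter _⟩
    obtain ⟨hg', hx⟩ := List.mem_filter.1 hg'
    have hvW : v.length = d := hW' v ((components_flatten_perm p B W).subset
      (List.mem_flatten_of_mem hg' hv))
    rcases List.mem_cons.1 hu with rfl | hu
    · have h1 : ¬ close p B u v = true := by
        intro hc
        have : (g'.any fun y => close p B u y) = true := List.any_eq_true.2 ⟨v, hv, hc⟩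
        simp [this] at hx
      exact ⟨h1, fun hc => h1 (close_symm hvW (hW u List.mem_cons_self) hc)⟩
    · obtain ⟨g, hg, hu⟩ := List.mem_flatten.1 hu
      obtain ⟨hg, hgx⟩ := List.mem_filter.1 hg
      have : Std.Symm fun g g' : List (List ℤ) =>
          ∀ u ∈ g, ∀ v ∈ g', ¬ close p B u v = true ∧ ¬ close p B v u = true :=
        ⟨fun g g' h u hu v hv => (h v hv u hu).symm⟩
      refine ih.forall hg hg' ?_ u hu v hv
      rintro rfl
      simp [hgx] at hx

/-- Properties that hold for single points and are preserved when two sets with close points are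
joined hold for the components. -/
theorem components_induction {P : List (List ℤ) → ℕ → Prop} {D : ℕ} (hsingle : ∀ x, P [x] 0)
    (hjoin : ∀ x y l g l' n m, x ∈ l → y ∈ g → x.length = d → close p B x y = true →
      (∀ u ∈ l', u ∈ l ∨ u ∈ g) → P l n → P g m → P l' (n + m + D))
    {W : List (List ℤ)} (hW : ∀ u ∈ W, u.length = d) :
    ∀ g ∈ components p B W, P g ((g.length - 1) * D) := by
  induction W with
  | nil => simp [components]
  | cons x W ih =>
    have hx := hW x List.mem_cons_self
    specialize ih fun u hu => hW u (List.mem_cons_of_mem _ hu)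
    rw [components_cons]
    intro g hg
    rcases List.mem_cons.1 hg with rfl | hg
    · rw [List.length_cons, Nat.add_sub_cancel]
      -- The components are joined to `x` one at a time. Each brings (|g| - 1)·D of its own plus `D`
      -- for the join, in total |g|·D.
      have : ∀ M : List (List (List ℤ)), (∀ g ∈ M, (g.any fun y => close p B x y) = true ∧
          P g ((g.length - 1) * D)) → P (x :: M.flatten) (M.flatten.length * D) := by
        intro M
        induction M with
        | nil => simpa using hsingle x
        | cons g M ihM =>
          intro hM
          have h1 := ihM fun g hg => hM g (List.mem_cons_of_mem _ hg)
          obtain ⟨h2, h3⟩ := hM g List.mem_cons_self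
          obtain ⟨y, hy, hc⟩ := List.any_eq_true.1 h2
          have h4 := List.length_pos_of_mem hy
          have h5 := hjoin x y _ g (x :: (g :: M).flatten) _ _ List.mem_cons_self hy hx hc
            (fun u hu => by
              simp only [List.flatten_cons, List.mem_cons, List.mem_append] at hu ⊢
              tauto) h1 h3
          have h6 : M.flatten.length * D + (g.length - 1) * D + D =
              (g :: M).flatten.length * D := by
            rw [List.flatten_cons, List.length_append]
            obtain ⟨c, hc⟩ := Nat.exists_eq_add_of_lt h4
            rw [hc, show 0 + c + 1 - 1 = c by omega]
            ring
          rwa [h6] at h5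
      refine this _ fun g hg => ?_
      obtain ⟨hg, hgx⟩ := List.mem_filter.1 hg
      exact ⟨hgx, ih g hg⟩
    · exact ih g (List.mem_of_mem_filter hg)

/-- The spread in one coordinate adds up under joining, with at most `2 * B` for the connecting
close pair. -/
theorem natAbs_sub_le_of_mem_components {W : List (List ℤ)} (hW : ∀ u ∈ W, u.length = d)
    {g : List (List ℤ)} (hg : g ∈ components p B W) {u v : List ℤ} (hu : u ∈ g) (hv : v ∈ g)
    {h : ℕ} (hh : h < d) : (u.getD h 0 - v.getD h 0).natAbs ≤ (g.length - 1) * (2 * B) := by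
  refine components_induction (p := p) (B := B) (D := 2 * B)
    (P := fun l n => ∀ u ∈ l, ∀ v ∈ l, (u.getD h 0 - v.getD h 0).natAbs ≤ n) ?_ ?_ hW g hg u hu v hv
  · intro x u hu v hv
    rw [List.mem_singleton.1 hu, List.mem_singleton.1 hv]
    simp
  · intro x y l g l' n m hx hy hxd hc hl' hl hg u hu v hv
    have h1 := ((close_iff hxd).1 hc).2 h hh
    rcases hl' u hu with hu | hu <;> rcases hl' v hv with hv | hv
    · have := hl u hu v hv
      omega
    · have := hl u hu x hx
      have := hg y hy v hv
      omega
    · have := hl x hx v hv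
      have := hg u hu y hy
      omega
    · have := hg u hu v hv
      omega

/-- The coordinates in which the points of a list do not agree. -/
def varying (d : ℕ) (l : List (List ℤ)) : Finset ℕ :=
  (range d).filter fun h => ∃ u ∈ l, ∃ v ∈ l, u.getD h 0 ≠ v.getD h 0

theorem mem_varying {l : List (List ℤ)} {h : ℕ} :
    h ∈ varying d l ↔ h < d ∧ ∃ u ∈ l, ∃ v ∈ l, u.getD h 0 ≠ v.getD h 0 := by
  simp [varying]

/-- A coordinate that varies after a join varied in one of the parts or separates the connecting
close pair, which differs in at most `B ^ max p 1` coordinates. -/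
theorem card_varying_le {W : List (List ℤ)} (hW : ∀ u ∈ W, u.length = d)
    {g : List (List ℤ)} (hg : g ∈ components p B W) :
    (varying d g).card ≤ (g.length - 1) * B ^ max p 1 := by
  refine components_induction (p := p) (B := B) (D := B ^ max p 1)
    (P := fun l n => (varying d l).card ≤ n) ?_ ?_ hW g hg
  · intro x
    rw [Nat.le_zero, card_eq_zero, eq_empty_iff_forall_notMem]
    intro h hh
    obtain ⟨_, u, hu, v, hv, hne⟩ := mem_varying.1 hh
    rw [List.mem_singleton.1 hu, List.mem_singleton.1 hv] at hne
    exact hne rfl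
  · intro x y l g l' n m hx hy hxd hc hl' hl hg
    have h1 := ((close_iff hxd).1 hc).1
    have h2 : varying d l' ⊆ varying d l ∪ varying d g ∪
        (range d).filter fun h => x.getD h 0 ≠ y.getD h 0 := by
      intro h hh
      obtain ⟨hd, u, hu, v, hv, hne⟩ := mem_varying.1 hh
      by_contra hcon
      simp only [mem_union, mem_varying, mem_filter, mem_range, hd, true_and, not_or, not_exists,
        not_and, not_not] at hcon
      obtain ⟨⟨hcl, hcg⟩, hxy⟩ := hcon
      have key : ∀ u ∈ l', u.getD h 0 = x.getD h 0 := fun u hu => by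
        rcases hl' u hu with hu | hu
        · exact hcl u hu x hx
        · rw [hcg u hu y hy, hxy]
      exact hne ((key u hu).trans (key v hv).symm)
    have h3 := card_le_card h2
    have h4 := card_union_le (varying d l ∪ varying d g)
      ((range d).filter fun h => x.getD h 0 ≠ y.getD h 0)
    have h5 := card_union_le (varying d l) (varying d g)
    omega

theorem componentOf_spec (p B : ℕ) {W : List (List ℤ)} {u : List ℤ} (hu : u ∈ W) :
    ∃ h : (componentOf (components p B W) u).2 < (components p B W).length,
      (components p B W)[(componentOf (components p B W) u).2] =
        (componentOf (components p B W) u).1 ∧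
      u ∈ (componentOf (components p B W) u).1 := by
  set G := components p B W
  have h1 : u ∈ G.flatten := (components_flatten_perm p B W).symm.subset hu
  obtain ⟨g, hg, hug⟩ := List.mem_flatten.1 h1
  obtain ⟨c, hc, rfl⟩ := List.mem_iff_getElem.1 hg
  have h2 : (G[c], c) ∈ G.zipIdx.filter fun z => z.1.any fun v => decide (v = u) := by
    rw [List.mem_filter]
    refine ⟨?_, by simpa using hug⟩
    rw [List.mk_mem_zipIdx_iff_getElem?]
    simp [hc]
  have h3 : componentOf G u ∈ G.zipIdx.filter fun z => z.1.any fun v => decide (v = u) := by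
    unfold componentOf
    cases hl : G.zipIdx.filter fun z => z.1.any fun v => decide (v = u) with
    | nil => rw [hl] at h2; simp at h2
    | cons a l => simp
  obtain ⟨h4, h5⟩ := List.mem_filter.1 h3
  rw [List.mem_zipIdx_iff_getElem?] at h4
  obtain ⟨h6, h7⟩ := List.getElem?_eq_some_iff.1 h4
  exact ⟨h6, h7, by simpa using h5⟩

theorem componentOf_eq_of_snd_eq {W : List (List ℤ)} {u v : List ℤ} (hu : u ∈ W) (hv : v ∈ W)
    (h : (componentOf (components p B W) u).2 = (componentOf (components p B W) v).2) :
    componentOf (components p B W) u = componentOf (components p B W) v := by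
  obtain ⟨h1, h2, _⟩ := componentOf_spec p B hu
  obtain ⟨h3, h4, _⟩ := componentOf_spec p B hv
  refine Prod.ext ?_ h
  rw [← h2, ← h4]
  simp only [h]

theorem componentOf_eq_of_close {W : List (List ℤ)} (hW : ∀ u ∈ W, u.length = d) {u v : List ℤ}
    (hu : u ∈ W) (hv : v ∈ W) (hc : close p B u v = true) :
    componentOf (components p B W) u = componentOf (components p B W) v := by
  obtain ⟨h1, h2, hu'⟩ := componentOf_spec p B hu
  obtain ⟨h3, h4, hv'⟩ := componentOf_spec p B hv
  have h5 := List.pairwise_iff_getElem.1 (components_pairwise p B hW)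
  refine componentOf_eq_of_snd_eq hu hv ?_
  rcases lt_trichotomy (componentOf (components p B W) u).2 (componentOf (components p B W) v).2
    with hlt | heq | hlt
  · exact absurd hc (h5 _ _ h1 h3 hlt u (h2 ▸ hu') v (h4 ▸ hv')).1
  · exact heq
  · exact absurd hc (h5 _ _ h3 h1 hlt v (h4 ▸ hv') u (h2 ▸ hu')).2

theorem head_componentOf_mem (p B : ℕ) {W : List (List ℤ)} {u : List ℤ} (hu : u ∈ W) :
    (componentOf (components p B W) u).1.headD [] ∈ (componentOf (components p B W) u).1 := by
  obtain ⟨_, _, h⟩ := componentOf_spec p B hu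
  cases hl : (componentOf (components p B W) u).1 with
  | nil => rw [hl] at h; simp at h
  | cons a l => simp

theorem componentOf_fst_mem (p B : ℕ) {W : List (List ℤ)} {u : List ℤ} (hu : u ∈ W) :
    (componentOf (components p B W) u).1 ∈ components p B W := by
  obtain ⟨h1, h2, _⟩ := componentOf_spec p B hu
  exact h2 ▸ List.getElem_mem h1

theorem length_le_of_mem_components {W : List (List ℤ)} {g : List (List ℤ)}
    (hg : g ∈ components p B W) : g.length ≤ W.length := by
  rw [← (components_flatten_perm p B W).length_eq]
  exact (List.sublist_flatten_of_mem hg).length_le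

theorem length_components_le (p B : ℕ) (W : List (List ℤ)) : (components p B W).length ≤ W.length := by
  rw [← (components_flatten_perm p B W).length_eq, List.length_flatten]
  have h := List.length_le_sum_of_one_le ((components p B W).map List.length) (by
    intro i hi
    obtain ⟨g, hg, rfl⟩ := List.mem_map.1 hi
    exact List.length_pos_of_ne_nil (components_ne_nil p B W g hg))
  simpa using h

theorem natAbs_relCoord_le {W : List (List ℤ)} (hW : ∀ u ∈ W, u.length = d) {u : List ℤ}
    (hu : u ∈ W) {h : ℕ} (hh : h < d) :
    (relCoord (components p B W) u h).natAbs ≤ W.length * (2 * B) := by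
  refine (natAbs_sub_le_of_mem_components hW (componentOf_fst_mem p B hu) (componentOf_spec p B hu).2.2
    (head_componentOf_mem p B hu) hh).trans (Nat.mul_le_mul_right _ ?_)
  exact (Nat.sub_le _ _).trans (length_le_of_mem_components (componentOf_fst_mem p B hu))

theorem mem_usedCoords {G : List (List (List ℤ))} {W : List (List ℤ)} (hW : ∀ u ∈ W, u.length = d)
    {h : ℕ} : h ∈ usedCoords G W ↔ h < d ∧ ∃ u ∈ W, relCoord G u h ≠ 0 := by
  unfold usedCoords
  cases W with
  | nil => simp
  | cons a W =>
    have := hW a List.mem_cons_self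
    rw [List.mem_filter, List.headD_cons, this, List.mem_range, List.any_eq_true]
    simp only [Bool.not_eq_true', decide_eq_false_iff_not, ne_eq]

theorem usedCoords_nodup (G : List (List (List ℤ))) (W : List (List ℤ)) : (usedCoords G W).Nodup :=
  List.nodup_range.filter _

/-- A nonzero relative coordinate varies within its component, so the bounds for the components are
summed. -/
theorem length_usedCoords_le {W : List (List ℤ)} (hW : ∀ u ∈ W, u.length = d) :
    (usedCoords (components p B W) W).length ≤ W.length * B ^ max p 1 := by
  rw [← List.toFinset_card_of_nodup (usedCoords_nodup _ _)]
  have h1 : ∀ G : List (List (List ℤ)),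
      (∀ g ∈ G, (varying d g).card ≤ (g.length - 1) * B ^ max p 1) →
      ((range d).filter fun h => ∃ g ∈ G, h ∈ varying d g).card ≤ G.flatten.length * B ^ max p 1 := by
    intro G
    induction G with
    | nil => simp
    | cons g G ih =>
      intro hG
      have h1 := ih fun g hg => hG g (List.mem_cons_of_mem _ hg)
      have h2 := hG g List.mem_cons_self
      have h3 : ((range d).filter fun h => ∃ g' ∈ g :: G, h ∈ varying d g') ⊆
          varying d g ∪ (range d).filter fun h => ∃ g ∈ G, h ∈ varying d g := by
        intro h
        simp only [mem_filter, mem_union, List.mem_cons, exists_eq_or_imp]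
        tauto
      have h4 := (card_le_card h3).trans (card_union_le _ _)
      rw [List.flatten_cons, List.length_append, add_mul]
      have h5 : (g.length - 1) * B ^ max p 1 ≤ g.length * B ^ max p 1 :=
        Nat.mul_le_mul_right _ (Nat.sub_le _ _)
      omega
  rw [← (components_flatten_perm p B W).length_eq]
  refine (card_le_card fun h hh => ?_).trans (h1 _ fun g hg => card_varying_le hW hg)
  obtain ⟨hd, u, hu, hne⟩ := (mem_usedCoords hW).1 (List.mem_toFinset.1 hh)
  refine mem_filter.2 ⟨mem_range.2 hd, _, componentOf_fst_mem p B hu, mem_varying.2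
    ⟨hd, u, (componentOf_spec p B hu).2.2, _, head_componentOf_mem p B hu, ?_⟩⟩
  exact fun heq => hne (sub_eq_zero.2 heq)

end Components

end EqualClustering

/-! ### Ranks, new coordinates and preservation of cheap costs -/

namespace EqualClustering

open Finset

theorem length_filter_lt {α : Type} {P Q : α → Bool} {l : List α} (hPQ : ∀ x, P x = true → Q x = true)
    {x : α} (hx : x ∈ l) (hQ : Q x = true) (hP : ¬ P x = true) :
    (l.filter P).length < (l.filter Q).length := by
  have h1 : l.filter P = (l.filter Q).filter P := by
    rw [List.filter_filter]
    refine List.filter_congr fun y _ => ?_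
    cases hy : P y
    · simp
    · simp [hPQ y hy]
  rw [h1, List.length_filter_lt_length_iff_exists]
  exact ⟨x, List.mem_filter.2 ⟨hx, hQ⟩, hP⟩

section Rank

variable {p d : ℕ} {V : List (List ℤ)}

theorem length_rankPoint (p : ℕ) (V : List (List ℤ)) (u : List ℤ) :
    (rankPoint p V u).length = u.length := by
  unfold rankPoint
  split_ifs <;> simp

theorem rankPoint_of_ne_zero (hp : p ≠ 0) (u : List ℤ) : rankPoint p V u = u := if_neg hp

theorem getD_rankPoint_zero {u : List ℤ} {h : ℕ} (hh : h < u.length) :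
    (rankPoint 0 V u).getD h 0 =
      ((V.filter fun v => decide (v.getD h 0 < u.getD h 0)).length : ℤ) := by
  simp [rankPoint, List.getD_eq_getElem?_getD, hh]

/-- A larger entry has strictly more entries below it, among them the smaller one. Hence ranks
preserve the pattern of equalities, which is all that p = 0 sees. -/
theorem getD_rankPoint_eq_iff {u v : List ℤ} (hu : u ∈ V) (hv : v ∈ V) {h : ℕ} (hhu : h < u.length)
    (hhv : h < v.length) :
    (rankPoint p V u).getD h 0 = (rankPoint p V v).getD h 0 ↔ u.getD h 0 = v.getD h 0 := by
  rcases eq_or_ne p 0 with rfl | hp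
  · have key : ∀ {u v : List ℤ}, u ∈ V → u.getD h 0 < v.getD h 0 →
        (V.filter fun w => decide (w.getD h 0 < u.getD h 0)).length <
          (V.filter fun w => decide (w.getD h 0 < v.getD h 0)).length := by
      intro u v hu hlt
      refine length_filter_lt (fun w hw => ?_) hu (by simpa using hlt) (by simp)
      simp only [decide_eq_true_eq] at hw ⊢
      exact hw.trans hlt
    rw [getD_rankPoint_zero hhu, getD_rankPoint_zero hhv, Nat.cast_inj]
    constructor
    · intro heq
      rcases lt_trichotomy (u.getD h 0) (v.getD h 0) with hlt | heq' | hlt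
      · exact absurd heq (key hu hlt).ne
      · exact heq'
      · exact absurd heq (key hv hlt).ne'
    · intro heq
      rw [heq]
  · rw [rankPoint_of_ne_zero hp, rankPoint_of_ne_zero hp]

/-- With at most 2B different points this makes the second condition for closeness automatic when p
= 0, and it keeps the new coordinates small. -/
theorem natAbs_rankPoint_sub_le (u v : List ℤ) {h : ℕ} (hhu : h < u.length) (hhv : h < v.length) :
    ((rankPoint 0 V u).getD h 0 - (rankPoint 0 V v).getD h 0).natAbs ≤ V.length := by
  rw [getD_rankPoint_zero hhu, getD_rankPoint_zero hhv]
  have h1 := List.length_filter_le (fun w : List ℤ => decide (w.getD h 0 < u.getD h 0)) V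
  have h2 := List.length_filter_le (fun w : List ℤ => decide (w.getD h 0 < v.getD h 0)) V
  omega

end Rank

section NewPoint

variable {p B : ℕ} {W : List (List ℤ)} {u : List ℤ} {t : ℕ}

theorem length_labelCoords_le (B : ℕ) (u : List ℤ) : (labelCoords B u).length ≤ B + 1 := by
  rw [labelCoords, List.length_cons, Nat.add_le_add_iff_right,
    ← List.toFinset_card_of_nodup (List.nodup_range.filter _)]
  refine (card_le_card fun h hh => ?_).trans (card_range B).le
  simpa using (List.mem_filter.1 (List.mem_toFinset.1 hh)).2

theorem le_length_labelCoords {B : ℕ} {u : List ℤ} (h : B ≤ u.length) :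
    B + 1 ≤ (labelCoords B u).length := by
  rw [labelCoords, List.length_cons, Nat.add_le_add_iff_right,
    ← List.toFinset_card_of_nodup (List.nodup_range.filter _)]
  refine (card_range B).symm.le.trans (card_le_card fun h hh => ?_)
  have := mem_range.1 hh
  simp
  omega

theorem length_newPoint (p B : ℕ) (W : List (List ℤ)) (u : List ℤ) : (newPoint p B W u).length =
    (usedCoords (components p B W) W).length + (labelCoords B u).length := by
  simp [newPoint]

theorem getD_newPoint_left (h : t < (usedCoords (components p B W) W).length) :
    (newPoint p B W u).getD t 0 =
      relCoord (components p B W) u ((usedCoords (components p B W) W)[t]) := by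
  rw [newPoint, List.getD_eq_getElem?_getD, List.getElem?_append_left (by simpa using h)]
  simp [h]

theorem getD_newPoint_right (h : (usedCoords (components p B W) W).length ≤ t)
    (h' : t < (newPoint p B W u).length) :
    (newPoint p B W u).getD t 0 =
      (((componentOf (components p B W) u).2 * (B + 1) : ℕ) : ℤ) := by
  rw [length_newPoint] at h'
  rw [newPoint, List.getD_eq_getElem?_getD, List.getElem?_append_right (by simpa using h)]
  rw [List.length_map, List.getElem?_map, List.getElem?_eq_getElem (by omega)]
  rfl

end NewPoint

/-- The reduced instance consists of the new points that correspond to the points `x i` of the given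
instance. -/
structure IsNewPoints (p : ℕ) (I I' : Instance) (emb : Fin I'.n ↪ Fin I.n) (X : List (List ℤ))
    (x : Fin I'.n → List ℤ) : Prop where
  length_eq : ∀ u ∈ X, u.length = I.d
  dedup_le : X.dedup.length ≤ 2 * I.B
  mem : ∀ i, x i ∈ X
  pts_eq : ∀ i h, I.pts (emb i) h = (x i).getD h 0
  new_eq : ∀ i t, I'.pts i t = (newPoint p I.B (X.dedup.map fun v => rankPoint p X.dedup v)
    (rankPoint p X.dedup (x i))).getD t 0
  dim_eq : ∀ i, (newPoint p I.B (X.dedup.map fun v => rankPoint p X.dedup v)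
    (rankPoint p X.dedup (x i))).length = I'.d

namespace IsNewPoints

variable {p : ℕ} {I I' : Instance} {emb : Fin I'.n ↪ Fin I.n} {X : List (List ℤ)}
  {x : Fin I'.n → List ℤ} (hN : IsNewPoints p I I' emb X x)
include hN

local notation "ranks" => List.map (fun v => rankPoint p (List.dedup X) v) (List.dedup X)

theorem length_ranks : ∀ u ∈ ranks, u.length = I.d := by
  intro u hu
  obtain ⟨v, hv, rfl⟩ := List.mem_map.1 hu
  rw [length_rankPoint, hN.length_eq v (List.mem_dedup.1 hv)]

theorem mem_ranks (i : Fin I'.n) : rankPoint p X.dedup (x i) ∈ ranks :=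
  List.mem_map_of_mem (List.mem_dedup.2 (hN.mem i))

theorem length_x (i : Fin I'.n) : (x i).length = I.d := hN.length_eq _ (hN.mem i)

theorem getD_rank_eq_iff (i j : Fin I'.n) (h : Fin I.d) :
    (rankPoint p X.dedup (x i)).getD h 0 = (rankPoint p X.dedup (x j)).getD h 0 ↔
      I.pts (emb i) h = I.pts (emb j) h := by
  rw [hN.pts_eq, hN.pts_eq]
  exact getD_rankPoint_eq_iff (List.mem_dedup.2 (hN.mem i)) (List.mem_dedup.2 (hN.mem j))
    (by rw [hN.length_x]; exact h.2) (by rw [hN.length_x]; exact h.2)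

theorem relCoord_sub {i j : Fin I'.n}
    (hij : componentOf (components p I.B ranks) (rankPoint p X.dedup (x i)) =
      componentOf (components p I.B ranks) (rankPoint p X.dedup (x j))) (h : Fin I.d) :
    (p ≠ 0 → relCoord (components p I.B ranks) (rankPoint p X.dedup (x i)) h -
      relCoord (components p I.B ranks) (rankPoint p X.dedup (x j)) h =
        I.pts (emb i) h - I.pts (emb j) h) ∧
    (relCoord (components p I.B ranks) (rankPoint p X.dedup (x i)) h =
      relCoord (components p I.B ranks) (rankPoint p X.dedup (x j)) h ↔
        I.pts (emb i) h = I.pts (emb j) h) := by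
  unfold relCoord
  rw [hij]
  refine ⟨fun hp => ?_, ?_⟩
  · rw [hN.pts_eq, hN.pts_eq, rankPoint_of_ne_zero hp, rankPoint_of_ne_zero hp]
    ring
  · rw [sub_left_inj]
    exact hN.getD_rank_eq_iff i j h

/-- Within one component, dropped coordinates and labels are constant, and the relative coordinates
are translates of the old ones or, for p = 0, show the same equalities. The comparison of medians is
then applied in both directions. -/
theorem clusterCost_eq_of_componentOf_eq {Y : Finset (Fin I'.n)}
    (hY : ∀ i ∈ Y, ∀ j ∈ Y,
      componentOf (components p I.B ranks) (rankPoint p X.dedup (x i)) =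
        componentOf (components p I.B ranks) (rankPoint p X.dedup (x j))) :
    clusterCost p I (Y.map emb) = clusterCost p I' Y := by
  rw [clusterCost_map]
  set M := usedCoords (components p I.B ranks) ranks with hM
  have hMd : ∀ {h}, h ∈ M → h < I.d := fun h => ((mem_usedCoords hN.length_ranks).1 h).1
  rcases Y.eq_empty_or_nonempty with rfl | ⟨i₀, hi₀⟩
  · simp [clusterCost]
  have hd' : M.length ≤ I'.d := by
    rw [← hN.dim_eq i₀, length_newPoint]
    exact Nat.le_add_right _ _
  refine le_antisymm (iInf_sum_lpDist_le
    (fun h => if hh : (h : ℕ) ∈ M then some ⟨M.idxOf (h : ℕ), (List.idxOf_lt_length_iff.2 hh).trans_le hd'⟩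
      else none) ?_ ?_ ?_)
    (iInf_sum_lpDist_le (fun t => if ht : (t : ℕ) < M.length then
      some ⟨M[(t : ℕ)], hMd (List.getElem_mem ht)⟩ else none) ?_ ?_ ?_)
  · intro h h' t ht ht'
    split_ifs at ht with hh
    split_ifs at ht' with hh'
    have h1 := Option.some_injective _ (ht.trans ht'.symm)
    exact Fin.ext (List.idxOf_inj hh |>.1 (Fin.mk.inj h1))
  · intro h ht i hi j hj
    split_ifs at ht with hh
    have h1 : ∀ i, relCoord (components p I.B ranks) (rankPoint p X.dedup (x i)) h = 0 := by
      intro i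
      by_contra hne
      exact hh ((mem_usedCoords hN.length_ranks).2 ⟨h.2, _, hN.mem_ranks i, hne⟩)
    exact (hN.relCoord_sub (hY i hi j hj) h).2.1 (by rw [h1, h1])
  · intro h t ht i hi j hj
    split_ifs at ht with hh
    have h2 := List.idxOf_lt_length_iff.2 hh
    have h3 : ∀ i, I'.pts i t = relCoord (components p I.B ranks) (rankPoint p X.dedup (x i)) h := by
      intro i
      rw [hN.new_eq, ← Option.some_injective _ ht, getD_newPoint_left h2]
      congr 1
      exact List.getElem_idxOf h2
    rw [h3, h3]
    have h4 := hN.relCoord_sub (hY i hi j hj) h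
    exact ⟨fun hp => (h4.1 hp).symm, h4.2.1⟩
  · intro t t' h ht ht'
    split_ifs at ht with hh
    split_ifs at ht' with hh'
    have h1 := Option.some_injective _ (ht.trans ht'.symm)
    exact Fin.ext ((usedCoords_nodup _ _).getElem_inj_iff.1 (Fin.mk.inj h1))
  · intro t ht i hi j hj
    split_ifs at ht with hh
    rw [hN.new_eq, hN.new_eq, getD_newPoint_right (not_lt.1 hh) (by rw [hN.dim_eq]; exact t.2),
      getD_newPoint_right (not_lt.1 hh) (by rw [hN.dim_eq]; exact t.2), hY i hi j hj]
  · intro t h ht i hi j hj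
    split_ifs at ht with hh
    have h1 : (h : ℕ) = M[(t : ℕ)] := by rw [← Option.some_injective _ ht]
    have h3 : ∀ i, I'.pts i t = relCoord (components p I.B ranks) (rankPoint p X.dedup (x i)) h := by
      intro i
      rw [hN.new_eq, getD_newPoint_left hh, h1]
    rw [h3, h3]
    have h4 := hN.relCoord_sub (hY i hi j hj) h
    exact ⟨h4.1, h4.2.2⟩

theorem close_iff_card {i j : Fin I'.n} :
    close p I.B (rankPoint p X.dedup (x i)) (rankPoint p X.dedup (x j)) = true ↔
      (univ.filter fun h => I.pts (emb i) h ≠ I.pts (emb j) h).card ≤ I.B ^ max p 1 ∧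
      (p ≠ 0 → ∀ h, (I.pts (emb i) h - I.pts (emb j) h).natAbs ≤ 2 * I.B) := by
  have h1 : ((range I.d).filter fun h => (rankPoint p X.dedup (x i)).getD h 0 ≠
      (rankPoint p X.dedup (x j)).getD h 0).card =
        (univ.filter fun h => I.pts (emb i) h ≠ I.pts (emb j) h).card := by
    rw [← card_map Fin.valEmbedding]
    congr 1
    ext h
    simp only [mem_filter, mem_range, mem_map, mem_univ, true_and, Fin.valEmbedding_apply]
    constructor
    · rintro ⟨hh, hne⟩
      exact ⟨⟨h, hh⟩, fun heq => hne ((hN.getD_rank_eq_iff i j ⟨h, hh⟩).2 heq), rfl⟩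
    · rintro ⟨h, hne, rfl⟩
      exact ⟨h.2, fun heq => hne ((hN.getD_rank_eq_iff i j h).1 heq)⟩
  rw [close_iff (hN.length_ranks _ (hN.mem_ranks i)), h1]
  refine and_congr_right fun _ => ?_
  constructor
  · intro hc hp h
    have := hc h h.2
    rwa [rankPoint_of_ne_zero hp, rankPoint_of_ne_zero hp, ← hN.pts_eq, ← hN.pts_eq] at this
  · intro hc h hh
    rcases eq_or_ne p 0 with rfl | hp
    · refine (natAbs_rankPoint_sub_le _ _ ?_ ?_).trans hN.dedup_le <;> rwa [hN.length_x]
    · rw [rankPoint_of_ne_zero hp, rankPoint_of_ne_zero hp]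
      have := hc hp ⟨h, hh⟩
      rwa [hN.pts_eq, hN.pts_eq] at this

/-- Points of a cheap cluster are within distance `B` of each other, hence close, hence in one
component. -/
theorem cost_map_eq {Y : Finset (Fin I'.n)} (hB : clusterCost p I (Y.map emb) ≤ I.B) :
    clusterCost p I (Y.map emb) = clusterCost p I' Y := by
  refine hN.clusterCost_eq_of_componentOf_eq fun i hi j hj => ?_
  refine componentOf_eq_of_close hN.length_ranks (hN.mem_ranks i) (hN.mem_ranks j)
    (hN.close_iff_card.2 ?_)
  have h1 := (lpDist_le_clusterCost (p := p) (mem_map_of_mem emb hi) (mem_map_of_mem emb hj)).trans hB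
  refine ⟨card_ne_le_of_dist_le h1, fun hp h => ?_⟩
  have h2 := (abs_sub_le_lpDist hp _ _ h).trans h1
  have h3 : |I.pts (emb i) h - I.pts (emb j) h| ≤ (I.B : ℤ) := by
    unfold pt at h2
    exact_mod_cast h2
  rw [abs_le] at h3
  omega

/-- The labels would put points of different components at distance more than `B`, which a cheap
cluster of new points does not allow. -/
theorem cost_eq_map {Y : Finset (Fin I'.n)} (hB : clusterCost p I' Y ≤ I.B) :
    clusterCost p I (Y.map emb) = clusterCost p I' Y := by
  refine hN.clusterCost_eq_of_componentOf_eq fun i hi j hj => ?_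
  by_contra hne
  have h1 := (lpDist_le_clusterCost (p := p) hi hj).trans hB
  set M := usedCoords (components p I.B ranks) ranks with hM
  have hlab : ∀ i, (labelCoords I.B (rankPoint p X.dedup (x i))).length + M.length = I'.d := by
    intro i
    rw [← hN.dim_eq i, length_newPoint, add_comm]
  have hne' : (componentOf (components p I.B ranks) (rankPoint p X.dedup (x i))).2 ≠
      (componentOf (components p I.B ranks) (rankPoint p X.dedup (x j))).2 := fun heq =>
    hne (componentOf_eq_of_snd_eq (hN.mem_ranks i) (hN.mem_ranks j) heq)
  have hpts : ∀ i (t : Fin I'.d), M.length ≤ t → I'.pts i t =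
      (((componentOf (components p I.B ranks) (rankPoint p X.dedup (x i))).2 * (I.B + 1) : ℕ) : ℤ) := by
    intro i t ht
    rw [hN.new_eq, getD_newPoint_right ht (by rw [hN.dim_eq]; exact t.2)]
  -- For p = 0 size is irrelevant, so `B + 1` differing label coordinates are needed; for p ≥ 1 a
  -- single one suffices, as labels are multiples of `B + 1`.
  rcases eq_or_ne p 0 with rfl | hp
  · by_cases hdB : I.B ≤ I.d
    · have h2 := card_ne_le_of_dist_le h1
      have h3 := le_length_labelCoords (B := I.B) (u := rankPoint 0 X.dedup (x i))
        (by rwa [length_rankPoint, hN.length_x])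
      have h4 : (univ.filter fun t : Fin I'.d => M.length ≤ t) ⊆
          univ.filter fun h => I'.pts i h ≠ I'.pts j h := by
        intro t ht
        have ht := (mem_filter.1 ht).2
        refine mem_filter.2 ⟨mem_univ _, ?_⟩
        rw [hpts i t ht, hpts j t ht, Ne, Nat.cast_inj]
        intro heq
        exact hne' (Nat.eq_of_mul_eq_mul_right (Nat.succ_pos _) heq)
      have h5 := card_le_card h4
      have h6 : (univ.filter fun t : Fin I'.d => M.length ≤ t).card = I'.d - M.length := by
        rw [← card_map Fin.valEmbedding, ← Nat.card_Ico]
        congr 1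
        ext t
        simp only [mem_map, mem_filter, mem_univ, true_and, Fin.valEmbedding_apply, mem_Ico]
        constructor
        · rintro ⟨t, ht, rfl⟩
          exact ⟨ht, t.2⟩
        · rintro ⟨h1, h2⟩
          exact ⟨⟨t, h2⟩, h1, rfl⟩
      have h7 := hlab i
      simp only [zero_le, sup_of_le_right, pow_one] at h2
      omega
    -- In dimension less than `B` any two points differ in fewer than `B` coordinates, so all are
    -- close and the missing labels are not needed.
    · refine hne (componentOf_eq_of_close hN.length_ranks (hN.mem_ranks i) (hN.mem_ranks j)
        (hN.close_iff_card.2 ⟨?_, fun hp => absurd rfl hp⟩))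
      refine (card_filter_le _ _).trans ?_
      rw [card_univ, Fintype.card_fin]
      simp only [zero_le, sup_of_le_right, pow_one]
      omega
  · have h2 : M.length < I'.d := by
      have := hlab i
      rw [labelCoords, List.length_cons] at this
      omega
    have h3 := (abs_sub_le_lpDist hp _ _ ⟨M.length, h2⟩).trans h1
    have h4 : |I'.pts i ⟨M.length, h2⟩ - I'.pts j ⟨M.length, h2⟩| ≤ (I.B : ℤ) := by
      unfold pt at h3
      exact_mod_cast h3
    rw [hpts i _ le_rfl, hpts j _ le_rfl, abs_le] at h4
    rcases lt_or_gt_of_ne hne' with hlt | hlt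
    · have h5 := Nat.mul_le_mul_right (I.B + 1) (Nat.succ_le_of_lt hlt)
      rw [Nat.succ_mul] at h5
      omega
    · have h5 := Nat.mul_le_mul_right (I.B + 1) (Nat.succ_le_of_lt hlt)
      rw [Nat.succ_mul] at h5
      omega

theorem dim_le (i : Fin I'.n) : I'.d ≤ 2 * I.B * I.B ^ max p 1 + (I.B + 1) := by
  rw [← hN.dim_eq i, length_newPoint]
  refine add_le_add ((length_usedCoords_le hN.length_ranks).trans (Nat.mul_le_mul_right _ ?_))
    (length_labelCoords_le _ _)
  rw [List.length_map]
  exact hN.dedup_le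

theorem natAbs_pts_le (i : Fin I'.n) (t : Fin I'.d) :
    (I'.pts i t).natAbs ≤ 2 * I.B * (2 * I.B + 1) := by
  have h1 : (ranks).length ≤ 2 * I.B := by rw [List.length_map]; exact hN.dedup_le
  rw [hN.new_eq]
  by_cases ht : (t : ℕ) < (usedCoords (components p I.B ranks) ranks).length
  · rw [getD_newPoint_left ht]
    refine (natAbs_relCoord_le hN.length_ranks (hN.mem_ranks i)
      ((mem_usedCoords hN.length_ranks).1 (List.getElem_mem ht)).1).trans ?_
    exact Nat.mul_le_mul h1 (Nat.le_succ _)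
  · rw [getD_newPoint_right (not_lt.1 ht) (by rw [hN.dim_eq]; exact t.2), Int.natAbs_natCast]
    obtain ⟨h2, _⟩ := componentOf_spec p I.B (hN.mem_ranks i)
    have h3 := length_components_le p I.B ranks
    exact Nat.mul_le_mul (by omega) (by omega)

end IsNewPoints

end EqualClustering

/-! ### The tagged list describes a grouping and a pruning -/

namespace EqualClustering

open Finset

section Lists

variable {β : Type}

theorem ofFn_getD {l : List β} {n : ℕ} (h : l.length = n) (a : β) :
    List.ofFn (fun i : Fin n => l.getD i a) = l := by
  subst h
  refine List.ext_getElem (by simp) fun i h1 h2 => ?_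
  simp

theorem length_filter_ofFn {n : ℕ} (f : Fin n → β) (P : β → Bool) :
    ((List.ofFn f).filter P).length = (univ.filter fun i => P (f i) = true).card := by
  induction n with
  | zero => simp
  | succ n ih =>
    rw [List.ofFn_succ, List.filter_cons, Fin.card_filter_univ_succ]
    have := ih fun i => f i.succ
    split_ifs with h
    · rw [List.length_cons, this]
    · exact this

theorem occ_ofFn [DecidableEq β] {n : ℕ} (y : β) (f : Fin n → β) :
    occ y (List.ofFn f) = (univ.filter fun i => f i = y).card := by
  rw [occ, length_filter_ofFn]
  simp

theorem zipIdx_ofFn {n : ℕ} (f : Fin n → β) :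
    (List.ofFn f).zipIdx = List.ofFn fun i => (f i, (i : ℕ)) := by
  refine List.ext_getElem (by simp) fun i h1 h2 => ?_
  simp

theorem zip_ofFn {γ : Type} {n : ℕ} (f : Fin n → β) (g : Fin n → γ) :
    (List.ofFn f).zip (List.ofFn g) = List.ofFn fun i => (f i, g i) := by
  refine List.ext_getElem (by simp) fun i h1 h2 => ?_
  simp

/-- A finite set contains `min e _` elements that are preceded by less than `e` of its elements. -/
theorem card_filter_card_lt {n : ℕ} (S : Finset (Fin n)) (e : ℕ) :
    (S.filter fun j => (S.filter fun i => i < j).card < e).card = min e S.card := by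
  induction S using Finset.induction_on_max with
  | empty => simp
  | insert a s ha ih =>
    have hna : a ∉ s := fun h => lt_irrefl _ (ha a h)
    have h1 : ∀ j ∈ s, ((insert a s).filter fun i => i < j) = s.filter fun i => i < j := by
      intro j hj
      rw [filter_insert, if_neg (ha j hj).not_gt]
    have h2 : ((insert a s).filter fun i => i < a) = s := by
      rw [filter_insert, if_neg (lt_irrefl _), filter_true_of_mem ha]
    have h3 : (s.filter fun j => ((insert a s).filter fun i => i < j).card < e) =
        s.filter fun j => (s.filter fun i => i < j).card < e :=
      filter_congr fun j hj => by rw [h1 j hj]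
    rw [filter_insert, h2, h3, card_insert_of_notMem hna]
    split_ifs with h
    · rw [card_insert_of_notMem (fun h => hna (mem_filter.1 h).1), ih]
      omega
    · rw [ih]
      omega

end Lists

/-- The properties of the greedy grouping. -/
theorem tagPoints_spec {s : ℕ} (hs : 0 < s) (X : List (List ℤ)) :
    (∀ t, 1 ≤ t → t ≤ (tagPoints s X).2 →
      ((tagPoints s X).1.filter fun z => decide (z.2 = t)).length = s) ∧
    (∀ z ∈ (tagPoints s X).1, ∀ w ∈ (tagPoints s X).1, z.2 = w.2 → z.2 ≠ 0 → z.1 = w.1) ∧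
    ∀ x, occ (x, 0) (tagPoints s X).1 < s := by
  induction X with
  | nil =>
    refine ⟨fun t h1 h2 => ?_, by simp [tagPoints], fun x => by simpa [tagPoints, occ] using hs⟩
    simp only [tagPoints, List.foldr_nil] at h2
    omega
  | cons x X ih =>
    obtain ⟨ih1, ih2, ih3⟩ := ih
    have hle := (tagPoints_snd_le s X).2
    rw [tagPoints_cons]
    set T := (tagPoints s X).1
    set G := (tagPoints s X).2
    split_ifs with h
    · have hmem : ∀ z ∈ (((x, 0) :: T).map fun z => if z = (x, 0) then (x, G + 1) else z),
          z = (x, G + 1) ∨ (z ∈ T ∧ z ≠ (x, 0)) := by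
        intro z hz
        obtain ⟨w, hw, rfl⟩ := List.mem_map.1 hz
        split_ifs with hwx
        · exact Or.inl rfl
        · exact Or.inr ⟨(List.mem_cons.1 hw).resolve_left hwx, hwx⟩
      refine ⟨fun t h1 h2 => ?_, fun z hz w hw hzw h0 => ?_, fun y => ?_⟩
      · rw [List.filter_map, List.length_map]
        rcases Nat.lt_or_ge G t with hlt | hge
        · have : t = G + 1 := le_antisymm h2 hlt
          subst this
          rw [← h, occ]
          congr 1
          refine List.filter_congr fun z hz => ?_
          simp only [Function.comp]
          split_ifs with hzx
          · simp [hzx]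
          · have := hle z ((List.mem_cons.1 hz).resolve_left hzx)
            simp [hzx]
            omega
        · rw [← ih1 t h1 hge, List.filter_cons_of_neg]
          · congr 1
            refine List.filter_congr fun z hz => ?_
            simp only [Function.comp]
            split_ifs with hzx
            · simp only [hzx, decide_eq_decide]
              omega
            · rfl
          · simp
            omega
      · rcases hmem z hz with rfl | ⟨hz, _⟩ <;> rcases hmem w hw with rfl | ⟨hw, _⟩
        · rfl
        · have := hle w hw
          dsimp only at hzw
          omega
        · have := hle z hz
          dsimp only at hzw
          omega
        · exact ih2 z hz w hw hzw h0
      · rw [occ, List.filter_map, List.length_map]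
        refine lt_of_le_of_lt ?_ (ih3 y)
        rw [List.filter_cons_of_neg (by simp), occ, ← List.countP_eq_length_filter,
          ← List.countP_eq_length_filter]
        refine List.countP_mono_left fun z hz hzy => ?_
        simp only [Function.comp] at hzy
        split_ifs at hzy with hzx
        · simp at hzy
        · exact hzy
    · have hcons : ∀ (P : List ℤ × ℕ → Bool), ¬ P (x, 0) = true →
          (((x, 0) :: T).filter P).length = (T.filter P).length := fun P hP => by
        rw [List.filter_cons_of_neg hP]
      refine ⟨fun t h1 h2 => ?_, fun z hz w hw hzw h0 => ?_, fun y => ?_⟩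
      · rw [hcons _ (by simp; omega)]
        exact ih1 t h1 h2
      · rcases List.mem_cons.1 hz with rfl | hz
        · exact absurd rfl h0
        rcases List.mem_cons.1 hw with rfl | hw
        · exact absurd hzw h0
        exact ih2 z hz w hw hzw h0
      · by_cases hyx : y = x
        · subst hyx
          have h1 := ih3 y
          refine lt_of_le_of_ne ?_ h
          unfold occ at h1 ⊢
          rw [List.filter_cons_of_pos (by simp), List.length_cons]
          exact h1
        · have := ih3 y
          unfold occ at this ⊢
          rw [hcons _ (by simpa using fun h => hyx h.symm)]
          exact this

/-- The list of the points of an instance. -/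
def pointList (I : Instance) : List (List ℤ) := List.ofFn fun i => List.ofFn (I.pts i)

section Pruning

variable (I : Instance)

theorem length_pointList : (pointList I).length = I.n := by simp [pointList]

theorem clusterSize_pointList : clusterSize I.k (pointList I) = I.n / I.k := by
  rw [clusterSize, length_pointList]

/-- The tagged points of an instance. -/
def taggedList : List (List ℤ × ℕ) := (tagPoints (clusterSize I.k (pointList I)) (pointList I)).1

/-- The number of groups of an instance. -/
def groupCount : ℕ := (tagPoints (clusterSize I.k (pointList I)) (pointList I)).2

/-- The tagged point with a given index. -/
def tagged (i : Fin I.n) : List ℤ × ℕ := (taggedList I).getD i ([], 0)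

/-- The group of each point. -/
def groupOf (i : Fin I.n) : Option (Fin (groupCount I)) :=
  if h : 1 ≤ (tagged I i).2 ∧ (tagged I i).2 - 1 < groupCount I then
    some ⟨(tagged I i).2 - 1, h.2⟩ else none

/-- The deleted points. -/
def deleted : Finset (Fin I.n) :=
  univ.filter fun i =>
    isDeleted (excess I.k I.B (pointList I)) I.B (taggedList I) (tagged I i, i) = true

theorem length_taggedList : (taggedList I).length = I.n := by
  have := congrArg List.length (tagPoints_map_fst (clusterSize I.k (pointList I)) (pointList I))
  rwa [List.length_map, length_pointList] at this

theorem ofFn_tagged : List.ofFn (tagged I) = taggedList I := ofFn_getD (length_taggedList I) _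

variable {I}

theorem tagged_mem (i : Fin I.n) : tagged I i ∈ taggedList I := by
  rw [← ofFn_tagged]
  exact List.mem_ofFn.2 ⟨i, rfl⟩

theorem tagged_fst (i : Fin I.n) : (tagged I i).1 = List.ofFn (I.pts i) := by
  have h1 : List.ofFn (fun i => (tagged I i).1) = pointList I := by
    rw [← tagPoints_map_fst (clusterSize I.k (pointList I)) (pointList I)]
    change _ = (taggedList I).map Prod.fst
    rw [← ofFn_tagged, List.map_ofFn]
    rfl
  exact congrFun (List.ofFn_injective h1) i

theorem tagged_fst_eq_iff {i j : Fin I.n} :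
    (tagged I i).1 = (tagged I j).1 ↔ I.pts i = I.pts j := by
  rw [tagged_fst, tagged_fst, List.ofFn_inj]

theorem tagged_snd_le (i : Fin I.n) : (tagged I i).2 ≤ groupCount I :=
  (tagPoints_snd_le _ _).2 _ (tagged_mem i)

theorem groupOf_eq_none {i : Fin I.n} : groupOf I i = none ↔ (tagged I i).2 = 0 := by
  have := tagged_snd_le i
  unfold groupOf
  split_ifs with h
  · simp
    omega
  · simp
    omega

theorem groupOf_eq_some {i : Fin I.n} {t : Fin (groupCount I)} :
    groupOf I i = some t ↔ (tagged I i).2 = t + 1 := by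
  have := tagged_snd_le i
  unfold groupOf
  split_ifs with h
  · rw [Option.some.injEq, Fin.ext_iff]
    dsimp only
    omega
  · simp
    omega

theorem tagged_eq_iff {i j : Fin I.n} :
    tagged I i = (List.ofFn (I.pts j), 0) ↔ groupOf I i = none ∧ I.pts i = I.pts j := by
  rw [Prod.ext_iff, groupOf_eq_none, tagged_fst, List.ofFn_inj, and_comm]

theorem occ_taggedList (i : Fin I.n) :
    occ (List.ofFn (I.pts i), 0) (taggedList I) = (copies I (openPoints (groupOf I)) i).card := by
  rw [← ofFn_tagged, occ_ofFn]
  congr 1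
  ext j
  rw [mem_copies, mem_openPoints, mem_filter, tagged_eq_iff]
  simp

theorem isPruning (hs : 0 < I.n / I.k) :
    IsPruning I (groupOf I) (excess I.k I.B (pointList I)) (deleted I) := by
  have hs' : 0 < clusterSize I.k (pointList I) := by rwa [clusterSize_pointList]
  obtain ⟨h1, h2, h3⟩ := tagPoints_spec hs' (pointList I)
  refine ⟨⟨fun t => ?_, fun i j t hi hj => ?_⟩, hs, ?_, fun i => ?_, fun i hi => ?_, fun i => ?_⟩
  · have := h1 (t + 1) (by omega) t.2
    change ((taggedList I).filter _).length = _ at this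
    rw [← ofFn_tagged, length_filter_ofFn, clusterSize_pointList] at this
    rw [← this]
    congr 1
    ext i
    simp [groupOf_eq_some]
  · rw [groupOf_eq_some] at hi hj
    exact tagged_fst_eq_iff.1 (h2 _ (tagged_mem i) _ (tagged_mem j) (hi.trans hj.symm) (by omega))
  · rw [excess, clusterSize_pointList]
  · have := h3 (List.ofFn (I.pts i))
    change occ _ (taggedList I) < _ at this
    rwa [occ_taggedList, clusterSize_pointList] at this
  · rw [mem_openPoints, groupOf_eq_none]
    have := (mem_filter.1 hi).2
    rw [isDeleted, decide_eq_true_iff] at this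
    exact this.1
  · set e := excess I.k I.B (pointList I)
    set S := copies I (openPoints (groupOf I)) i with hS
    have hmem : ∀ {j}, j ∈ S ↔ tagged I j = (List.ofFn (I.pts i), 0) := fun {j} => by
      rw [tagged_eq_iff, hS, mem_copies, mem_openPoints]
    -- The rank of a point among its open copies; the deleted ones are those of rank less than `e`.
    have hrank : ∀ j ∈ S, ((taggedList I).zipIdx.filter fun w =>
        decide (w.1 = tagged I j ∧ w.2 < (j : ℕ))).length = (S.filter fun l => l < j).card := by
      intro j hj
      rw [← ofFn_tagged, zipIdx_ofFn, length_filter_ofFn]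
      congr 1
      ext l
      simp only [mem_filter, mem_univ, true_and, decide_eq_true_eq, hmem, hmem.1 hj, Fin.lt_def]
    have hdel : copies I (deleted I) i =
        S.filter fun j => e + I.B + 1 ≤ S.card ∧ (S.filter fun l => l < j).card < e := by
      ext j
      rw [mem_copies, mem_filter, deleted, mem_filter]
      simp only [mem_univ, true_and, isDeleted, decide_eq_true_eq]
      constructor
      · rintro ⟨⟨h4, h5, h6⟩, h7⟩
        have hj : j ∈ S := hmem.2 (tagged_eq_iff.2 ⟨groupOf_eq_none.2 h4, h7⟩)
        rw [hrank j hj] at h6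
        rw [hmem.1 hj, occ_taggedList] at h5
        exact ⟨hj, h5, h6⟩
      · rintro ⟨hj, h5, h6⟩
        have h7 := hmem.1 hj
        refine ⟨⟨by rw [h7], ?_, ?_⟩, (tagged_eq_iff.1 h7).2⟩
        · rw [h7, occ_taggedList]
          exact h5
        · rw [hrank j hj]
          exact h6
    rw [hdel]
    split_ifs with hbig
    · simp only [hbig, true_and]
      rw [card_filter_card_lt]
      omega
    · simp [hbig]

end Pruning

end EqualClustering

/-! ### The retained points as an embedded subfamily -/

namespace EqualClustering

open Finset

section Kernel

variable (I : Instance)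

/-- The retained indexed points of an instance. -/
def kernelList : List ((List ℤ × ℕ) × ℕ) := kernelPoints I.k I.B (pointList I)

/-- The retained points of an instance. -/
def keptPoints : List (List ℤ) := (kernelList I).map fun z => z.1.1

variable {I}

theorem kernelList_eq : kernelList I = (List.ofFn fun i => (tagged I i, (i : ℕ))).filter fun z =>
    decide (z.1.2 = 0 ∧
      ¬ isDeleted (excess I.k I.B (pointList I)) I.B (taggedList I) z = true) := by
  rw [← zipIdx_ofFn, ofFn_tagged]
  rfl

theorem mem_retained_iff {i : Fin I.n} : i ∈ openPoints (groupOf I) \ deleted I ↔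
    (tagged I i).2 = 0 ∧ ¬ isDeleted (excess I.k I.B (pointList I)) I.B (taggedList I)
      (tagged I i, (i : ℕ)) = true := by
  rw [mem_sdiff, mem_openPoints, groupOf_eq_none, deleted, mem_filter]
  simp

theorem mem_kernelList {z : (List ℤ × ℕ) × ℕ} : z ∈ kernelList I ↔
    ∃ i ∈ openPoints (groupOf I) \ deleted I, z = (tagged I i, (i : ℕ)) := by
  rw [kernelList_eq, List.mem_filter, List.mem_ofFn, decide_eq_true_iff]
  constructor
  · rintro ⟨⟨i, rfl⟩, h⟩
    exact ⟨i, mem_retained_iff.2 h, rfl⟩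
  · rintro ⟨i, hi, rfl⟩
    exact ⟨⟨i, rfl⟩, mem_retained_iff.1 hi⟩

theorem kernelList_nodup : (kernelList I).Nodup := by
  rw [kernelList_eq]
  exact (List.nodup_ofFn.2 fun i j hij => Fin.ext (Prod.ext_iff.1 hij).2).filter _

theorem exists_kernelList_getElem (i : Fin (kernelList I).length) :
    ∃ j : Fin I.n, (kernelList I)[i] = (tagged I j, (j : ℕ)) := by
  obtain ⟨j, _, hj⟩ := mem_kernelList.1 (List.getElem_mem i.2)
  exact ⟨j, hj⟩

variable (I) in
/-- The index of a retained point. -/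
noncomputable def kernelEmb : Fin (kernelList I).length ↪ Fin I.n where
  toFun i := (exists_kernelList_getElem i).choose
  inj' i j hij := by
    have h1 := (exists_kernelList_getElem i).choose_spec
    have h2 := (exists_kernelList_getElem j).choose_spec
    dsimp only at hij
    rw [hij, ← h2] at h1
    exact Fin.ext (kernelList_nodup.getElem_inj_iff.1 h1)

theorem kernelList_getElem (i : Fin (kernelList I).length) :
    (kernelList I)[i] = (tagged I (kernelEmb I i), (kernelEmb I i : ℕ)) :=
  (exists_kernelList_getElem i).choose_spec

theorem kernelList_eq_ofFn :
    kernelList I = List.ofFn fun i => (tagged I (kernelEmb I i), (kernelEmb I i : ℕ)) := by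
  simp only [← kernelList_getElem]
  exact (List.ofFn_getElem (α := (List ℤ × ℕ) × ℕ)).symm

theorem map_kernelEmb : univ.map (kernelEmb I) = openPoints (groupOf I) \ deleted I := by
  ext i
  rw [mem_map]
  constructor
  · rintro ⟨j, _, rfl⟩
    obtain ⟨l, hl, h⟩ := mem_kernelList.1 (List.getElem_mem j.2)
    have h1 := (kernelList_getElem j).symm.trans h
    rwa [Fin.ext (Prod.ext_iff.1 h1).2]
  · intro hi
    have h1 := mem_kernelList.2 ⟨i, hi, rfl⟩
    rw [kernelList_eq_ofFn, List.mem_ofFn] at h1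
    obtain ⟨j, hj⟩ := h1
    exact ⟨j, mem_univ _, Fin.ext (Prod.ext_iff.1 hj).2⟩

theorem keptPoints_eq : keptPoints I = List.ofFn fun i => List.ofFn (I.pts (kernelEmb I i)) := by
  refine (congrArg (List.map fun z : (List ℤ × ℕ) × ℕ => z.1.1) kernelList_eq_ofFn).trans ?_
  rw [List.map_ofFn]
  congr 1
  funext i
  exact tagged_fst _

end Kernel

/-! ### The reduced instance -/

section Reduction

variable (p : ℕ) (I : Instance)

/-- Whether the reduced instance is not the trivial one. -/
def Reducible : Prop := isReducible I.k I.B (pointList I) = true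

instance : Decidable (Reducible I) := inferInstanceAs (Decidable (_ = true))

variable {I} in
theorem reducible_iff : Reducible I ↔ 1 ≤ newK I.k (pointList I) ∧ newK I.k (pointList I) ≤ I.B ∧
    (kernelList I).length =
      newK I.k (pointList I) * (I.n / I.k - excess I.k I.B (pointList I)) ∧
    (keptPoints I).dedup.length ≤ 2 * I.B := by
  rw [Reducible, isReducible, clusterSize_pointList]
  simp only [Bool.and_eq_true, decide_eq_true_eq, and_assoc]
  rfl

/-- The nontrivial reduced instance. -/
def properReduction (h : Reducible I) : Instance where
  d := ((newPoints p I.B (keptPoints I)).headD []).length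
  n := (kernelList I).length
  pts i t := ((newPoints p I.B (keptPoints I)).getD i []).getD t 0
  k := newK I.k (pointList I)
  k_pos := (reducible_iff.1 h).1
  k_dvd := Dvd.intro _ (reducible_iff.1 h).2.2.1.symm
  B := I.B

variable {I} in
/-- The index of a point of the reduced instance in the given instance. -/
noncomputable def reductionEmb (h : Reducible I) : Fin (properReduction p I h).n ↪ Fin I.n :=
  kernelEmb I

/-- An instance without points. -/
def emptyInstance : Instance where
  d := 0
  n := 0
  pts i := i.elim0
  k := 1
  k_pos := one_pos
  k_dvd := one_dvd _
  B := 0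

/-- The reduction. -/
def reduction : Instance := if h : Reducible I then properReduction p I h else emptyInstance

variable {p I}

theorem length_newPoint_eq {B : ℕ} {W : List (List ℤ)} {u v : List ℤ} (h : u.length = v.length) :
    (newPoint p B W u).length = (newPoint p B W v).length := by
  rw [length_newPoint, length_newPoint, labelCoords, labelCoords, h]

theorem isNewPoints (h : Reducible I) : IsNewPoints p I (properReduction p I h) (reductionEmb p h)
    (keptPoints I) (fun i => List.ofFn (I.pts (reductionEmb p h i))) := by
  have hmem : ∀ i : Fin (kernelList I).length,
      List.ofFn (I.pts (kernelEmb I i)) ∈ keptPoints I := fun i => by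
    rw [keptPoints_eq]
    exact List.mem_ofFn.2 ⟨i, rfl⟩
  have hlen : ∀ u ∈ keptPoints I, u.length = I.d := by
    intro u hu
    rw [keptPoints_eq] at hu
    obtain ⟨i, rfl⟩ := List.mem_ofFn.1 hu
    simp
  refine ⟨hlen, (reducible_iff.1 h).2.2.2, hmem, fun i t => ?_, fun i t => ?_, fun i => ?_⟩
  · simp
  · change ((newPoints p I.B (keptPoints I)).getD i []).getD t 0 = _
    have hi : (i : ℕ) < (keptPoints I).length := by
      rw [keptPoints, List.length_map]
      exact i.2
    have h1 : (keptPoints I)[(i : ℕ)] = List.ofFn (I.pts (kernelEmb I i)) := by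
      simp only [keptPoints_eq, List.getElem_ofFn]
      rfl
    rw [newPoints, List.getD_eq_getElem?_getD (l := List.map _ _), List.getElem?_map, List.getElem?_eq_getElem hi, h1]
    rfl
  · change _ = ((newPoints p I.B (keptPoints I)).headD []).length
    have h1 := hmem i
    have h2 := hlen _ h1
    rw [newPoints]
    cases hk : keptPoints I with
    | nil => rw [hk] at h1; simp at h1
    | cons u l =>
      rw [List.map_cons, List.headD_cons]
      refine length_newPoint_eq ?_
      rw [length_rankPoint, length_rankPoint]
      exact h2.trans (hlen u (by rw [hk]; exact List.mem_cons_self)).symm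

theorem isKernelization (h : Reducible I) (hs : 0 < I.n / I.k) :
    IsKernelization p I (properReduction p I h) (groupOf I) (excess I.k I.B (pointList I)) (deleted I)
      (reductionEmb p h) where
  toIsPruning := isPruning hs
  k_eq := by
    have h1 := (reducible_iff.1 h).1
    change newK I.k (pointList I) + groupCount I = I.k
    unfold newK at h1 ⊢
    unfold groupCount
    omega
  n_eq := by
    change (kernelList I).length / newK I.k (pointList I) = _
    rw [(reducible_iff.1 h).2.2.1, Nat.mul_div_cancel_left _ (reducible_iff.1 h).1]
  map_eq := map_kernelEmb
  cost_map_le Y hY := ((isNewPoints h).cost_eq_map hY).le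
  cost_le_map Y hY := ((isNewPoints h).cost_map_eq hY).ge

end Reduction

/-! ### The lifted clustering -/

section Lifting

variable {I : Instance}

/-- The list of the clusters of the points. -/
def assignList (K : Clustering I) : List ℕ := List.ofFn fun i => (K.assign i : ℕ)

/-- A list describes an equal clustering. -/
structure IsAssignment (I : Instance) (l : List ℕ) : Prop where
  length_eq : l.length = I.n
  lt : ∀ j ∈ l, j < I.k
  occ_le : ∀ j ∈ l, occ j l ≤ I.n / I.k

theorem isAssignment_liftLists (I : Instance) (K : List ℕ) :
    IsAssignment I (liftLists I.k I.B (pointList I) K) := by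
  unfold liftLists
  split_ifs with h
  · rw [List.all_eq_true] at h
    simp only [decide_eq_true_eq, clusterSize_pointList] at h
    refine ⟨?_, fun j hj => (h j hj).1, fun j hj => (h j hj).2⟩
    rw [liftPref, List.length_map, List.length_zipIdx]
    exact length_taggedList I
  · refine ⟨by rw [List.length_map, List.length_range, length_pointList], fun j hj => ?_,
      fun j _ => ?_⟩
    · obtain ⟨i, _, rfl⟩ := List.mem_map.1 hj
      exact Nat.mod_lt _ I.k_pos
    · rw [occ, List.filter_map, List.length_map, length_pointList,
        ← List.toFinset_card_of_nodup (List.nodup_range.filter _)]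
      have h1 : I.n = I.k * (I.n / I.k) := (Nat.mul_div_cancel' I.k_dvd).symm
      conv_rhs => rw [← card_range (I.n / I.k)]
      -- Indices with the same remainder modulo `k` are distinguished by their quotients, which are
      -- less than `n / k`.
      refine card_le_card_of_injOn (fun i => i / I.k) (fun i hi => ?_) fun i hi i' hi' heq => ?_
      · have hi : i < I.n ∧ i % I.k = j := by simpa using hi
        rw [mem_coe, mem_range]
        exact Nat.div_lt_of_lt_mul (h1 ▸ hi.1)
      · have hi : i < I.n ∧ i % I.k = j := by simpa using hi
        have hi' : i' < I.n ∧ i' % I.k = j := by simpa using hi'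
        dsimp only at heq
        rw [← Nat.div_add_mod i I.k, ← Nat.div_add_mod i' I.k, heq, hi.2, hi'.2]

/-- The clustering that is described by a list. -/
def clusteringOfList (l : List ℕ) (h : IsAssignment I l) : Clustering I where
  assign i := ⟨l.getD i 0, h.lt _ (by
    have hi : (i : ℕ) < l.length := by rw [h.length_eq]; exact i.2
    rw [List.getD_eq_getElem l 0 hi]
    exact List.getElem_mem hi)⟩
  card_eq := by
    have hle : ∀ j : Fin I.k, (univ.filter fun i : Fin I.n => l.getD i 0 = (j : ℕ)).card ≤ I.n / I.k := by
      intro j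
      have h1 : occ (j : ℕ) l = (univ.filter fun i : Fin I.n => l.getD i 0 = (j : ℕ)).card := by
        conv_lhs => rw [← ofFn_getD h.length_eq 0]
        exact occ_ofFn _ _
      by_cases hj : (j : ℕ) ∈ l
      · rw [← h1]
        exact h.occ_le _ hj
      · rw [← h1, occ, List.filter_eq_nil_iff.2]
        · exact Nat.zero_le _
        · intro i hi
          simp only [decide_eq_true_eq]
          rintro rfl
          exact hj hi
    have hfib : ∀ j : Fin I.k, (univ.filter fun i : Fin I.n => (⟨l.getD i 0, h.lt _ (by
        have hi : (i : ℕ) < l.length := by rw [h.length_eq]; exact i.2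
        rw [List.getD_eq_getElem l 0 hi]
        exact List.getElem_mem hi)⟩ : Fin I.k) = j).card ≤ I.n / I.k := by
      intro j
      refine le_trans (le_of_eq ?_) (hle j)
      congr 1
      ext i
      simp [Fin.ext_iff]
    have hsum : ∑ j : Fin I.k, (univ.filter fun i : Fin I.n => (⟨l.getD i 0, h.lt _ (by
        have hi : (i : ℕ) < l.length := by rw [h.length_eq]; exact i.2
        rw [List.getD_eq_getElem l 0 hi]
        exact List.getElem_mem hi)⟩ : Fin I.k) = j).card = ∑ _j : Fin I.k, I.n / I.k := by
      rw [← card_eq_sum_card_fiberwise fun _ _ => mem_univ _]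
      simp [Nat.mul_div_cancel' I.k_dvd]
    intro j
    -- The `k` cluster sizes are at most `n / k` and add up to `n`, so all are equal to `n / k`.
    exact (sum_eq_sum_iff_of_le fun j _ => hfib j).1 hsum j (mem_univ j)

theorem assignList_clusteringOfList (l : List ℕ) (h : IsAssignment I l) :
    assignList (clusteringOfList l h) = l := ofFn_getD h.length_eq 0

theorem assignList_injective : Function.Injective (assignList (I := I)) := by
  rintro ⟨a, ha⟩ ⟨b, hb⟩ h
  have h1 := List.ofFn_injective h
  have : a = b := funext fun i => Fin.ext (congrFun h1 i)
  subst this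
  rfl

/-- The solution-lifting algorithm. -/
def lift (I : Instance) {I' : Instance} (K' : Clustering I') : Clustering I :=
  clusteringOfList _ (isAssignment_liftLists I (assignList K'))

/-- A search returns the intended cluster if something is found and all hits agree, whatever their
order. -/
theorem headD_eq {β : Type} {l : List β} {a b : β} (hne : ∃ x, x ∈ l) (h : ∀ x ∈ l, x = a) :
    l.headD b = a := by
  cases l with
  | nil => simp at hne
  | cons x l => exact h x List.mem_cons_self

/-- The hypotheses determine the cluster of every point: grouped points by `h1`, retained ones by
`h2`, deleted ones by the count in `h3`. The searches of the algorithm evaluate exactly these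
descriptions. -/
theorem liftCluster_eq {I' : Instance} {emb : Fin I'.n ↪ Fin I.n} (hk : I'.k = newK I.k (pointList I))
    (hemb : kernelPoints I.k I.B (pointList I) =
      List.ofFn fun i' => (tagged I (emb i'), (emb i' : ℕ)))
    (hmap : univ.map emb = openPoints (groupOf I) \ deleted I) {K' : Clustering I'}
    {K : Clustering I}
    (h1 : ∀ i t, groupOf I i = some t → (K.assign i : ℕ) = I'.k + t)
    (h2 : ∀ i', (K.assign (emb i') : ℕ) = K'.assign i')
    (h3 : ∀ i ∈ deleted I, (∃ i', I.pts (emb i') = I.pts i ∧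
        I.B + 1 ≤ (clusterCopies I emb K' i i').card) ∧
      ∀ i', I.B + 1 ≤ (clusterCopies I emb K' i i').card →
        (K.assign i : ℕ) = K'.assign i')
    (i : Fin I.n) :
    liftCluster I.k I.B (pointList I) (assignList K') (tagged I i, (i : ℕ)) = K.assign i := by
  have hzip : (kernelPoints I.k I.B (pointList I)).zip (assignList K') =
      List.ofFn fun i' : Fin I'.n =>
        ((tagged I (emb i'), (emb i' : ℕ)), (K'.assign i' : ℕ)) := by
    rw [hemb]
    exact zip_ofFn _ _
  unfold liftCluster
  rw [hzip]
  split_ifs with ha hb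
  · have hi : i ∈ deleted I := mem_filter.2 ⟨mem_univ _, hb⟩
    have hcount : ∀ i' : Fin I'.n,
        ((List.ofFn fun i' : Fin I'.n =>
          ((tagged I (emb i'), (emb i' : ℕ)), (K'.assign i' : ℕ))).filter fun w =>
            decide (w.1.1.1 = (tagged I i).1 ∧ w.2 = (K'.assign i' : ℕ))).length =
          (clusterCopies I emb K' i i').card := by
      intro i'
      rw [length_filter_ofFn, clusterCopies]
      congr 1
      ext l
      simp only [mem_filter, mem_univ, true_and, decide_eq_true_eq, tagged_fst_eq_iff, Fin.val_inj]
    refine headD_eq ?_ fun c hc => ?_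
    · obtain ⟨i', hi', hc'⟩ := (h3 i hi).1
      refine ⟨K'.assign i', List.mem_map.2 ⟨((tagged I (emb i'), (emb i' : ℕ)),
        (K'.assign i' : ℕ)), List.mem_filter.2 ⟨List.mem_ofFn.2 ⟨i', rfl⟩, ?_⟩, rfl⟩⟩
      rw [decide_eq_true_iff]
      refine ⟨tagged_fst_eq_iff.2 hi', ?_⟩
      exact hc'.trans (hcount i').ge
    · obtain ⟨w, hw, rfl⟩ := List.mem_map.1 hc
      obtain ⟨hw, hw'⟩ := List.mem_filter.1 hw
      obtain ⟨i', rfl⟩ := List.mem_ofFn.1 hw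
      rw [decide_eq_true_iff] at hw'
      exact ((h3 i hi).2 i' (hw'.2.trans (hcount i').le)).symm
  · have hi : i ∈ univ.map emb := by
      rw [hmap]
      exact mem_retained_iff.2 ⟨ha, hb⟩
    obtain ⟨i', _, rfl⟩ := mem_map.1 hi
    rw [h2 i']
    refine headD_eq ?_ fun c hc => ?_
    · exact ⟨K'.assign i', List.mem_map.2 ⟨((tagged I (emb i'), (emb i' : ℕ)),
        (K'.assign i' : ℕ)), List.mem_filter.2 ⟨List.mem_ofFn.2 ⟨i', rfl⟩, by simp⟩, rfl⟩⟩
    · obtain ⟨w, hw, rfl⟩ := List.mem_map.1 hc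
      obtain ⟨hw, hw'⟩ := List.mem_filter.1 hw
      obtain ⟨l, rfl⟩ := List.mem_ofFn.1 hw
      rw [decide_eq_true_iff] at hw'
      have : l = i' := emb.injective (Fin.ext hw')
      rw [this]
  · have h4 := tagged_snd_le i
    have h5 : groupOf I i = some ⟨(tagged I i).2 - 1, by dsimp only at ha; omega⟩ := by
      rw [groupOf_eq_some]
      dsimp only at ha ⊢
      omega
    rw [h1 i _ h5, hk]

theorem lift_eq {I' : Instance} {K' : Clustering I'} {K : Clustering I}
    (h : ∀ i, liftCluster I.k I.B (pointList I) (assignList K') (tagged I i, (i : ℕ)) = K.assign i) :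
    lift I K' = K := by
  have h1 : liftPref I.k I.B (pointList I) (assignList K') = assignList K := by
    unfold liftPref
    change (taggedList I).zipIdx.map _ = _
    rw [← ofFn_tagged, zipIdx_ofFn, List.map_ofFn, assignList]
    congr 1
    funext i
    exact h i
  apply assignList_injective
  rw [lift, assignList_clusteringOfList, liftLists, h1, if_pos]
  rw [List.all_eq_true]
  intro j hj
  obtain ⟨i, rfl⟩ := List.mem_ofFn.1 hj
  rw [decide_eq_true_iff, clusterSize_pointList]
  refine ⟨(K.assign i).2, ?_⟩
  rw [assignList, occ_ofFn, ← K.card_eq (K.assign i)]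
  simp only [Fin.val_inj]
  exact le_rfl

/-- Cheap clusterings of the reduced instance are lifted to clusterings that are not more
expensive. -/
theorem cost_lift_le {p : ℕ} (hr : Reducible I) (hs : 0 < I.n / I.k)
    (K' : Clustering (properReduction p I hr)) (hB : cost p _ K' ≤ I.B) :
    cost p I (lift I K') ≤ cost p _ K' := by
  obtain ⟨K, hK, h1, h2, h3⟩ := (isKernelization hr hs).exists_lift K' hB
  rwa [lift_eq (liftCluster_eq (I' := properReduction p I hr) (emb := reductionEmb p hr) rfl
    kernelList_eq_ofFn map_kernelEmb h1 h2 h3)]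

end Lifting

end EqualClustering

/-! ### Encodings and running time -/

namespace EqualClustering

open PolyModel LossyKernel
open Enc (enc)

section Encoding

/-- An instance as a tuple of lists and numbers. -/
def instanceTuple (I : Instance) : ℕ × ℕ × ℕ × List (List (List ℤ)) := (I.d, I.k, I.B, [pointList I])

/-- A list of four codes is a nested pair that ends in a list with one entry; this is why the points
are wrapped in a singleton. -/
theorem enc_instanceTuple (I : Instance) : enc (instanceTuple I) = encInstance I := by
  have h1 : enc (pointList I) =
      encList (List.ofFn fun i => encList (List.ofFn fun h => encInt (I.pts i h))) := by
    change encList ((pointList I).map enc) = _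
    rw [pointList, List.map_ofFn]
    congr 2
    funext i
    change encList ((List.ofFn (I.pts i)).map enc) = _
    rw [List.map_ofFn]
    rfl
  rw [instanceTuple, encInstance, ← h1]
  rfl

theorem enc_assignList {I : Instance} (K : Clustering I) : enc (assignList K) = encClustering I K := by
  change encList ((assignList K).map enc) = _
  rw [assignList, List.map_ofFn]
  rfl

theorem instanceTuple_reduction (p : ℕ) (I : Instance) :
    instanceTuple (reduction p I) = reduceLists p I.k I.B (pointList I) := by
  unfold reduction reduceLists
  split_ifs with h h' h'
  · have h1 : pointList (properReduction p I h) = newPoints p I.B (keptPoints I) := by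
      have hlen : (newPoints p I.B (keptPoints I)).length = (kernelList I).length := by
        rw [newPoints, List.length_map, keptPoints, List.length_map]
      rw [← ofFn_getD hlen [], pointList]
      congr 1
      funext i
      refine ofFn_getD ?_ 0
      have h2 := (isNewPoints (p := p) h).new_eq i
      have h3 := (isNewPoints (p := p) h).dim_eq i
      have h4 : (i : ℕ) < (keptPoints I).length := by
        rw [keptPoints, List.length_map]
        exact i.2
      rw [newPoints, List.getD_eq_getElem?_getD, List.getElem?_map, List.getElem?_eq_getElem h4]
      have h5 : (keptPoints I)[(i : ℕ)] = List.ofFn (I.pts (kernelEmb I i)) := by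
        simp only [keptPoints_eq, List.getElem_ofFn]
        rfl
      rw [h5]
      exact h3
    rw [instanceTuple, h1]
    rfl
  · exact absurd h h'
  · exact absurd h' h
  · rfl

theorem polyTime_reduction (p : ℕ) : PolyTime encInstance encInstance (reduction p) := by
  have h1 : IsPoly fun x : ℕ × ℕ × ℕ × List (List (List ℤ)) =>
      reduceLists p x.2.1 x.2.2.1 (x.2.2.2.headD []) := by fun_prop
  obtain ⟨P, q, h⟩ := h1
  refine ⟨P, q, fun I => ?_⟩
  have h2 := h (instanceTuple I)
  rw [enc_instanceTuple] at h2
  rw [← enc_instanceTuple (reduction p I), instanceTuple_reduction]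
  exact h2

/-- The retained points are recomputed from the original instance, so the code of the reduced
instance is skipped and `R` may be arbitrary. -/
theorem polyTime_lift (R : Instance → Instance) :
    PolyTime (fun a : (I : Instance) × Clustering (R I) =>
        .cons (encInstance a.1) (.cons (encInstance (R a.1)) (encClustering (R a.1) a.2)))
      (fun b : (I : Instance) × Clustering I => encClustering b.1 b.2)
      (fun a => ⟨a.1, lift a.1 a.2⟩) := by
  have h1 : IsPoly fun x : (ℕ × ℕ × ℕ × List (List (List ℤ))) ×
      (ℕ × ℕ × ℕ × List (List (List ℤ))) × List ℕ =>
      liftLists x.1.2.1 x.1.2.2.1 (x.1.2.2.2.headD []) x.2.2 := by fun_prop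
  obtain ⟨P, q, h⟩ := h1
  refine ⟨P, q, fun a => ?_⟩
  have h2 := h (instanceTuple a.1, instanceTuple (R a.1), assignList a.2)
  have h3 : enc (instanceTuple a.1, instanceTuple (R a.1), assignList a.2) =
      .cons (encInstance a.1) (.cons (encInstance (R a.1)) (encClustering (R a.1) a.2)) := by
    rw [← enc_instanceTuple, ← enc_instanceTuple, ← enc_assignList]
    rfl
  rw [h3] at h2
  dsimp only
  rw [← enc_assignList (lift a.1 a.2), lift, assignList_clusteringOfList]
  exact h2

end Encoding

/-! ### Size of the reduced instance -/

section Size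

theorem size_int_le (z : ℤ) : (enc z).size ≤ 4 * z.natAbs + 5 := by
  have h1 := size_nat_le_self z.natAbs
  change 1 + (encBool (decide (z < 0))).size + (enc z.natAbs).size ≤ _
  have h2 : (encBool (decide (z < 0))).size ≤ 3 := by
    cases decide (z < 0) <;> simp [encBool, Data.size]
  omega

theorem size_encInstance_le {I : Instance} {d k B n z : ℕ} (hd : I.d ≤ d) (hk : I.k ≤ k)
    (hB : I.B ≤ B) (hn : I.n ≤ n) (hz : ∀ i h, (I.pts i h).natAbs ≤ z) :
    (encInstance I).size ≤ 4 * d + 4 * k + 4 * B + (n * (d * (4 * z + 6) + 2) + 9) := by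
  have h1 : (enc (pointList I)).size ≤ n * ((d * ((4 * z + 5) + 1) + 1) + 1) + 1 := by
    refine size_le_of_forall ((length_pointList I).trans_le hn) fun u hu => ?_
    obtain ⟨i, rfl⟩ := List.mem_ofFn.1 hu
    refine size_le_of_forall (by simpa using hd) fun c hc => ?_
    obtain ⟨h, rfl⟩ := List.mem_ofFn.1 hc
    have := size_int_le (I.pts i h)
    have := hz i h
    omega
  have h2 := size_nat_le_self I.d
  have h3 := size_nat_le_self I.k
  have h4 := size_nat_le_self I.B
  rw [← enc_instanceTuple, instanceTuple, size_prod, size_prod, size_prod, size_cons, size_nil]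
  dsimp only
  have h5 : n * ((d * ((4 * z + 5) + 1) + 1) + 1) + 1 = n * (d * (4 * z + 6) + 2) + 1 := by ring
  omega

theorem reduction_bounds (p : ℕ) (I : Instance) :
    (reduction p I).n ≤ I.B * (2 * I.B + 1) ∧
    (reduction p I).d ≤ 2 * I.B * I.B ^ max p 1 + (I.B + 1) ∧
    (reduction p I).k ≤ I.B + 1 ∧ (reduction p I).B ≤ I.B ∧
    ∀ i h, ((reduction p I).pts i h).natAbs ≤ 2 * I.B * (2 * I.B + 1) := by
  by_cases hr : Reducible I
  · rw [show reduction p I = properReduction p I hr from dif_pos hr]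
    have hN := isNewPoints (p := p) hr
    obtain ⟨h1, h2, h3, h4⟩ := reducible_iff.1 hr
    have hn : (properReduction p I hr).n ≤ I.B * (2 * I.B + 1) := by
      change (kernelList I).length ≤ _
      rw [h3]
      refine Nat.mul_le_mul h2 ?_
      rw [excess, clusterSize_pointList]
      omega
    refine ⟨hn, ?_, (show newK I.k (pointList I) ≤ _ by omega), le_rfl, hN.natAbs_pts_le⟩
    -- The dimension is read off the first new point; without points it defaults to 0.
    rcases Nat.eq_zero_or_pos (kernelList I).length with h0 | h0
    · have h5 : kernelList I = [] := List.length_eq_zero_iff.1 h0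
      have h6 : (properReduction p I hr).d = 0 := by
        change ((newPoints p I.B (keptPoints I)).headD []).length = 0
        simp [newPoints, keptPoints, h5]
      rw [h6]
      exact Nat.zero_le _
    · exact hN.dim_le ⟨0, h0⟩
  · rw [show reduction p I = emptyInstance from dif_neg hr]
    exact ⟨Nat.zero_le _, Nat.zero_le _, Nat.le_add_left _ _, Nat.zero_le _, fun i => i.elim0⟩

end Size

/-! ### The approximation ratio -/

section Ratio

open Finset

variable {p : ℕ} {I : Instance}

instance : Nonempty (Clustering I) := ⟨clusteringOfList _ (isAssignment_liftLists I [])⟩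

theorem budgetCost_nonneg (K : Clustering I) : 0 ≤ budgetCost p I K := by
  unfold budgetCost
  split_ifs
  · exact cost_nonneg K
  · positivity

theorem budgetCost_le (K : Clustering I) : budgetCost p I K ≤ I.B + 1 := by
  unfold budgetCost
  split_ifs with h
  · linarith
  · exact le_rfl

theorem opt_le (K : Clustering I) : (problem p).opt I ≤ budgetCost p I K :=
  ciInf_le (Set.finite_range (budgetCost p I)).bddBelow K

theorem exists_budgetCost_eq_opt (p : ℕ) (I : Instance) :
    ∃ K : Clustering I, budgetCost p I K = (problem p).opt I :=
  exists_eq_ciInf_of_finite (f := budgetCost p I)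

theorem opt_nonneg (p : ℕ) (I : Instance) : 0 ≤ (problem p).opt I := by
  obtain ⟨K, hK⟩ := exists_budgetCost_eq_opt p I
  exact hK ▸ budgetCost_nonneg K

theorem one_le_ratio (K : Clustering I) : 1 ≤ (problem p).ratio I K := by
  unfold ParamMinProblem.ratio
  split_ifs with h
  · exact le_rfl
  · rw [one_le_div₀ (lt_of_le_of_ne (opt_nonneg p I) (Ne.symm h))]
    exact opt_le K

/-- If the optimum is positive and can be doubled within the budget, then the reduced instance is
not the trivial one. -/
theorem reducible_of_respectsGroups (hs : 0 < I.n / I.k) {K : Clustering I}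
    {π : Fin (groupCount I) → Fin I.k} (hK : RespectsGroups (groupOf I) K π) (hB : cost p I K ≤ I.B)
    (hpos : 0 < (problem p).opt I) : Reducible I := by
  have hP := isPruning hs
  have h1 : (univ.filter fun j => j ∉ Set.range π).card = newK I.k (pointList I) := by
    have := hK.card_notMem_range
    change _ = I.k - groupCount I
    omega
  rw [reducible_iff, ← h1]
  refine ⟨?_, hP.card_open_le hK hB, ?_, ?_⟩
  · rw [Nat.one_le_iff_ne_zero, Ne, card_eq_zero]
    intro h0
    have h2 : cost p I K = 0 := by rw [hP.cost_eq_sum_open hK, h0, sum_empty]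
    have h3 := opt_le (p := p) K
    rw [budgetCost, if_pos hB, h2] at h3
    exact absurd h3 (not_le.2 hpos)
  · rw [← hP.card_retained_eq hK hB, ← map_kernelEmb, card_map, card_univ, Fintype.card_fin]
  · refine le_trans ?_ (hP.card_image_open_le hK hB)
    rw [← List.card_toFinset]
    refine (card_le_card fun u hu => ?_).trans
      (card_image_le (s := (openPoints (groupOf I)).image I.pts) (f := List.ofFn))
    rw [List.mem_toFinset, keptPoints_eq] at hu
    obtain ⟨i, rfl⟩ := List.mem_ofFn.1 hu
    refine mem_image_of_mem _ (mem_image_of_mem _ ?_)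
    have : kernelEmb I i ∈ univ.map (kernelEmb I) := mem_map_of_mem _ (mem_univ i)
    rw [map_kernelEmb] at this
    exact (mem_sdiff.1 this).1

theorem cost_eq_zero_of_div_eq_zero (hs : I.n / I.k = 0) (K : Clustering I) : cost p I K = 0 := by
  refine sum_eq_zero fun j _ => clusterCost_eq_zero fun i hi => ?_
  have h1 := K.card_eq j
  rw [hs, card_eq_zero] at h1
  rw [h1] at hi
  exact absurd hi (notMem_empty i)

/-- Cheap solutions do not become more expensive; any other has the value `B + 1`, which no value
exceeds. -/
theorem budgetCost_lift_le (hr : Reducible I) (hs : 0 < I.n / I.k)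
    (K' : Clustering (properReduction p I hr)) :
    budgetCost p I (lift I K') ≤ budgetCost p _ K' := by
  by_cases h : cost p _ K' ≤ I.B
  · have h1 := cost_lift_le hr hs K' h
    rw [budgetCost, if_pos (h1.trans h), budgetCost, if_pos (show _ ≤ ((properReduction p I hr).B : ℝ)
      from h)]
    exact h1
  · have h1 : budgetCost p _ K' = (I.B : ℝ) + 1 := if_neg h
    rw [h1]
    exact budgetCost_le _

/-- Lifting does not increase values, and the optimum of the reduced instance is at most twice the
original one unless every solution is within a factor 2 anyway. The equation for `I'` is a
hypothesis so that the two forms of the reduced instance can be substituted. -/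
theorem ratio_lift_le {I' : Instance} (hI' : I' = reduction p I) (K' : Clustering I') :
    (problem p).ratio I (lift I K') ≤ 2 * (problem p).ratio I' K' := by
  have h1 := one_le_ratio (p := p) K'
  rcases (opt_nonneg p I).eq_or_lt with h0 | hpos
  · have h2 : (problem p).ratio I (lift I K') = 1 := if_pos h0.symm
    linarith
  have hratio : (problem p).ratio I (lift I K') =
      budgetCost p I (lift I K') / (problem p).opt I := if_neg hpos.ne'
  -- If the optimum is at least (B + 1)/2, the cap `B + 1` on values already gives ratio 2.
  by_cases h2 : (I.B : ℝ) + 1 ≤ 2 * (problem p).opt I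
  · have h3 : (problem p).ratio I (lift I K') ≤ 2 := by
      rw [hratio, div_le_iff₀ hpos]
      exact (budgetCost_le _).trans h2
    linarith
  rw [not_le] at h2
  obtain ⟨K, hK⟩ := exists_budgetCost_eq_opt p I
  have hKB : cost p I K ≤ I.B := by
    by_contra hcon
    rw [budgetCost, if_neg hcon] at hK
    linarith
  rw [budgetCost, if_pos hKB] at hK
  have hs : 0 < I.n / I.k := by
    rw [Nat.pos_iff_ne_zero]
    intro hs
    rw [cost_eq_zero_of_div_eq_zero hs] at hK
    exact hpos.ne hK
  obtain ⟨K₁, π, hK₁, hle, hB⟩ := (isPruning hs).exists_respectsGroups hs K hKB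
  rw [hK] at hle hB
  specialize hB h2
  have hr := reducible_of_respectsGroups hs hK₁ hB hpos
  obtain rfl : I' = properReduction p I hr := hI'.trans (dif_pos hr)
  obtain ⟨K₂, hK₂⟩ := (isKernelization (p := p) hr hs).exists_clustering_le hK₁ hB
  have h3 : (problem p).opt (properReduction p I hr) ≤ 2 * (problem p).opt I := by
    refine (opt_le K₂).trans ?_
    rw [budgetCost, if_pos (show _ ≤ ((properReduction p I hr).B : ℝ) from hK₂.trans hB)]
    exact hK₂.trans hle
  -- A solution of value 0 of the reduced instance would be lifted to one of the original instance,
  -- whose optimum is positive. This excludes the conventional ratio 1.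
  have h4 : 0 < (problem p).opt (properReduction p I hr) := by
    obtain ⟨K₃, hK₃⟩ := exists_budgetCost_eq_opt p (properReduction p I hr)
    rw [← hK₃]
    exact hpos.trans_le ((opt_le _).trans (budgetCost_lift_le hr hs K₃))
  have h5 : (problem p).ratio (properReduction p I hr) K' =
      budgetCost p _ K' / (problem p).opt (properReduction p I hr) := if_neg h4.ne'
  rw [hratio, h5, div_le_iff₀ hpos]
  have h6 : budgetCost p _ K' ≤ budgetCost p _ K' / (problem p).opt (properReduction p I hr) *
      (2 * (problem p).opt I) := by
    rw [div_mul_eq_mul_div, le_div_iff₀ h4]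
    exact mul_le_mul_of_nonneg_left h3 (budgetCost_nonneg K')
  have h7 := budgetCost_lift_le hr hs K'
  linarith

end Ratio

end EqualClustering

open EqualClustering LossyKernel in
theorem theorem1 (p : ℕ) :
    ∃ (R : Instance → Instance) (L : (I : Instance) → Clustering (R I) → Clustering I)
      (g : Polynomial ℕ) (C : ℕ),
      (problem p).IsApproxKernel 2 (fun b => g.eval b) R L ∧
      ∀ I : Instance,
        (R I).n ≤ C * (max I.B 1) ^ 2 ∧
        (R I).d ≤ C * (max I.B 1) ^ (p + 2) ∧
        ∀ (i : Fin (R I).n) (h : Fin (R I).d),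
          |(R I).pts i h| ≤ (C : ℤ) * ((max I.B 1 : ℕ) : ℤ) ^ 3 := by
  open Polynomial in
  let D : ℕ[X] := 2 * X * X ^ max p 1 + (X + 1)
  refine ⟨reduction p, fun I K' => lift I K',
    4 * D + 4 * (X + 1) + 4 * X + (X * (2 * X + 1) * (D * (4 * (2 * X * (2 * X + 1)) + 6) + 2) + 9) + X,
    -- The coordinates determine the constant: 2B(2B + 1) ≤ 6b². The number of points needs only 3b²
    -- and the dimension 4b^(p+2).
    6, ⟨polyTime_reduction p, polyTime_lift (reduction p), fun I => ?_,
      fun I K' => ratio_lift_le rfl K'⟩, fun I => ?_⟩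
  · obtain ⟨h1, h2, h3, h4, h5⟩ := reduction_bounds p I
    have h6 := size_encInstance_le h2 h3 h4 h1 h5
    simp only [D, eval_add, eval_mul, eval_pow, eval_X, eval_one, eval_ofNat]
    exact add_le_add h6 h4
  · obtain ⟨h1, h2, -, -, h5⟩ := reduction_bounds p I
    set b := max I.B 1
    have hB : I.B ≤ b := le_max_left _ _
    have hb : 1 ≤ b := le_max_right _ _
    have h6 : I.B * (2 * I.B + 1) ≤ 3 * b ^ 2 := by
      calc I.B * (2 * I.B + 1) ≤ b * (2 * b + b) := by gcongr
        _ = 3 * b ^ 2 := by ring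
    refine ⟨h1.trans (by omega), ?_, fun i h => ?_⟩
    · have h7 : I.B ^ max p 1 ≤ b ^ (p + 1) :=
        (Nat.pow_le_pow_left hB _).trans (Nat.pow_le_pow_right hb (by omega))
      have h8 : b ≤ b ^ (p + 2) := Nat.le_self_pow (by omega) b
      have h9 : 2 * I.B * I.B ^ max p 1 ≤ 2 * b ^ (p + 2) := by
        calc 2 * I.B * I.B ^ max p 1 ≤ 2 * b * b ^ (p + 1) := by gcongr
          _ = 2 * b ^ (p + 2) := by ring
      omega
    · have h7 : b ^ 2 ≤ b ^ 3 := Nat.pow_le_pow_right hb (by omega)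
      have h8 : ((reduction p I).pts i h).natAbs ≤ 6 * b ^ 3 := by
        refine (h5 i h).trans ?_
        rw [mul_assoc]
        omega
      rw [Int.abs_eq_natAbs]
      exact_mod_cast h8
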